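/- Let $Q$ be a smooth manifold (Hausdorff, finite-dimensional) with a nonholonomic system: a lagrangian $L(v)=\tfrac12\kappa(v,v)+U$ of mechanical type on $TQ$ ($\kappa$ a Riemannian metric, $U\in C^\infty(Q)$) and a smooth regular distribution $D\subseteq TQ$. Let $\mathcal M=\kappa^\flat(D)\subseteq T^*Q$ be the constraint submanifold, $\iota:\mathcal M\to T^*Q$ the inclusion, $\tau:\mathcal M\to Q$ the projection, $\Theta_{\mathcal M}=\iota^*\Theta_Q$ and $\Omega_{\mathcal M}=\iota^*\Omega_Q$ the pullbacks of the Liouville form and of the canonical 2-form $\Omega_Q=-d\Theta_Q$, and $\mathcal C_m=\{v\in T_m\mathcal M: T\tau(v)\in D_{\tau(m)}\}$. The nonholonomic bivector field $\pi_{nh}$ on $\mathcal M$ is given by $\pi_{nh}^\sharp(\alpha)=-X$ iff $X\in\mathcal C$ and $\mathbf i_X\Omega_{\mathcal M}|_{\mathcal C}=\alpha|_{\mathcal C}$; here $\beta(\pi^\sharp(\alpha))=\pi(\alpha,\beta)$. Let a Lie group $G$ with Lie algebra $\mathfrak g$ act smoothly, freely and properly on $Q$ so that the tangent lift preserves $L$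 and $D$; then $G$ acts on $\mathcal M$ by the cotangent lift. Let $\mathcal V_m$ be the tangent space of the $G$-orbit of $m$, let $\eta_{\mathcal M}$ be the infinitesimal generator of $\eta\in\mathfrak g$, and assume $T_m\mathcal M=\mathcal C_m+\mathcal V_m$ for all $m$. Let $\rho:\mathcal M\to\mathcal M/G$ be the orbit projection, where $\mathcal M/G$ has the smooth structure for which $\rho$ is a submersion. Let $\mathcal W\subseteq T\mathcal M$ be a smooth $G$-invariant distribution with $T\mathcal M=\mathcal C\oplus\mathcal W$ and $\mathcal W\subseteq\mathcal V$, with projections $P_{\mathcal C},P_{\mathcal W}$. Define the $\mathfrak g$-valued 1-form $\mathcal A_{\mathcal W}$ by $\mathcal A_{\mathcal W}(v)=\xi$ iff $P_{\mathcal W}(v)=\xi_{\mathcal M}(m)$ ($v\in T_m\mathcal M$), the $\mathcal W$-curvature $\mathcal K_{\mathcal W}(X,Y)=d\mathcal A_{\mathcal W}(P_{\mathcal C}X,P_{\mathcal C}Y)$, the momentum map $\mathcal J:\mathcal M\to\mathfrak g^*$, $\langle\mathcal J(m),\eta\rangle=\Theta_{\mathcal M}(\eta_{\mathcal M}(m))$,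 and the 3-form $$(d\mathcal J\wedge\mathcal K_{\mathcal W})(X,Y,Z)=\langle d\mathcal J(Z),\mathcal K_{\mathcal W}(X,Y)\rangle+\langle d\mathcal J(X),\mathcal K_{\mathcal W}(Y,Z)\rangle+\langle d\mathcal J(Y),\mathcal K_{\mathcal W}(Z,X)\rangle .$$ Let $B$ be a smooth $G$-invariant 2-form on $\mathcal M$ with $\mathbf i_ZB=0$ for all $Z\in\mathcal W$ and such that $\mathrm{Id}+B^\flat\circ\pi_{nh}^\sharp$ is invertible, and let $\pi_B^\sharp=\pi_{nh}^\sharp\circ(\mathrm{Id}+B^\flat\circ\pi_{nh}^\sharp)^{-1}$ be the gauge transformed bivector field. Then $\pi_B$ induces a smooth bivector field $\pi_{red}^B$ on $\mathcal M/G$ with $T\rho\circ\pi_B^\sharp\circ\rho^*=(\pi_{red}^B)^\sharp$, and $$\tfrac12[\pi_{red}^B,\pi_{red}^B]=-\pi_B^\sharp\bigl(dB+d\mathcal J\wedge\mathcal K_{\mathcal W}\bigr)\circ\rho^* ,$$ that is, for $m\in\mathcal M$ and covectors $\alpha,\beta,\gamma$ at $\rho(m)$, the left side at $(\alpha,\beta,\gamma)$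 equals the trivector $-\pi_B^\sharp(dB+d\mathcal J\wedge\mathcal K_{\mathcal W})$ at $(\rho^*\alpha,\rho^*\beta,\rho^*\gamma)$. Here $\pi^\sharp(\phi)(\alpha,\beta,\gamma)=(-1)^3\phi(\pi^\sharp\alpha,\pi^\sharp\beta,\pi^\sharp\gamma)$ for a 3-form $\phi$, and the Schouten bracket is normalised by $\tfrac12[\pi,\pi](df,dg,dh)=\{f,\{g,h\}\}+\{g,\{h,f\}\}+\{h,\{f,g\}\}$ for $\{f,g\}=\pi(df,dg)$. Moreover, the trivector $\psi_{\pi_B}(\alpha,\beta,\gamma)=\mathrm{cycl}\,[\gamma((\mathcal K_{\mathcal W}(\pi_B^\sharp\alpha,\pi_B^\sharp\beta))_{\mathcal M})]$ vanishes on covectors pulled back by $\rho$. -/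

import Mathlib

open scoped Manifold ContDiff Topology

noncomputable section

namespace NonholonomicGeometry

/-! ### Multilinear algebra on one vector space -/

section LinearAlgebra

variable {V : Type*} [NormedAddCommGroup V] [NormedSpace ℝ V]

/-- The map `B♭ : V → V*`, `B♭ X = i_X B = B(X, ·)`, of a 2-form `B` on `V`. -/
def flat (B : V [⋀^Fin 2]→L[ℝ] ℝ) : V →L[ℝ] V →L[ℝ] ℝ :=
  ((ContinuousAlternatingMap.ofSubsingletonLIE (𝕜 := ℝ) (E := V) (F := ℝ) (0 : Fin 1)).symm.toContinuousLinearEquiv :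
      (V [⋀^Fin 1]→L[ℝ] ℝ) →L[ℝ] (V →L[ℝ] ℝ)) ∘L B.curryLeft

theorem flat_apply (B : V [⋀^Fin 2]→L[ℝ] ℝ) (X Y : V) : flat B X Y = B ![X, Y] := by
  have h : flat B X Y = B (Matrix.vecCons X (fun _ => Y)) := rfl
  rw [h]
  congr 1
  ext i; fin_cases i <;> rfl

/-- The map `F → F*`, `X ↦ (i_X σ)|_F`, given by the restriction of a 2-form `σ` to the
subspace `F`. -/
def restrictedFlat (F : Submodule ℝ V) (σ : V [⋀^Fin 2]→L[ℝ] ℝ) : F →L[ℝ] F →L[ℝ] ℝ :=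
  (ContinuousLinearMap.precomp ℝ F.subtypeL) ∘L flat σ ∘L F.subtypeL

/-- The map `π♯ : V* → V` of the bivector determined by a subspace `F` and a 2-form `σ` with
nondegenerate restriction to `F`: `π♯ α = -X`, where `X ∈ F` and `(i_X σ)|_F = α|_F`. -/
def sharpOfPair (F : Submodule ℝ V) (σ : V [⋀^Fin 2]→L[ℝ] ℝ) : (V →L[ℝ] ℝ) →L[ℝ] V :=
  -(F.subtypeL ∘L (restrictedFlat F σ).inverse ∘L ContinuousLinearMap.precomp ℝ F.subtypeL)

/-- The defining property of `sharpOfPair`. -/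
theorem sharpOfPair_iff (F : Submodule ℝ V) (σ : V [⋀^Fin 2]→L[ℝ] ℝ)
    (h : (restrictedFlat F σ).IsInvertible) (α : V →L[ℝ] ℝ) (X : V) :
    sharpOfPair F σ α = -X ↔ X ∈ F ∧ ∀ Y ∈ F, σ ![X, Y] = α Y := by
  have key : sharpOfPair F σ α =
      -(((restrictedFlat F σ).inverse (ContinuousLinearMap.precomp ℝ F.subtypeL α) : F) : V) := rfl
  rw [key, neg_inj]
  constructor
  · rintro rfl
    refine ⟨Subtype.property _, fun Y hY => ?_⟩
    have h1 : restrictedFlat F σ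
        ((restrictedFlat F σ).inverse (ContinuousLinearMap.precomp ℝ F.subtypeL α)) =
        ContinuousLinearMap.precomp ℝ F.subtypeL α := (h.inverse_apply_eq.mp rfl).symm
    rw [← flat_apply]
    exact DFunLike.congr_fun h1 ⟨Y, hY⟩
  · rintro ⟨hX, hY⟩
    have h2 : (restrictedFlat F σ).inverse (ContinuousLinearMap.precomp ℝ F.subtypeL α) =
        ⟨X, hX⟩ := by
      rw [h.inverse_apply_eq]
      ext ⟨Y, hYF⟩
      exact ((flat_apply σ X Y).trans (hY Y hYF)).symm
    rw [h2]

/-- `Id + B♭ ∘ π♯` on `V*`. -/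
def gaugeEndo (π : (V →L[ℝ] ℝ) →L[ℝ] V) (B : V [⋀^Fin 2]→L[ℝ] ℝ) :
    (V →L[ℝ] ℝ) →L[ℝ] (V →L[ℝ] ℝ) :=
  ContinuousLinearMap.id ℝ (V →L[ℝ] ℝ) + flat B ∘L π

/-- The gauge transformation `π_B♯ = π♯ ∘ (Id + B♭ ∘ π♯)⁻¹` of a bivector by a 2-form. -/
def gaugeSharp (π : (V →L[ℝ] ℝ) →L[ℝ] V) (B : V [⋀^Fin 2]→L[ℝ] ℝ) : (V →L[ℝ] ℝ) →L[ℝ] V :=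
  π ∘L (gaugeEndo π B).inverse

/-- The trivector `π♯(φ)`, `π♯(φ)(α, β, γ) = (-1)³ φ(π♯ α, π♯ β, π♯ γ)`, of a 3-form `φ`. -/
def sharpThree (π : (V →L[ℝ] ℝ) →L[ℝ] V) (φ : V [⋀^Fin 3]→L[ℝ] ℝ) (α β γ : V →L[ℝ] ℝ) : ℝ :=
  (-1) ^ 3 * φ ![π α, π β, π γ]

variable {𝔤 : Type*} [NormedAddCommGroup 𝔤] [NormedSpace ℝ 𝔤]

/-- The 3-form `a ∧ K` built from a `𝔤*`-valued 1-form `a` and a `𝔤`-valued 2-form `K`;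
see `wedgeDual_apply`. -/
def wedgeDual (a : V →L[ℝ] 𝔤 →L[ℝ] ℝ) (K : V [⋀^Fin 2]→L[ℝ] 𝔤) : V [⋀^Fin 3]→L[ℝ] ℝ :=
  ContinuousAlternatingMap.alternatizeUncurryFin
    (((ContinuousLinearMap.compContinuousAlternatingMapCLM ℝ V 𝔤 ℝ (ι := Fin 2)).flip K) ∘L a)

theorem wedgeDual_apply (a : V →L[ℝ] 𝔤 →L[ℝ] ℝ) (K : V [⋀^Fin 2]→L[ℝ] 𝔤) (X Y Z : V) :
    wedgeDual a K ![X, Y, Z] = a Z (K ![X, Y]) + a X (K ![Y, Z]) + a Y (K ![Z, X]) := by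
  have h : K ![Z, X] = - K ![X, Z] := by
    have := K.toAlternatingMap.map_swap ![X, Z] (i := 0) (j := 1) (by decide)
    have e : ![X, Z] ∘ (Equiv.swap (0 : Fin 2) 1) = ![Z, X] := by
      ext i; fin_cases i <;> simp
    rw [e] at this
    exact this
  rw [wedgeDual, ContinuousAlternatingMap.alternatizeUncurryFin_apply, h]
  have e0 : Fin.removeNth 0 ![X, Y, Z] = ![Y, Z] := by
    ext i; fin_cases i <;> rfl
  have e1 : Fin.removeNth 1 ![X, Y, Z] = ![X, Z] := by
    ext i; fin_cases i <;> rfl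
  have e2 : Fin.removeNth 2 ![X, Y, Z] = ![X, Y] := by
    ext i; fin_cases i <;> rfl
  simp [Fin.sum_univ_three, e0, e1, e2]
  ring

end LinearAlgebra

/-! ### Forms, distributions and bivector fields on manifolds -/

section Manifolds

variable {E : Type*} [NormedAddCommGroup E] [NormedSpace ℝ E]
  {H : Type*} [TopologicalSpace H] (I : ModelWithCorners ℝ E H)
  {M : Type*} [TopologicalSpace M] [ChartedSpace H M]
  {F : Type*} [NormedAddCommGroup F] [NormedSpace ℝ F] {n : ℕ}

/-- The expression of an `F`-valued `n`-form on `M` in the preferred chart at `x₀`, that is, its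
pullback by the inverse of this chart. -/
def formInChart (σ : ∀ x : M, TangentSpace I x [⋀^Fin n]→L[ℝ] F) (x₀ : M) :
    E → E [⋀^Fin n]→L[ℝ] F := fun y =>
  (σ ((extChartAt I x₀).symm y)).compContinuousLinearMap
    (mfderivWithin 𝓘(ℝ, E) I (extChartAt I x₀).symm (Set.range I) y)

/-- An `n`-form is smooth if its expressions in all charts are smooth. -/
def IsSmoothForm (σ : ∀ x : M, TangentSpace I x [⋀^Fin n]→L[ℝ] F) : Prop :=
  ∀ x₀ : M, ContDiffOn ℝ ∞ (formInChart I σ x₀) (extChartAt I x₀).target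

/-- The exterior derivative of an `n`-form on a manifold, computed at each point in the preferred
chart at this point. The normalisation is
`dσ(X, Y) = X(σ(Y)) - Y(σ(X)) - σ([X, Y])` for 1-forms, without factors `1/n`. -/
def mextDeriv (σ : ∀ x : M, TangentSpace I x [⋀^Fin n]→L[ℝ] F) (x : M) :
    TangentSpace I x [⋀^Fin (n + 1)]→L[ℝ] F :=
  (extDerivWithin (formInChart I σ x) (Set.range I) (extChartAt I x x)).compContinuousLinearMap
    (mfderiv I 𝓘(ℝ, E) (extChartAt I x) x)

/-- A family of subspaces of the tangent spaces is a smooth regular distribution (a smooth vector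
subbundle of the tangent bundle) if it has smooth local frames. -/
def IsSmoothDistribution [IsManifold I 1 M] (D : ∀ x : M, Submodule ℝ (TangentSpace I x)) : Prop :=
  ∀ x₀ : M, ∃ (r : ℕ) (U : Set M) (s : Fin r → ∀ x : M, TangentSpace I x),
    IsOpen U ∧ x₀ ∈ U ∧
    (∀ i, ContMDiffOn I I.tangent ∞ (fun x => (⟨x, s i x⟩ : TangentBundle I M)) U) ∧
    ∀ x ∈ U, LinearIndependent ℝ (fun i => s i x) ∧ Submodule.span ℝ (Set.range fun i => s i x) = D x

/-- A field of maps `π♯ₓ : Tₓ*M → TₓM`; bivector fields `π` are treated through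
`β (π♯ α) = π(α, β)`. -/
abbrev SharpField (M : Type*) [TopologicalSpace M] [ChartedSpace H M] :=
  ∀ x : M, (TangentSpace I x →L[ℝ] ℝ) →L[ℝ] TangentSpace I x

/-- The expression of a bivector field in the preferred chart at `x₀`. -/
def bivectorInChart (π : SharpField I M) (x₀ : M) : E → (E →L[ℝ] ℝ) →L[ℝ] E := fun y =>
  let T : E →L[ℝ] E := mfderiv I 𝓘(ℝ, E) (extChartAt I x₀) ((extChartAt I x₀).symm y)
  let p : (E →L[ℝ] ℝ) →L[ℝ] E := π ((extChartAt I x₀).symm y)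
  T ∘L p ∘L ContinuousLinearMap.precomp ℝ T

/-- A smooth bivector field: `π(α, β)` is skew-symmetric, and `π` is smooth in all charts. -/
structure IsBivectorField (π : SharpField I M) : Prop where
  skew : ∀ (x : M) (α β : TangentSpace I x →L[ℝ] ℝ), β (π x α) = -α (π x β)
  smooth : ∀ x₀ : M, ContDiffOn ℝ ∞ (bivectorInChart I π x₀) (extChartAt I x₀).target

/-- The Schouten bracket `[π, π]` of a bivector field with itself, evaluated on three covectors at
`x`. In coordinates, `[π, π]^{ijk} = 2 ∑ₗ (π^{il} ∂ₗ π^{jk} + π^{jl} ∂ₗ π^{ki} + π^{kl} ∂ₗ π^{ij})`,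
so that `½ [π, π](df, dg, dh) = {f, {g, h}} + {g, {h, f}} + {h, {f, g}}`
for `{f, g} = π(df, dg)`. -/
def schoutenSelf (π : SharpField I M) (x : M) (α β γ : TangentSpace I x →L[ℝ] ℝ) : ℝ :=
  let y₀ : E := extChartAt I x x
  let p : E → (E →L[ℝ] ℝ) →L[ℝ] E := bivectorInChart I π x
  let T : E →L[ℝ] E := mfderivWithin 𝓘(ℝ, E) I (extChartAt I x).symm (Set.range I) y₀
  let a : E →L[ℝ] ℝ := ContinuousLinearMap.precomp ℝ T α
  let b : E →L[ℝ] ℝ := ContinuousLinearMap.precomp ℝ T β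
  let c : E →L[ℝ] ℝ := ContinuousLinearMap.precomp ℝ T γ
  2 * (fderivWithin ℝ (fun y => c (p y b)) (Set.range I) y₀ (p y₀ a)
    + fderivWithin ℝ (fun y => a (p y c)) (Set.range I) y₀ (p y₀ b)
    + fderivWithin ℝ (fun y => b (p y a)) (Set.range I) y₀ (p y₀ c))

end Manifolds

/-! ### The cotangent bundle -/

section Cotangent

variable (E : Type*) [NormedAddCommGroup E] [NormedSpace ℝ E]
  (Q : Type*) [TopologicalSpace Q] [ChartedSpace E Q]

/-- The cotangent bundle `T*Q`. -/
abbrev CotangentBundle :=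
  Bundle.TotalSpace (E →L[ℝ] ℝ) (fun q : Q => TangentSpace 𝓘(ℝ, E) q →L[ℝ] ℝ)

/-- The model with corners of `T*Q`. -/
abbrev cotangentModel : ModelWithCorners ℝ (E × (E →L[ℝ] ℝ)) (ModelProd E (E →L[ℝ] ℝ)) :=
  𝓘(ℝ, E).prod 𝓘(ℝ, E →L[ℝ] ℝ)

/-- The projection `τ_Q : T*Q → Q`. -/
def cotangentProj : CotangentBundle E Q → Q := Bundle.TotalSpace.proj

variable [IsManifold 𝓘(ℝ, E) ∞ Q]

/-- The Liouville 1-form `Θ_Q` on `T*Q`: `Θ_Q(v) = p(Tτ_Q(v))` for `v ∈ T_p(T*Q)`. -/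
def liouvilleForm (p : CotangentBundle E Q) :
    TangentSpace (cotangentModel E) p [⋀^Fin 1]→L[ℝ] ℝ :=
  let P : TangentSpace 𝓘(ℝ, E) (cotangentProj E Q p) →L[ℝ] ℝ := p.2
  ContinuousAlternatingMap.ofSubsingleton ℝ (TangentSpace (cotangentModel E) p) ℝ (0 : Fin 1)
    (P ∘L mfderiv (cotangentModel E) 𝓘(ℝ, E) (cotangentProj E Q) p)

/-- The canonical symplectic form `Ω_Q = -dΘ_Q` on `T*Q` (`dqⁱ ∧ dpᵢ` in coordinates). -/
def canonicalForm (p : CotangentBundle E Q) :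
    TangentSpace (cotangentModel E) p [⋀^Fin 2]→L[ℝ] ℝ :=
  -mextDeriv (cotangentModel E) (liouvilleForm E Q) p

end Cotangent

section CotangentLift

variable {E : Type*} [NormedAddCommGroup E] [NormedSpace ℝ E]
  {Q : Type*} [TopologicalSpace Q] [ChartedSpace E Q]

/-- The cotangent lift `(q, p) ↦ (f(q), p ∘ (T_q f)⁻¹)` of a diffeomorphism `f` of `Q`. -/
def cotangentLift (f : Q → Q) (p : CotangentBundle E Q) : CotangentBundle E Q :=
  ⟨f p.1, p.2 ∘L (mfderiv 𝓘(ℝ, E) 𝓘(ℝ, E) f p.1).inverse⟩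

theorem cotangentLift_id (p : CotangentBundle E Q) : cotangentLift id p = p := by
  obtain ⟨q, p⟩ := p
  unfold cotangentLift
  rw [mfderiv_id]
  congr 1
  ext v
  simp

theorem cotangentLift_comp {f g : Q → Q} (p : CotangentBundle E Q)
    (hf : MDifferentiableAt 𝓘(ℝ, E) 𝓘(ℝ, E) f (g p.1))
    (hg : MDifferentiableAt 𝓘(ℝ, E) 𝓘(ℝ, E) g p.1)
    (hf' : (mfderiv 𝓘(ℝ, E) 𝓘(ℝ, E) f (g p.1)).IsInvertible) :
    cotangentLift (f ∘ g) p = cotangentLift f (cotangentLift g p) := by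
  obtain ⟨q, p⟩ := p
  unfold cotangentLift
  dsimp only at *
  rw [mfderiv_comp q hf hg, hf'.inverse_comp_of_left]
  rfl

end CotangentLift

/-! ### Nonholonomic systems with symmetries -/

/-- A nonholonomic system on `Q`: a kinetic energy metric, a potential energy, and a regular
distribution `D ⊆ TQ` of permitted velocities. -/
structure NonholonomicSystem (E : Type*) [NormedAddCommGroup E] [NormedSpace ℝ E]
    (Q : Type*) [TopologicalSpace Q] [ChartedSpace E Q] [IsManifold 𝓘(ℝ, E) ∞ Q] where
  /-- The kinetic energy metric `κ`. -/
  metric : Bundle.ContMDiffRiemannianMetric 𝓘(ℝ, E) ∞ E (fun q : Q => TangentSpace 𝓘(ℝ, E) q)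
  /-- The potential energy term `U` of the lagrangian. -/
  potential : Q → ℝ
  /-- The constraint distribution `D`. -/
  constraint : ∀ q : Q, Submodule ℝ (TangentSpace 𝓘(ℝ, E) q)
  contMDiff_potential : ContMDiff 𝓘(ℝ, E) 𝓘(ℝ, ℝ) ∞ potential
  smooth_constraint : IsSmoothDistribution 𝓘(ℝ, E) constraint

namespace NonholonomicSystem

section Basic

variable {E : Type*} [NormedAddCommGroup E] [NormedSpace ℝ E]
  {Q : Type*} [TopologicalSpace Q] [ChartedSpace E Q] [IsManifold 𝓘(ℝ, E) ∞ Q]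
  (S : NonholonomicSystem E Q)

/-- The lagrangian of mechanical type, `L(v) = ½ κ(v, v) + U`. -/
def lagrangian (v : TangentBundle 𝓘(ℝ, E) Q) : ℝ :=
  (1 / 2) * S.metric.inner v.1 v.2 v.2 + S.potential v.1

/-- The Legendre transform `TQ → T*Q`, `v ↦ κ(v, ·)`. -/
def legendre (v : TangentBundle 𝓘(ℝ, E) Q) : CotangentBundle E Q :=
  ⟨v.1, S.metric.inner v.1 v.2⟩

/-- The constraint submanifold `𝓜 = Leg(D) ⊆ T*Q`. -/
def constraintSet : Set (CotangentBundle E Q) :=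
  S.legendre '' {v | v.2 ∈ S.constraint v.1}

/-- The constraint submanifold `𝓜`, with the subspace topology of `T*Q`. -/
abbrev M : Type _ := S.constraintSet

/-- The inclusion `ι : 𝓜 → T*Q`. -/
def incl : S.M → CotangentBundle E Q := Subtype.val

/-- The projection `τ : 𝓜 → Q`. -/
def proj (m : S.M) : Q := cotangentProj E Q (S.incl m)

/-- A group acting on `Q` is a symmetry group of the system if the tangent lift of the action
preserves the lagrangian and the constraints. -/
class IsSymmetric (G : Type*) [Group G] [MulAction G Q] : Prop where
  contMDiff_smul : ∀ g : G, ContMDiff 𝓘(ℝ, E) 𝓘(ℝ, E) ∞ (fun q : Q => g • q)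
  lagrangian_smul : ∀ (g : G) (v : TangentBundle 𝓘(ℝ, E) Q),
    S.lagrangian (tangentMap 𝓘(ℝ, E) 𝓘(ℝ, E) (fun q => g • q) v) = S.lagrangian v
  constraint_smul : ∀ (g : G) (v : TangentBundle 𝓘(ℝ, E) Q), v.2 ∈ S.constraint v.1 →
    (tangentMap 𝓘(ℝ, E) 𝓘(ℝ, E) (fun q => g • q) v).2 ∈ S.constraint (g • v.1)

end Basic

section Action

variable {E : Type*} [NormedAddCommGroup E] [NormedSpace ℝ E]
  {Q : Type*} [TopologicalSpace Q] [ChartedSpace E Q]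
  {G : Type*} [Group G] [MulAction G Q]

theorem mdifferentiableAt_smul
    (hG : ∀ g : G, ContMDiff 𝓘(ℝ, E) 𝓘(ℝ, E) ∞ (fun q : Q => g • q)) (g : G) (q : Q) :
    MDifferentiableAt 𝓘(ℝ, E) 𝓘(ℝ, E) (fun q : Q => g • q) q :=
  (hG g).mdifferentiableAt (by simp)

theorem mfderiv_smul_comp
    (hG : ∀ g : G, ContMDiff 𝓘(ℝ, E) 𝓘(ℝ, E) ∞ (fun q : Q => g • q)) (g : G) (q : Q) :
    mfderiv 𝓘(ℝ, E) 𝓘(ℝ, E) (fun q : Q => g⁻¹ • q) (g • q) ∘L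
      mfderiv 𝓘(ℝ, E) 𝓘(ℝ, E) (fun q : Q => g • q) q =
      ContinuousLinearMap.id ℝ (TangentSpace 𝓘(ℝ, E) q) := by
  rw [← mfderiv_comp q (mdifferentiableAt_smul hG g⁻¹ (g • q)) (mdifferentiableAt_smul hG g q)]
  have : (fun q : Q => g⁻¹ • q) ∘ (fun q : Q => g • q) = id := by
    funext x; simp
  rw [this, mfderiv_id]

theorem mfderiv_smul_comp'
    (hG : ∀ g : G, ContMDiff 𝓘(ℝ, E) 𝓘(ℝ, E) ∞ (fun q : Q => g • q)) (g : G) (q : Q) :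
    mfderiv 𝓘(ℝ, E) 𝓘(ℝ, E) (fun q : Q => g • q) q ∘L
      mfderiv 𝓘(ℝ, E) 𝓘(ℝ, E) (fun q : Q => g⁻¹ • q) (g • q) =
      ContinuousLinearMap.id ℝ (TangentSpace 𝓘(ℝ, E) (g • q)) := by
  have h := mfderiv_comp (g • q) (g := fun q : Q => g • q) (f := fun q : Q => g⁻¹ • q)
    (mdifferentiableAt_smul hG g (g⁻¹ • g • q)) (mdifferentiableAt_smul hG g⁻¹ (g • q))
  have e : (fun q : Q => g • q) ∘ (fun q : Q => g⁻¹ • q) = id := by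
    funext x; simp
  rw [e, mfderiv_id] at h
  have e2 : ∀ q' : Q, q' = q → (mfderiv 𝓘(ℝ, E) 𝓘(ℝ, E) (fun q : Q => g • q) q' : E →L[ℝ] E) =
      mfderiv 𝓘(ℝ, E) 𝓘(ℝ, E) (fun q : Q => g • q) q := by
    rintro _ rfl; rfl
  exact (h.trans (congrArg (fun T : E →L[ℝ] E => T ∘L
    (mfderiv 𝓘(ℝ, E) 𝓘(ℝ, E) (fun q : Q => g⁻¹ • q) (g • q) : E →L[ℝ] E))
    (e2 _ (inv_smul_smul g q)))).symm

theorem mfderiv_smul_isInvertible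
    (hG : ∀ g : G, ContMDiff 𝓘(ℝ, E) 𝓘(ℝ, E) ∞ (fun q : Q => g • q)) (g : G) (q : Q) :
    (mfderiv 𝓘(ℝ, E) 𝓘(ℝ, E) (fun q : Q => g • q) q).IsInvertible :=
  ContinuousLinearMap.IsInvertible.of_inverse (mfderiv_smul_comp' hG g q) (mfderiv_smul_comp hG g q)

variable [IsManifold 𝓘(ℝ, E) ∞ Q] (S : NonholonomicSystem E Q) [hS : S.IsSymmetric G]

/-- The symmetry group acts by isometries of the kinetic energy metric. -/
theorem metric_smul (g : G) (q : Q) (v w : TangentSpace 𝓘(ℝ, E) q) :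
    S.metric.inner (g • q) (mfderiv 𝓘(ℝ, E) 𝓘(ℝ, E) (fun q : Q => g • q) q v)
      (mfderiv 𝓘(ℝ, E) 𝓘(ℝ, E) (fun q : Q => g • q) q w) = S.metric.inner q v w := by
  have hL : ∀ u : TangentSpace 𝓘(ℝ, E) q,
      (1 / 2) * S.metric.inner (g • q) (mfderiv 𝓘(ℝ, E) 𝓘(ℝ, E) (fun q : Q => g • q) q u)
        (mfderiv 𝓘(ℝ, E) 𝓘(ℝ, E) (fun q : Q => g • q) q u) + S.potential (g • q) =
      (1 / 2) * S.metric.inner q u u + S.potential q := fun u =>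
    hS.lagrangian_smul g ⟨q, u⟩
  have h0 := hL 0
  have hv := hL v
  have hw := hL w
  have hvw := hL (v + w)
  have s1 := S.metric.symm q v w
  have s2 := S.metric.symm (g • q) (mfderiv 𝓘(ℝ, E) 𝓘(ℝ, E) (fun q : Q => g • q) q v)
    (mfderiv 𝓘(ℝ, E) 𝓘(ℝ, E) (fun q : Q => g • q) q w)
  simp only [map_add, map_zero, add_apply] at h0 hvw
  linarith

theorem cotangentLift_legendre (g : G) (v : TangentBundle 𝓘(ℝ, E) Q) :
    cotangentLift (fun q : Q => g • q) (S.legendre v) =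
      S.legendre (tangentMap 𝓘(ℝ, E) 𝓘(ℝ, E) (fun q => g • q) v) := by
  obtain ⟨q, v⟩ := v
  unfold cotangentLift legendre tangentMap
  dsimp only
  congr 1
  ext w
  have hi := mfderiv_smul_isInvertible hS.contMDiff_smul g q
  have e : mfderiv 𝓘(ℝ, E) 𝓘(ℝ, E) (fun q : Q => g • q) q
      ((mfderiv 𝓘(ℝ, E) 𝓘(ℝ, E) (fun q : Q => g • q) q).inverse w) = w :=
    (hi.inverse_apply_eq.mp rfl).symm
  have h := S.metric_smul g q v ((mfderiv 𝓘(ℝ, E) 𝓘(ℝ, E) (fun q : Q => g • q) q).inverse w)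
  rw [e] at h
  exact h.symm

theorem cotangentLift_mem (g : G) (m : S.M) :
    cotangentLift (fun q : Q => g • q) (S.incl m) ∈ S.constraintSet := by
  obtain ⟨_, v, hv, rfl⟩ := m
  exact ⟨_, hS.constraint_smul g v hv, (S.cotangentLift_legendre g v).symm⟩

/-- The action of the symmetry group on `𝓜`: the restriction of the cotangent lift of the action
on `Q`. -/
instance instMulAction : MulAction G S.M where
  smul g m := ⟨cotangentLift (fun q : Q => g • q) (S.incl m), S.cotangentLift_mem g m⟩
  one_smul m := by
    apply Subtype.ext
    change cotangentLift (fun q : Q => (1 : G) • q) (S.incl m) = S.incl m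
    have : (fun q : Q => (1 : G) • q) = id := by funext x; simp
    rw [this, cotangentLift_id]
  mul_smul g h m := by
    apply Subtype.ext
    change cotangentLift (fun q : Q => (g * h) • q) (S.incl m) =
      cotangentLift (fun q : Q => g • q) (cotangentLift (fun q : Q => h • q) (S.incl m))
    have : (fun q : Q => (g * h) • q) = (fun q : Q => g • q) ∘ (fun q : Q => h • q) := by
      funext x; simp [mul_smul]
    rw [this, cotangentLift_comp _ (mdifferentiableAt_smul hS.contMDiff_smul g _) (mdifferentiableAt_smul hS.contMDiff_smul h _)
      (mfderiv_smul_isInvertible hS.contMDiff_smul g _)]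

theorem incl_smul (g : G) (m : S.M) :
    S.incl (g • m) = cotangentLift (fun q : Q => g • q) (S.incl m) := rfl

end Action

/-! ### Geometry of the constraint submanifold -/

section Geometry

variable {E : Type*} [NormedAddCommGroup E] [NormedSpace ℝ E]
  {Q : Type*} [TopologicalSpace Q] [ChartedSpace E Q] [IsManifold 𝓘(ℝ, E) ∞ Q]
  (S : NonholonomicSystem E Q)
  {EM : Type*} [NormedAddCommGroup EM] [NormedSpace ℝ EM] [ChartedSpace EM S.M]

/-- The distribution `𝓒 ⊆ T𝓜`, `𝓒ₘ = {v | Tτ(v) ∈ D}`. -/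
def constraintDist (m : S.M) : Submodule ℝ (TangentSpace 𝓘(ℝ, EM) m) :=
  (S.constraint (S.proj m)).comap
    (mfderiv 𝓘(ℝ, EM) 𝓘(ℝ, E) S.proj m : TangentSpace 𝓘(ℝ, EM) m →ₗ[ℝ]
      TangentSpace 𝓘(ℝ, E) (S.proj m))

/-- `Θ_𝓜 = ι^* Θ_Q`. -/
def liouville (m : S.M) : TangentSpace 𝓘(ℝ, EM) m [⋀^Fin 1]→L[ℝ] ℝ :=
  (liouvilleForm E Q (S.incl m)).compContinuousLinearMap
    (mfderiv 𝓘(ℝ, EM) (cotangentModel E) S.incl m)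

/-- `Ω_𝓜 = ι^* Ω_Q`. -/
def twoForm (m : S.M) : TangentSpace 𝓘(ℝ, EM) m [⋀^Fin 2]→L[ℝ] ℝ :=
  (canonicalForm E Q (S.incl m)).compContinuousLinearMap
    (mfderiv 𝓘(ℝ, EM) (cotangentModel E) S.incl m)

/-- The nonholonomic bivector field `π_nh`, determined by `𝓒` and `Ω_𝓜|_𝓒`. -/
def nhBivector : SharpField 𝓘(ℝ, EM) S.M := fun m =>
  sharpOfPair (V := EM) (S.constraintDist m) (S.twoForm m)

/-- A 2-form `B` defines a gauge transformation of `π_nh` if `Id + B♭ ∘ π_nh♯` is invertible. -/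
def IsGauge (B : ∀ m : S.M, TangentSpace 𝓘(ℝ, EM) m [⋀^Fin 2]→L[ℝ] ℝ) : Prop :=
  ∀ m : S.M, (gaugeEndo (V := EM) (S.nhBivector m) (B m)).IsInvertible

/-- The bivector field `π_B` gauge related to `π_nh` by the 2-form `B`. -/
def gaugeBivector (B : ∀ m : S.M, TangentSpace 𝓘(ℝ, EM) m [⋀^Fin 2]→L[ℝ] ℝ) :
    SharpField 𝓘(ℝ, EM) S.M := fun m =>
  gaugeSharp (V := EM) (S.nhBivector m) (B m)

end Geometry

section Symmetry

variable {E : Type*} [NormedAddCommGroup E] [NormedSpace ℝ E]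
  {Q : Type*} [TopologicalSpace Q] [ChartedSpace E Q] [IsManifold 𝓘(ℝ, E) ∞ Q]
  (S : NonholonomicSystem E Q)
  (EM : Type*) [NormedAddCommGroup EM] [NormedSpace ℝ EM] [ChartedSpace EM S.M]
  (EG : Type*) [NormedAddCommGroup EG] [NormedSpace ℝ EG]
  (G : Type*) [TopologicalSpace G] [ChartedSpace EG G] [Group G]
  [MulAction G Q] [S.IsSymmetric G]

/-- A form `σ` on `𝓜` is `G`-invariant if `φ_g^* σ = σ` for all `g ∈ G`. -/
def IsInvariantForm {n : ℕ} {EM : Type*} [NormedAddCommGroup EM] [NormedSpace ℝ EM]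
    [ChartedSpace EM S.M] (σ : ∀ m : S.M, TangentSpace 𝓘(ℝ, EM) m [⋀^Fin n]→L[ℝ] ℝ) : Prop :=
  ∀ (g : G) (m : S.M),
    (σ (g • m)).compContinuousLinearMap
      (mfderiv 𝓘(ℝ, EM) 𝓘(ℝ, EM) (fun m : S.M => g • m) m) = σ m

/-- The infinitesimal action `𝔤 → Tₘ𝓜`, `ξ ↦ ξ_𝓜(m)`: the derivative at `1` of the orbit map
`g ↦ g • m`. -/
def infAction (m : S.M) : GroupLieAlgebra 𝓘(ℝ, EG) G →L[ℝ] TangentSpace 𝓘(ℝ, EM) m :=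
  (mfderiv 𝓘(ℝ, EG) 𝓘(ℝ, EM) (fun g : G => g • m) 1 : EG →L[ℝ] EM)

/-- The vertical space `𝓥ₘ`, tangent to the orbit of `m`. -/
def vertical (m : S.M) : Submodule ℝ (TangentSpace 𝓘(ℝ, EM) m) :=
  LinearMap.range (S.infAction EM EG G m : GroupLieAlgebra 𝓘(ℝ, EG) G →ₗ[ℝ]
    TangentSpace 𝓘(ℝ, EM) m)

/-- The momentum map `J : 𝓜 → 𝔤*`, `⟨J(m), η⟩ = Θ_𝓜(η_𝓜(m))`. -/
def momentum (m : S.M) : EG →L[ℝ] ℝ :=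
  ((ContinuousAlternatingMap.ofSubsingleton ℝ (TangentSpace 𝓘(ℝ, EM) m) ℝ (0 : Fin 1)).symm
    (S.liouville m) : EM →L[ℝ] ℝ) ∘L (S.infAction EM EG G m : EG →L[ℝ] EM)

/-- A `G`-invariant vertical complement `𝓦` of `𝓒` in `T𝓜`. -/
structure VerticalComplement [IsManifold 𝓘(ℝ, EM) 1 S.M] where
  /-- The distribution `𝓦`. -/
  dist : ∀ m : S.M, Submodule ℝ (TangentSpace 𝓘(ℝ, EM) m)
  smooth : IsSmoothDistribution 𝓘(ℝ, EM) dist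
  isCompl : ∀ m : S.M, IsCompl (S.constraintDist m) (dist m)
  le_vertical : ∀ m : S.M, dist m ≤ S.vertical EM EG G m
  invariant : ∀ (g : G) (m : S.M), ∀ v ∈ dist m,
    mfderiv 𝓘(ℝ, EM) 𝓘(ℝ, EM) (fun m : S.M => g • m) m v ∈ dist (g • m)

/-- The orbit space `𝓜/G`, with the quotient topology. -/
abbrev OrbitSpace : Type _ := MulAction.orbitRel.Quotient G S.M

/-- The orbit projection `ρ : 𝓜 → 𝓜/G`. -/
def orbitProj (m : S.M) : S.OrbitSpace G := Quotient.mk _ m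

end Symmetry

namespace VerticalComplement

variable {E : Type*} [NormedAddCommGroup E] [NormedSpace ℝ E]
  {Q : Type*} [TopologicalSpace Q] [ChartedSpace E Q] [IsManifold 𝓘(ℝ, E) ∞ Q]
  {S : NonholonomicSystem E Q}
  {EM : Type*} [NormedAddCommGroup EM] [NormedSpace ℝ EM] [FiniteDimensional ℝ EM]
  [ChartedSpace EM S.M] [IsManifold 𝓘(ℝ, EM) 1 S.M]
  {EG : Type*} [NormedAddCommGroup EG] [NormedSpace ℝ EG]
  {G : Type*} [TopologicalSpace G] [ChartedSpace EG G] [Group G]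
  [MulAction G Q] [S.IsSymmetric G] (W : S.VerticalComplement EM EG G)

/-- The projection `P_𝓒 : T𝓜 → 𝓒` along `𝓦`. -/
def projC (m : S.M) : EM →L[ℝ] EM :=
  LinearMap.toContinuousLinearMap (E := EM) (F' := EM)
    ((S.constraintDist m).projection (W.dist m) (W.isCompl m))

/-- The projection `P_𝓦 : T𝓜 → 𝓦` along `𝓒`. -/
def projW (m : S.M) : EM →L[ℝ] EM :=
  LinearMap.toContinuousLinearMap (E := EM) (F' := EM)
    ((W.dist m).projection (S.constraintDist m) (W.isCompl m).symm)

/-- The `𝔤`-valued 1-form `A_𝓦` with `A_𝓦(v) = ξ` if and only if `P_𝓦(v) = ξ_𝓜(m)`. -/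
def connForm (m : S.M) : TangentSpace 𝓘(ℝ, EM) m [⋀^Fin 1]→L[ℝ] EG :=
  ContinuousAlternatingMap.ofSubsingleton ℝ EM EG (0 : Fin 1)
    (LinearMap.toContinuousLinearMap (E := EM) (F' := EG)
      (LinearMap.leftInverse (V := EG) (V' := EM) (S.infAction EM EG G m : EG →L[ℝ] EM).toLinearMap ∘ₗ
        (W.projW m).toLinearMap))

/-- The defining property of `A_𝓦`. -/
theorem connForm_iff (m : S.M) (h : Function.Injective (S.infAction EM EG G m))
    (v : TangentSpace 𝓘(ℝ, EM) m) (ξ : EG) :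
    W.connForm m ![v] = ξ ↔ W.projW m v = S.infAction EM EG G m ξ := by
  have hk : LinearMap.ker (S.infAction EM EG G m : EG →L[ℝ] EM).toLinearMap = ⊥ :=
    LinearMap.ker_eq_bot.mpr h
  obtain ⟨ζ, hζ⟩ : W.projW m v ∈ S.vertical EM EG G m :=
    W.le_vertical m (Submodule.projection_apply_mem (W.isCompl m).symm v)
  let L : EM →ₗ[ℝ] EG := (S.infAction EM EG G m : EG →L[ℝ] EM).toLinearMap.leftInverse
  have e : W.connForm m ![v] = L (W.projW m v) := rfl
  have e' : L (W.projW m v) = ζ := by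
    rw [← hζ]
    exact LinearMap.leftInverse_apply_of_inj hk ζ
  rw [e, e', ← hζ]
  exact ⟨fun hh => by rw [hh]; rfl, fun hh => h hh⟩

/-- The `𝓦`-curvature `K_𝓦(X, Y) = dA_𝓦(P_𝓒 X, P_𝓒 Y)`. -/
def curvature (m : S.M) : TangentSpace 𝓘(ℝ, EM) m [⋀^Fin 2]→L[ℝ] EG :=
  (mextDeriv 𝓘(ℝ, EM) W.connForm m).compContinuousLinearMap (W.projC m)

/-- The 3-form `dJ ∧ K_𝓦 (X, Y, Z) = cyclic ⟨dJ(Z), K_𝓦(X, Y)⟩`. -/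
def momentumCurvature (m : S.M) : TangentSpace 𝓘(ℝ, EM) m [⋀^Fin 3]→L[ℝ] ℝ :=
  wedgeDual (V := EM) (𝔤 := EG)
    (mfderiv 𝓘(ℝ, EM) 𝓘(ℝ, EG →L[ℝ] ℝ) (S.momentum EM EG G) m) (W.curvature m)

/-- The trivector `ψ_π(α, β, γ) = cyclic [γ (K_𝓦(π♯ α, π♯ β)_𝓜)]`. -/
def psi (π : SharpField 𝓘(ℝ, EM) S.M) (m : S.M)
    (α β γ : TangentSpace 𝓘(ℝ, EM) m →L[ℝ] ℝ) : ℝ :=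
  γ (S.infAction EM EG G m (W.curvature m ![π m α, π m β]))
    + α (S.infAction EM EG G m (W.curvature m ![π m β, π m γ]))
    + β (S.infAction EM EG G m (W.curvature m ![π m γ, π m α]))

end VerticalComplement

section Reduction

variable {E : Type*} [NormedAddCommGroup E] [NormedSpace ℝ E]
  {Q : Type*} [TopologicalSpace Q] [ChartedSpace E Q] [IsManifold 𝓘(ℝ, E) ∞ Q]
  (S : NonholonomicSystem E Q)
  {EM : Type*} [NormedAddCommGroup EM] [NormedSpace ℝ EM] [ChartedSpace EM S.M]
  (G : Type*) [Group G] [MulAction G Q] [S.IsSymmetric G]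
  {EN : Type*} [NormedAddCommGroup EN] [NormedSpace ℝ EN] [ChartedSpace EN (S.OrbitSpace G)]

/-- The pullback `ρ^* α ∈ Tₘ^*𝓜` of a covector `α` on `𝓜/G` at `ρ(m)`. -/
def pullCovector (m : S.M) (α : TangentSpace 𝓘(ℝ, EN) (S.orbitProj G m) →L[ℝ] ℝ) :
    TangentSpace 𝓘(ℝ, EM) m →L[ℝ] ℝ :=
  α ∘L mfderiv 𝓘(ℝ, EM) 𝓘(ℝ, EN) (S.orbitProj G) m

/-- The reduced bivector field on `𝓜/G` of an invariant bivector field `π` on `𝓜`: at `y = ρ(m)` it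
is `Tρ ∘ πₘ♯ ∘ ρ^*`, for a chosen representative `m` of the orbit `y`. -/
def reducedBivector (π : SharpField 𝓘(ℝ, EM) S.M) : SharpField 𝓘(ℝ, EN) (S.OrbitSpace G) :=
  fun y =>
    let m : S.M := Quotient.out y
    let T : EM →L[ℝ] EN := mfderiv 𝓘(ℝ, EM) 𝓘(ℝ, EN) (S.orbitProj G) m
    let p : (EM →L[ℝ] ℝ) →L[ℝ] EM := π m
    T ∘L p ∘L ContinuousLinearMap.precomp ℝ T

end Reduction

end NonholonomicSystem

end NonholonomicGeometry

end

noncomputable section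

namespace NonholonomicGeometry

/-! Write σ = Ω_𝓜 − B. The gauge transformation keeps the distribution 𝓒 and replaces Ω_𝓜 by σ: π_B♯
takes values in 𝓒 and σ(π_B♯ β, v) = −β(v) for v ∈ 𝓒 (`IsSharp.gaugeSharp`). Nondegeneracy of Ω_𝓜 on
𝓒 (`twoForm_nondegenerate`) and invertibility of Id + B♭π_nh♯ make σ nondegenerate on 𝓒, so these
two conditions determine π_B♯. Uniqueness gives its invariance (`gaugeBivector_smul`), hence the
reduced field; smoothness descends through local sections of ρ.

For covectors a, b, c that are constant in a chart of 𝓜/G, set X_a = −π_B♯(ρ^*a) ∈ 𝓒, so that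
i_{X_a}σ = ρ^*a on 𝓒 and {b, c}∘ρ = σ(X_b, X_c). The Jacobiator appears on expanding dσ(X_a, X_b,
X_c) by Cartan's formula. The bracket [X_a, X_b] need not lie in 𝓒, and everything rests on
splitting it along 𝓒 ⊕ 𝓦. The 𝓒-part pairs with X_c under σ as iterated brackets, because 𝓦 is
vertical and is killed by Tρ. The 𝓦-part is generated by A_𝓦[X_a, X_b] = −K_𝓦(X_a, X_b), since A_𝓦
vanishes on 𝓒. As B vanishes on 𝓦, pairing it with X_c only sees Ω_𝓜, and the momentum equation
i_{ξ_𝓜}Ω_𝓜 = d⟨J, ξ⟩ (`twoForm_infAction`) turns it into dJ(X_c) applied to −K_𝓦. This computation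
is `jacobiator_eq`; since dΩ_𝓜 = 0, dσ = −dB, and the signs of X = −π_B♯ρ^* give dB + dJ ∧ K_𝓦.

The momentum equation is Cartan's formula for the invariant form Θ_𝓜 (`extDeriv_invariant_apply`)
with ξ fixed, so no equivariance of J enters. Finally ψ vanishes because its entries are pullbacks
by ρ evaluated on infinitesimal generators. -/

theorem two_le_infty : (2 : WithTop ℕ∞) ≤ ∞ := WithTop.coe_le_coe.2 (le_top : (2 : ℕ∞) ≤ ⊤)

theorem minSmoothness_two_le_infty : minSmoothness ℝ 2 ≤ ∞ := by
  simpa using two_le_infty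

/-! ### Derivatives of charts and of maps read in charts. -/

section Charts

variable {E : Type*} [NormedAddCommGroup E] [NormedSpace ℝ E]
  {H : Type*} [TopologicalSpace H] (I : ModelWithCorners ℝ E H)
  {X : Type*} [TopologicalSpace X] [ChartedSpace H X]
  {E' : Type*} [NormedAddCommGroup E'] [NormedSpace ℝ E']
  {H' : Type*} [TopologicalSpace H'] (I' : ModelWithCorners ℝ E' H')
  {Y : Type*} [TopologicalSpace Y] [ChartedSpace H' Y]
  {F : Type*} [NormedAddCommGroup F] [NormedSpace ℝ F] {n : ℕ}

/-- The derivative of a map between manifolds, as a map between the model spaces. -/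
def tderiv (f : X → Y) (x : X) : E →L[ℝ] E' := mfderiv I I' f x

/-- The derivative of the inverse of the preferred chart at `x₀`. -/
def chartInv (x₀ : X) (y : E) : E →L[ℝ] E :=
  mfderivWithin 𝓘(ℝ, E) I (extChartAt I x₀).symm (Set.range I) y

/-- The derivative of the preferred chart at `x₀`. -/
def chartFwd (x₀ x : X) : E →L[ℝ] E := mfderiv I 𝓘(ℝ, E) (extChartAt I x₀) x

/-- The expression of a map in the preferred charts at `x₀` and `y₀`. -/
def localExpr (f : X → Y) (x₀ : X) (y₀ : Y) : E → E' :=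
  extChartAt I' y₀ ∘ f ∘ (extChartAt I x₀).symm

variable {I I'}

theorem tderiv_chart_symm [I.Boundaryless] (x₀ : X) (y : E) :
    tderiv 𝓘(ℝ, E) I (extChartAt I x₀).symm y = chartInv I x₀ y := by
  unfold chartInv tderiv
  rw [I.range_eq_univ, mfderivWithin_univ]

section Derivatives

variable [IsManifold I 1 X]

theorem chartFwd_comp_chartInv {x₀ : X} {y : E} (hy : y ∈ (extChartAt I x₀).target) :
    chartFwd I x₀ ((extChartAt I x₀).symm y) ∘L chartInv I x₀ y = ContinuousLinearMap.id ℝ E :=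
  mfderiv_extChartAt_comp_mfderivWithin_extChartAt_symm hy

theorem chartInv_comp_chartFwd {x₀ : X} {y : E} (hy : y ∈ (extChartAt I x₀).target) :
    chartInv I x₀ y ∘L chartFwd I x₀ ((extChartAt I x₀).symm y) = ContinuousLinearMap.id ℝ E :=
  mfderivWithin_extChartAt_symm_comp_mfderiv_extChartAt hy

/-- The tangent space at `x₀` is identified with the model space through the preferred chart at `x₀`
itself. Hence chart derivatives are identities at the centre, and pointwise identities can be
checked there without any Jacobian. -/
theorem chartFwd_self (x₀ : X) : chartFwd I x₀ x₀ = ContinuousLinearMap.id ℝ E := by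
  have h : chartFwd I x₀ x₀ = tangentCoordChange I x₀ x₀ x₀ :=
    (TangentBundle.continuousLinearMapAt_trivializationAt (mem_chart_source H x₀)).symm.trans
      (TangentBundle.continuousLinearMapAt_trivializationAt_eq_core (mem_chart_source H x₀))
  ext v
  rw [h]
  exact tangentCoordChange_self (mem_extChartAt_source x₀)

theorem chartInv_self (x₀ : X) :
    chartInv I x₀ (extChartAt I x₀ x₀) = ContinuousLinearMap.id ℝ E := by
  have h := chartFwd_comp_chartInv (I := I) (mem_extChartAt_target x₀)
  rw [extChartAt_to_inv, chartFwd_self] at h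
  simpa using h

variable [I.Boundaryless] [IsManifold I' 1 Y]

theorem chart_mem_nhds {x₀ : X} {y : E} (hy : y ∈ (extChartAt I x₀).target) :
    (extChartAt I x₀).target ∈ 𝓝 y :=
  (isOpen_extChartAt_target x₀).mem_nhds hy

theorem mdifferentiableAt_chart_symm {x₀ : X} {y : E} (hy : y ∈ (extChartAt I x₀).target) :
    MDifferentiableAt 𝓘(ℝ, E) I (extChartAt I x₀).symm y := by
  have h := mdifferentiableWithinAt_extChartAt_symm hy
  rwa [I.range_eq_univ, mdifferentiableWithinAt_univ] at h

theorem hasFDerivAt_localExpr {f : X → Y} {x₀ : X} {y₀ : Y} {z : E}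
    (hz : z ∈ (extChartAt I x₀).target)
    (hf : MDifferentiableAt I I' f ((extChartAt I x₀).symm z))
    (hfz : f ((extChartAt I x₀).symm z) ∈ (extChartAt I' y₀).source) :
    HasFDerivAt (localExpr I I' f x₀ y₀)
      (chartFwd I' y₀ (f ((extChartAt I x₀).symm z)) ∘L
        tderiv I I' f ((extChartAt I x₀).symm z) ∘L chartInv I x₀ z) z := by
  have h1 := (mdifferentiableAt_chart_symm hz).hasMFDerivAt
  have h2 := hf.hasMFDerivAt.comp z h1
  have h3 := (mdifferentiableAt_extChartAt (I := I')
    (by rwa [extChartAt_source] at hfz)).hasMFDerivAt.comp z h2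
  rw [← tderiv_chart_symm]
  exact h3.hasFDerivAt

/-- The chain rule with the target chart moved to the other side. In this form a tensor evaluated on
the left-hand vectors is directly its chart expression along the local expression of `f`. -/
theorem tderiv_comp_chartInv {f : X → Y} {x₀ : X} {y₀ : Y} {z : E}
    (hz : z ∈ (extChartAt I x₀).target)
    (hf : MDifferentiableAt I I' f ((extChartAt I x₀).symm z))
    (hfz : f ((extChartAt I x₀).symm z) ∈ (extChartAt I' y₀).source) :
    tderiv I I' f ((extChartAt I x₀).symm z) ∘L chartInv I x₀ z =
      chartInv I' y₀ (localExpr I I' f x₀ y₀ z) ∘L fderiv ℝ (localExpr I I' f x₀ y₀) z := by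
  rw [(hasFDerivAt_localExpr hz hf hfz).fderiv, ← ContinuousLinearMap.comp_assoc]
  have h := chartInv_comp_chartFwd ((extChartAt I' y₀).map_source hfz)
  rw [(extChartAt I' y₀).left_inv hfz] at h
  have e : localExpr I I' f x₀ y₀ z = extChartAt I' y₀ (f ((extChartAt I x₀).symm z)) := rfl
  rw [e, h, ContinuousLinearMap.id_comp]

theorem tderiv_eq_fderiv_localExpr {f : X → Y} {x₀ : X} (hf : MDifferentiableAt I I' f x₀) :
    tderiv I I' f x₀ =
      fderiv ℝ (localExpr I I' f x₀ (f x₀)) (extChartAt I x₀ x₀) := by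
  have hf' : MDifferentiableAt I I' f ((extChartAt I x₀).symm (extChartAt I x₀ x₀)) := by
    rwa [extChartAt_to_inv]
  have h := tderiv_comp_chartInv (y₀ := f x₀) (mem_extChartAt_target x₀) hf'
    (by rw [extChartAt_to_inv]; exact mem_extChartAt_source _)
  rw [extChartAt_to_inv, chartInv_self] at h
  have e : localExpr I I' f x₀ (f x₀) (extChartAt I x₀ x₀) = extChartAt I' (f x₀) (f x₀) := by
    simp [localExpr]
  rw [e, chartInv_self] at h
  exact h

theorem contDiffAt_localExpr {k : ℕ∞} [IsManifold I ∞ X] [IsManifold I' ∞ Y]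
    {f : X → Y} {x₀ : X} {y₀ : Y} {z : E}
    (hz : z ∈ (extChartAt I x₀).target)
    (hf : ContMDiffAt I I' k f ((extChartAt I x₀).symm z))
    (hfz : f ((extChartAt I x₀).symm z) ∈ (extChartAt I' y₀).source) :
    ContDiffAt ℝ k (localExpr I I' f x₀ y₀) z := by
  have hk : (k : WithTop ℕ∞) ≤ ∞ := by exact_mod_cast le_top
  have h1 : ContMDiffAt 𝓘(ℝ, E) I k (extChartAt I x₀).symm z := by
    have := contMDiffWithinAt_extChartAt_symm_range (I := I) (n := ∞) x₀ hz
    rw [I.range_eq_univ, contMDiffWithinAt_univ] at this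
    exact this.of_le hk
  have h2 : ContMDiffAt I' 𝓘(ℝ, E') k (extChartAt I' y₀) (f ((extChartAt I x₀).symm z)) :=
    (contMDiffAt_extChartAt' (n := ∞) (by rwa [extChartAt_source] at hfz)).of_le hk
  exact (h2.comp z (hf.comp z h1)).contDiffAt

end Derivatives

end Charts

/-! ### Pullback and exterior derivative of forms in charts. -/

section Forms

variable {E : Type*} [NormedAddCommGroup E] [NormedSpace ℝ E]
  {H : Type*} [TopologicalSpace H] {I : ModelWithCorners ℝ E H} [I.Boundaryless]
  {X : Type*} [TopologicalSpace X] [ChartedSpace H X] [IsManifold I ∞ X]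
  {E' : Type*} [NormedAddCommGroup E'] [NormedSpace ℝ E']
  {H' : Type*} [TopologicalSpace H'] {I' : ModelWithCorners ℝ E' H'} [I'.Boundaryless]
  {Y : Type*} [TopologicalSpace Y] [ChartedSpace H' Y] [IsManifold I' ∞ Y]
  {F : Type*} [NormedAddCommGroup F] [NormedSpace ℝ F] {n : ℕ}

/-- The pullback of a form by a map. -/
def pullForm (I : ModelWithCorners ℝ E H) (I' : ModelWithCorners ℝ E' H') (f : X → Y)
    (σ : ∀ y : Y, TangentSpace I' y [⋀^Fin n]→L[ℝ] F) (x : X) :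
    TangentSpace I x [⋀^Fin n]→L[ℝ] F :=
  (σ (f x)).compContinuousLinearMap (mfderiv I I' f x)

theorem formInChart_pullForm [IsManifold I 1 X] [IsManifold I' 1 Y]
    (σ : ∀ y : Y, TangentSpace I' y [⋀^Fin n]→L[ℝ] F)
    {f : X → Y} {x₀ : X} {y₀ : Y} {z : E}
    (hz : z ∈ (extChartAt I x₀).target)
    (hf : MDifferentiableAt I I' f ((extChartAt I x₀).symm z))
    (hfz : f ((extChartAt I x₀).symm z) ∈ (extChartAt I' y₀).source) :
    formInChart I (pullForm I I' f σ) x₀ z =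
      (formInChart I' σ y₀ (localExpr I I' f x₀ y₀ z)).compContinuousLinearMap
        (fderiv ℝ (localExpr I I' f x₀ y₀) z) := by
  have h := tderiv_comp_chartInv hz hf hfz
  have e : (extChartAt I' y₀).symm (localExpr I I' f x₀ y₀ z) = f ((extChartAt I x₀).symm z) :=
    (extChartAt I' y₀).left_inv hfz
  -- The base points agree only up to the equation `e`, and the fibre of `σ` depends on the point;
  -- generalising the point allows it to be substituted.
  have key : ∀ (y : Y) (_ : y = f ((extChartAt I x₀).symm z)) (v : Fin n → E),
      (σ (f ((extChartAt I x₀).symm z)) : E' [⋀^Fin n]→L[ℝ] F)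
        (fun i => (tderiv I I' f ((extChartAt I x₀).symm z) ∘L
          chartInv I x₀ z) (v i)) =
      (σ y : E' [⋀^Fin n]→L[ℝ] F) (fun i =>
        (chartInv I' y₀ (localExpr I I' f x₀ y₀ z) ∘L fderiv ℝ (localExpr I I' f x₀ y₀) z)
          (v i)) := by
    rintro _ rfl v
    rw [h]
  ext v
  exact key _ e v

theorem formInChart_eventuallyEq_pullForm (σ : ∀ y : Y, TangentSpace I' y [⋀^Fin n]→L[ℝ] F)
    {f : X → Y} {x₀ : X} {y₀ : Y} {z : E}
    (hz : z ∈ (extChartAt I x₀).target)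
    (hf : ContMDiffAt I I' 1 f ((extChartAt I x₀).symm z))
    (hfz : f ((extChartAt I x₀).symm z) ∈ (extChartAt I' y₀).source) :
    formInChart I (pullForm I I' f σ) x₀ =ᶠ[𝓝 z] fun z =>
      (formInChart I' σ y₀ (localExpr I I' f x₀ y₀ z)).compContinuousLinearMap
        (fderiv ℝ (localExpr I I' f x₀ y₀) z) := by
  have : IsManifold I 1 X := .of_le (n := ∞) (by simp)
  have : IsManifold I' 1 Y := .of_le (n := ∞) (by simp)
  have hc : ContinuousAt (extChartAt I x₀).symm z := continuousAt_extChartAt_symm'' hz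
  have h1 : ∀ᶠ x in 𝓝 ((extChartAt I x₀).symm z), ContMDiffAt I I' 1 f x :=
    (contMDiffAt_iff_contMDiffAt_nhds (by simp)).1 hf
  have h2 : ∀ᶠ x in 𝓝 ((extChartAt I x₀).symm z), f x ∈ (extChartAt I' y₀).source :=
    hf.continuousAt ((isOpen_extChartAt_source y₀).mem_nhds hfz)
  filter_upwards [chart_mem_nhds hz, hc.eventually h1, hc.eventually h2] with w hw hw1 hw2
  exact formInChart_pullForm σ hw (hw1.mdifferentiableAt (by simp)) hw2

/-- A change of charts is the pullback by the identity map, read in two different charts. -/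
theorem formInChart_change (σ : ∀ x : X, TangentSpace I x [⋀^Fin n]→L[ℝ] F)
    {x₀ x₁ : X} {z : E} (hz : z ∈ (extChartAt I x₀).target)
    (hz1 : (extChartAt I x₀).symm z ∈ (extChartAt I x₁).source) :
    formInChart I σ x₀ =ᶠ[𝓝 z] fun z =>
      (formInChart I σ x₁ (localExpr I I id x₀ x₁ z)).compContinuousLinearMap
        (fderiv ℝ (localExpr I I id x₀ x₁) z) := by
  have h := formInChart_eventuallyEq_pullForm (I := I) (I' := I) σ (f := id) (y₀ := x₁) hz
    contMDiffAt_id hz1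
  have e : pullForm I I id σ = σ := by
    funext x
    ext v
    simp only [pullForm, ContinuousAlternatingMap.compContinuousLinearMap_apply]
    rw [mfderiv_id]
    rfl
  rwa [e] at h

theorem mextDeriv_eq [IsManifold I 1 X] (σ : ∀ x : X, TangentSpace I x [⋀^Fin n]→L[ℝ] F) (x : X) :
    mextDeriv I σ x = (extDeriv (formInChart I σ x) (extChartAt I x x) : E [⋀^Fin (n + 1)]→L[ℝ] F) := by
  have h := chartFwd_self (I := I) x
  ext v
  have e : mextDeriv I σ x v = extDerivWithin (formInChart I σ x) (Set.range I) (extChartAt I x x)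
      (fun i => chartFwd I x x (v i)) := rfl
  rw [e, h, I.range_eq_univ, extDerivWithin_univ]
  rfl

/-- The exterior derivative commutes with pullbacks. -/
theorem mextDeriv_pullForm (σ : ∀ y : Y, TangentSpace I' y [⋀^Fin n]→L[ℝ] F)
    {f : X → Y} {x : X} (hf : ContMDiffAt I I' ∞ f x)
    (hσ : DifferentiableAt ℝ (formInChart I' σ (f x)) (extChartAt I' (f x) (f x))) :
    mextDeriv I (pullForm I I' f σ) x = pullForm I I' f (mextDeriv I' σ) x := by
  have : IsManifold I 1 X := .of_le (n := ∞) (by simp)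
  have : IsManifold I' 1 Y := .of_le (n := ∞) (by simp)
  have hf' : ContMDiffAt I I' ∞ f ((extChartAt I x).symm (extChartAt I x x)) := by
    rwa [extChartAt_to_inv]
  have hs : f ((extChartAt I x).symm (extChartAt I x x)) ∈ (extChartAt I' (f x)).source := by
    rw [extChartAt_to_inv]; exact mem_extChartAt_source _
  have e1 : localExpr I I' f x (f x) (extChartAt I x x) = extChartAt I' (f x) (f x) := by
    simp [localExpr]
  -- In the charts centred at `x` and `f x` the claim is the pullback rule for `extDeriv` on vector
  -- spaces, applied to the local expression of `f`.
  rw [mextDeriv_eq, (formInChart_eventuallyEq_pullForm σ (mem_extChartAt_target x)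
    (hf'.of_le (by simp)) hs).extDeriv_eq, extDeriv_pullback (r := ∞)
    (by rw [e1]; exact hσ)
    (contDiffAt_localExpr (k := ⊤) (mem_extChartAt_target x) hf' hs)
    minSmoothness_two_le_infty, e1,
    ← tderiv_eq_fderiv_localExpr (hf.mdifferentiableAt (by simp))]
  have e2 := mextDeriv_eq (I := I') σ (f x)
  unfold pullForm
  rw [e2]
  rfl

/-- `mextDeriv` uses a different chart at each point. Naturality of `extDeriv` under the chart
change to the chart centred at the point shows that a single fixed chart computes it everywhere on
its target; this is what allows dΘ to be differentiated again. -/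
theorem formInChart_mextDeriv (σ : ∀ x : X, TangentSpace I x [⋀^Fin n]→L[ℝ] F)
    {x₀ : X} {z : E} (hz : z ∈ (extChartAt I x₀).target)
    (hσ : DifferentiableAt ℝ (formInChart I σ ((extChartAt I x₀).symm z))
      (extChartAt I ((extChartAt I x₀).symm z) ((extChartAt I x₀).symm z))) :
    formInChart I (mextDeriv I σ) x₀ z = extDeriv (formInChart I σ x₀) z := by
  have : IsManifold I 1 X := .of_le (n := ∞) (by simp)
  set x := (extChartAt I x₀).symm z with hx
  have hs : id ((extChartAt I x₀).symm z) ∈ (extChartAt I x).source := mem_extChartAt_source _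
  have e1 : localExpr I I id x₀ x z = extChartAt I x x := rfl
  have h := tderiv_comp_chartInv (f := id) hz mdifferentiableAt_id hs
  rw [e1, chartInv_self] at h
  have hid : tderiv I I id ((extChartAt I x₀).symm z) =
    ContinuousLinearMap.id ℝ E := mfderiv_id
  rw [hid, ContinuousLinearMap.id_comp, ContinuousLinearMap.id_comp] at h
  rw [(formInChart_change σ hz hs).extDeriv_eq, extDeriv_pullback (r := ∞)
    (by rw [e1]; exact hσ) (contDiffAt_localExpr (k := ⊤) hz contMDiffAt_id hs)
    minSmoothness_two_le_infty, e1, ← h,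
    ← mextDeriv_eq]
  rfl

end Forms

/-! ### Cartan's formulas for the exterior derivative in degrees one and two. -/

section VectorSpace

variable {V : Type*} [NormedAddCommGroup V] [NormedSpace ℝ V]
  {F : Type*} [NormedAddCommGroup F] [NormedSpace ℝ F]

theorem alternating_two_swap (σ : V [⋀^Fin 2]→L[ℝ] F) (X Y : V) : σ ![Y, X] = -σ ![X, Y] := by
  have := σ.toAlternatingMap.map_swap ![X, Y] (i := 0) (j := 1) (by decide)
  have e : ![X, Y] ∘ (Equiv.swap (0 : Fin 2) 1) = ![Y, X] := by
    ext i; fin_cases i <;> simp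
  rw [e] at this
  exact this

theorem alternating_two_neg_left (σ : V [⋀^Fin 2]→L[ℝ] F) (X Y : V) :
    σ ![-X, Y] = -σ ![X, Y] := by
  have h := σ.map_update_smul ![X, Y] 0 (-1 : ℝ) X
  have e1 : Function.update ![X, Y] 0 ((-1 : ℝ) • X) = ![-X, Y] := by
    ext i; fin_cases i <;> simp
  have e2 : Function.update ![X, Y] 0 X = ![X, Y] := by
    ext i; fin_cases i <;> simp
  rw [e1, e2] at h
  simpa using h

theorem alternating_two_add_left (σ : V [⋀^Fin 2]→L[ℝ] F) (X X' Y : V) :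
    σ ![X + X', Y] = σ ![X, Y] + σ ![X', Y] := by
  have h := σ.map_update_add ![X, Y] 0 X X'
  have e1 : ∀ Z, Function.update ![X, Y] 0 Z = ![Z, Y] := by
    intro Z; ext i; fin_cases i <;> simp
  simpa only [e1] using h

theorem extDeriv_apply_vectorField_one {A : V → V [⋀^Fin 1]→L[ℝ] F} {X Y : V → V} {x : V}
    (hA : DifferentiableAt ℝ A x) (hX : DifferentiableAt ℝ X x) (hY : DifferentiableAt ℝ Y x) :
    extDeriv A x ![X x, Y x] = fderiv ℝ (fun y => A y ![Y y]) x (X x)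
      - fderiv ℝ (fun y => A y ![X y]) x (Y x) - A x ![VectorField.lieBracket ℝ X Y x] := by
  have h := extDeriv_apply_vectorField (V := ![X, Y]) hA (by
    intro i; fin_cases i <;> assumption)
  have e : (fun i => (![X, Y] : Fin 2 → V → V) i x) = ![X x, Y x] := by
    ext i; fin_cases i <;> rfl
  have e0 : ∀ y, Fin.removeNth 0 (fun i => (![X, Y] : Fin 2 → V → V) i y) = ![Y y] := by
    intro y; ext i; fin_cases i; rfl
  have e1 : ∀ y, Fin.removeNth 1 (fun i => (![X, Y] : Fin 2 → V → V) i y) = ![X y] := by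
    intro y; ext i; fin_cases i; rfl
  have b0 : Matrix.vecCons (VectorField.lieBracket ℝ ((![X, Y] : Fin 2 → V → V) (Fin.castSucc 0))
      ((![X, Y] : Fin 2 → V → V) (Fin.succ 0)) x) (Fin.removeNth 0 (Fin.removeNth (Fin.castSucc 0)
        (fun i => (![X, Y] : Fin 2 → V → V) i x))) = ![VectorField.lieBracket ℝ X Y x] := by
    ext i; fin_cases i; rfl
  rw [Fin.sum_univ_two, Fin.sum_univ_one, show Finset.Ici (0 : Fin 1) = {0} from rfl,
    Finset.sum_singleton, b0] at h
  simp only [e0, e1] at h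
  rw [e] at h
  simpa [sub_eq_add_neg] using h

theorem extDeriv_apply_vectorField_two {σ : V → V [⋀^Fin 2]→L[ℝ] F} {X Y Z : V → V} {x : V}
    (hσ : DifferentiableAt ℝ σ x) (hX : DifferentiableAt ℝ X x) (hY : DifferentiableAt ℝ Y x)
    (hZ : DifferentiableAt ℝ Z x) :
    extDeriv σ x ![X x, Y x, Z x] = fderiv ℝ (fun y => σ y ![Y y, Z y]) x (X x)
      + fderiv ℝ (fun y => σ y ![Z y, X y]) x (Y x)
      + fderiv ℝ (fun y => σ y ![X y, Y y]) x (Z x)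
      - σ x ![VectorField.lieBracket ℝ X Y x, Z x] - σ x ![VectorField.lieBracket ℝ Y Z x, X x]
      - σ x ![VectorField.lieBracket ℝ Z X x, Y x] := by
  have h := extDeriv_apply_vectorField (V := ![X, Y, Z]) hσ (by
    intro i; fin_cases i <;> assumption)
  have e : (fun i => (![X, Y, Z] : Fin 3 → V → V) i x) = ![X x, Y x, Z x] := by
    ext i; fin_cases i <;> rfl
  have e0 : ∀ y, Fin.removeNth 0 (fun i => (![X, Y, Z] : Fin 3 → V → V) i y) = ![Y y, Z y] := by
    intro y; ext i; fin_cases i <;> rfl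
  have e1 : ∀ y, Fin.removeNth 1 (fun i => (![X, Y, Z] : Fin 3 → V → V) i y) = ![X y, Z y] := by
    intro y; ext i; fin_cases i <;> rfl
  have e2 : ∀ y, Fin.removeNth 2 (fun i => (![X, Y, Z] : Fin 3 → V → V) i y) = ![X y, Y y] := by
    intro y; ext i; fin_cases i <;> rfl
  have b00 : Matrix.vecCons (VectorField.lieBracket ℝ
      ((![X, Y, Z] : Fin 3 → V → V) (Fin.castSucc 0)) ((![X, Y, Z] : Fin 3 → V → V) (Fin.succ 0)) x)
      (Fin.removeNth 0 (Fin.removeNth (Fin.castSucc 0)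
        (fun i => (![X, Y, Z] : Fin 3 → V → V) i x))) =
      ![VectorField.lieBracket ℝ X Y x, Z x] := by
    ext i; fin_cases i <;> rfl
  have b01 : Matrix.vecCons (VectorField.lieBracket ℝ
      ((![X, Y, Z] : Fin 3 → V → V) (Fin.castSucc 0)) ((![X, Y, Z] : Fin 3 → V → V) (Fin.succ 1)) x)
      (Fin.removeNth 1 (Fin.removeNth (Fin.castSucc 0)
        (fun i => (![X, Y, Z] : Fin 3 → V → V) i x))) =
      ![VectorField.lieBracket ℝ X Z x, Y x] := by
    ext i; fin_cases i <;> rfl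
  have b11 : Matrix.vecCons (VectorField.lieBracket ℝ
      ((![X, Y, Z] : Fin 3 → V → V) (Fin.castSucc 1)) ((![X, Y, Z] : Fin 3 → V → V) (Fin.succ 1)) x)
      (Fin.removeNth 1 (Fin.removeNth (Fin.castSucc 1)
        (fun i => (![X, Y, Z] : Fin 3 → V → V) i x))) =
      ![VectorField.lieBracket ℝ Y Z x, X x] := by
    ext i; fin_cases i <;> rfl
  rw [Fin.sum_univ_three, Fin.sum_univ_two, show Finset.Ici (0 : Fin 2) = {0, 1} from rfl,
    show Finset.Ici (1 : Fin 2) = {1} from rfl, Finset.sum_pair (by decide),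
    Finset.sum_singleton, b00, b01, b11] at h
  simp only [e0, e1, e2] at h
  rw [e] at h
  -- The general formula has increasing indices and alternating signs; swapping `X` and `Z` in one
  -- derivative and in one bracket brings it to cyclic form.
  have hs : (fun y => σ y ![Z y, X y]) = fun y => -σ y ![X y, Z y] := by
    funext y; exact alternating_two_swap _ _ _
  have hb : σ x ![VectorField.lieBracket ℝ Z X x, Y x] =
      -σ x ![VectorField.lieBracket ℝ X Z x, Y x] := by
    rw [VectorField.lieBracket_swap (V := Z) (W := X)]
    exact alternating_two_neg_left _ _ _
  rw [hs, hb, fderiv_fun_neg]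
  simp at h
  rw [h]
  simp
  abel

end VectorSpace

/-! ### The Jacobiator on the quotient. -/

section Jacobi

variable {V : Type*} [NormedAddCommGroup V] [NormedSpace ℝ V]
  {N : Type*} [NormedAddCommGroup N] [NormedSpace ℝ N]
  {𝔤 : Type*} [NormedAddCommGroup 𝔤] [NormedSpace ℝ 𝔤]

theorem fderiv_fderiv_apply_sub {r : V → N} {X Y : V → V} {x : V} (hr : ContDiffAt ℝ 2 r x)
    (hX : DifferentiableAt ℝ X x) (hY : DifferentiableAt ℝ Y x) :
    fderiv ℝ (fun y => fderiv ℝ r y (Y y)) x (X x) - fderiv ℝ (fun y => fderiv ℝ r y (X y)) x (Y x)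
      = fderiv ℝ r x (VectorField.lieBracket ℝ X Y x) := by
  have hd : DifferentiableAt ℝ (fderiv ℝ r) x :=
    (hr.fderiv_right (m := 1) (by norm_num)).differentiableAt (by simp)
  rw [fderiv_clm_apply hd hX, fderiv_clm_apply hd hY]
  have hs := hr.isSymmSndFDerivAt (by simp)
  simp [VectorField.lieBracket, hs.eq (X x) (Y x)]

/-- The Jacobiator of a bracket on the quotient, in terms of the exterior derivative of an almost
symplectic form on a nonintegrable distribution and of the curvature of the distribution. -/
theorem jacobiator_eq {r : V → N} {p : N → (N →L[ℝ] ℝ) →L[ℝ] N} {X : (N →L[ℝ] ℝ) → V → V}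
    {σ : V → V [⋀^Fin 2]→L[ℝ] ℝ} {A : V → V [⋀^Fin 1]→L[ℝ] 𝔤} {i : 𝔤 →L[ℝ] V}
    {dJ : V →L[ℝ] 𝔤 →L[ℝ] ℝ} {C : V → Submodule ℝ V} {x : V}
    (hr : ContDiffAt ℝ 2 r x) (hp : DifferentiableAt ℝ p (r x))
    (hX : ∀ a, DifferentiableAt ℝ (X a) x) (hσ : DifferentiableAt ℝ σ x)
    (hA : DifferentiableAt ℝ A x)
    (hXC : ∀ a, ∀ᶠ y in 𝓝 x, X a y ∈ C y)
    (hXσ : ∀ a, ∀ᶠ y in 𝓝 x, ∀ v ∈ C y, σ y ![X a y, v] = a (fderiv ℝ r y v))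
    (hpX : ∀ a, ∀ᶠ y in 𝓝 x, p (r y) a = -fderiv ℝ r y (X a y))
    (hAC : ∀ᶠ y in 𝓝 x, ∀ v ∈ C y, A y ![v] = 0)
    (hiA : ∀ v, v - i (A x ![v]) ∈ C x)
    (hri : ∀ ξ, fderiv ℝ r x (i ξ) = 0)
    (hJ : ∀ w, ∀ v ∈ C x, σ x ![i (A x ![w]), v] = dJ v (A x ![w])) (a b c : N →L[ℝ] ℝ) :
    fderiv ℝ (fun z => c (p z b)) (r x) (p (r x) a)
      + fderiv ℝ (fun z => a (p z c)) (r x) (p (r x) b)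
      + fderiv ℝ (fun z => b (p z a)) (r x) (p (r x) c) =
    extDeriv σ x ![X a x, X b x, X c x]
      - (dJ (X c x) (extDeriv A x ![X a x, X b x]) + dJ (X a x) (extDeriv A x ![X b x, X c x])
        + dJ (X b x) (extDeriv A x ![X c x, X a x])) := by
  have hr1 : DifferentiableAt ℝ r x := hr.differentiableAt (by simp)
  have hpd : ∀ b c : N →L[ℝ] ℝ, DifferentiableAt ℝ (fun z => c (p z b)) (r x) := fun b c =>
    c.differentiableAt.comp _ (hp.clm_apply (differentiableAt_const b))
  -- the bracket of two functions on the quotient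
  have hbr : ∀ b c : N →L[ℝ] ℝ,
      (fun y => c (p (r y) b)) =ᶠ[𝓝 x] fun y => σ y ![X b y, X c y] := by
    intro b c
    filter_upwards [hXC b, hXσ c, hpX b] with y h1 h2 h3
    rw [h3, alternating_two_swap, h2 _ h1, map_neg]
  have hchain : ∀ a b c : N →L[ℝ] ℝ, fderiv ℝ (fun z => c (p z b)) (r x) (p (r x) a) =
      -fderiv ℝ (fun y => c (p (r y) b)) x (X a x) := by
    intro a b c
    have h := fderiv_fun_comp x (hpd b c) hr1
    have e : (fun y => c (p (r y) b)) = fun y => (fun z => c (p z b)) (r y) := rfl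
    rw [e, h, (hpX a).self_of_nhds]
    simp
  -- Skewness of `p` is available only along `r`, where it comes from that of `σ`; `hchain` shows
  -- that only derivatives along `r` matter.
  have hskew : ∀ a b c : N →L[ℝ] ℝ, fderiv ℝ (fun z => c (p z b)) (r x) (p (r x) a) =
      -fderiv ℝ (fun z => b (p z c)) (r x) (p (r x) a) := by
    intro a b c
    have h : (fun y => c (p (r y) b)) =ᶠ[𝓝 x] fun y => -(b (p (r y) c)) := by
      filter_upwards [hbr b c, hbr c b] with y h1 h2
      rw [h1, h2, alternating_two_swap]
    rw [hchain, hchain, h.fderiv_eq, fderiv_fun_neg]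
    simp
  have hder : ∀ a b c : N →L[ℝ] ℝ, fderiv ℝ (fun y => σ y ![X b y, X c y]) x (X a x) =
      -fderiv ℝ (fun z => c (p z b)) (r x) (p (r x) a) := by
    intro a b c
    rw [hchain, ← (hbr b c).fderiv_eq, neg_neg]
  -- The second derivative of `r` is symmetric, so `Dr` of the Lie bracket is the antisymmetrised
  -- derivative of `Dr (X b) = -p (r ·) b`. This yields two of the three terms of the Jacobiator.
  have hlie : ∀ a b c : N →L[ℝ] ℝ,
      c (fderiv ℝ r x (VectorField.lieBracket ℝ (X a) (X b) x)) =
        fderiv ℝ (fun z => c (p z b)) (r x) (p (r x) a)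
          + fderiv ℝ (fun z => a (p z c)) (r x) (p (r x) b) := by
    intro a b c
    have hg : ∀ b, (fun y => fderiv ℝ r y (X b y)) =ᶠ[𝓝 x] fun y => -(p (r y) b) := by
      intro b
      filter_upwards [hpX b] with y h
      rw [h, neg_neg]
    have hgd : ∀ b, DifferentiableAt ℝ (fun y => p (r y) b) x := fun b =>
      (hp.comp x hr1).clm_apply (differentiableAt_const b)
    have hc : ∀ b v, c (fderiv ℝ (fun y => fderiv ℝ r y (X b y)) x v) =
        -fderiv ℝ (fun y => c (p (r y) b)) x v := by
      intro b v
      rw [(hg b).fderiv_eq, fderiv_fun_neg]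
      have h : HasFDerivAt (fun y => c (p (r y) b)) (c ∘L fderiv ℝ (fun y => p (r y) b) x) x :=
        c.hasFDerivAt.comp x (hgd b).hasFDerivAt
      rw [h.fderiv]
      simp
    rw [← fderiv_fderiv_apply_sub hr (hX a) (hX b), map_sub, hc, hc, ← hchain, ← hchain,
      hskew b a c]
    ring
  -- `A` vanishes on the fields `X a`, so only the bracket term of Cartan's formula survives.
  have hcurv : ∀ a b : N →L[ℝ] ℝ, extDeriv A x ![X a x, X b x] =
      -A x ![VectorField.lieBracket ℝ (X a) (X b) x] := by
    intro a b
    have h : ∀ b, (fun y => A y ![X b y]) =ᶠ[𝓝 x] fun _ => 0 := by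
      intro b
      filter_upwards [hXC b, hAC] with y h1 h2
      exact h2 _ h1
    rw [extDeriv_apply_vectorField_one hA (hX a) (hX b), (h a).fderiv_eq, (h b).fderiv_eq]
    simp
  have hterm : ∀ a b c : N →L[ℝ] ℝ,
      σ x ![VectorField.lieBracket ℝ (X a) (X b) x, X c x] =
        -(fderiv ℝ (fun z => c (p z b)) (r x) (p (r x) a)
          + fderiv ℝ (fun z => a (p z c)) (r x) (p (r x) b))
        - dJ (X c x) (extDeriv A x ![X a x, X b x]) := by
    intro a b c
    set Z := VectorField.lieBracket ℝ (X a) (X b) x with hZ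
    -- The bracket is split into its part in `C`, on which `σ` is known through `hXσ`, and its
    -- vertical part, on which `σ` is known through `hJ`.
    have e : Z = (Z - i (A x ![Z])) + i (A x ![Z]) := by abel
    have hCx := (hXC c).self_of_nhds
    conv_lhs => rw [e]
    rw [alternating_two_add_left, hJ Z _ hCx, alternating_two_swap,
      (hXσ c).self_of_nhds _ (hiA Z), map_sub, hri, sub_zero, hZ, hlie, hcurv a b]
    simp
  -- With `J` the cyclic sum sought, the differentiated terms contribute `-J` and the bracket terms
  -- `+2J` plus the curvature terms. Hence dσ is `J` plus curvature.
  rw [extDeriv_apply_vectorField_two hσ (hX a) (hX b) (hX c), hder a b c, hder b c a, hder c a b,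
    hterm a b c, hterm b c a, hterm c a b]
  ring

end Jacobi

/-! ### Cartan's formula for a form invariant under a local action. -/

section Momentum

variable {V : Type*} [NormedAddCommGroup V] [NormedSpace ℝ V]
  {S : Type*} [NormedAddCommGroup S] [NormedSpace ℝ S]

/-- Cartan's formula for a 1-form that is invariant under a local action `Φ`. -/
theorem extDeriv_invariant_apply {Φ : S × V → V} {θ : V → V [⋀^Fin 1]→L[ℝ] ℝ} {s : S} {x : V}
    (hΦ : ContDiffAt ℝ ∞ Φ (s, x)) (hθ : DifferentiableAt ℝ θ x)
    (hid : ∀ᶠ y in 𝓝 x, Φ (s, y) = y)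
    (hinv : ∀ᶠ z in 𝓝 (s, x), ∀ v, θ (Φ z) ![fderiv ℝ Φ z (0, v)] = θ z.2 ![v]) (ξ : S) (v : V) :
    extDeriv θ x ![fderiv ℝ Φ (s, x) (ξ, 0), v] =
      -fderiv ℝ (fun y => θ y ![fderiv ℝ Φ (s, y) (ξ, 0)]) x v := by
  have hx : Φ (s, x) = x := hid.self_of_nhds
  have hΦd : DifferentiableAt ℝ Φ (s, x) := hΦ.differentiableAt (by simp)
  have hΦ2 : DifferentiableAt ℝ (fderiv ℝ Φ) (s, x) :=
    (hΦ.fderiv_right (m := 1) two_le_infty).differentiableAt (by simp)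
  have hv : fderiv ℝ Φ (s, x) (0, v) = v := by
    have h : HasFDerivAt (fun y => Φ (s, y)) (fderiv ℝ Φ (s, x) ∘L .inr ℝ S V) x :=
      hΦd.hasFDerivAt.comp x (hasFDerivAt_prodMk_right s x)
    have h2 : (fun y => Φ (s, y)) =ᶠ[𝓝 x] id := hid
    have h3 := h2.fderiv_eq (𝕜 := ℝ)
    rw [h.fderiv, fderiv_id] at h3
    exact DFunLike.congr_fun h3 v
  have hθ' : DifferentiableAt ℝ θ (Φ (s, x)) := by rwa [hx]
  -- No flow is needed: θ is pulled back to the product by Φ, and dλ is evaluated there on the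
  -- constant fields `(ξ, 0)` and `(0, v)`, which commute.
  set lam : S × V → (S × V) [⋀^Fin 1]→L[ℝ] ℝ :=
    fun z => (θ (Φ z)).compContinuousLinearMap (fderiv ℝ Φ z) with hlam
  have hlamd : DifferentiableAt ℝ lam (s, x) :=
    (DifferentiableAt.comp (s, x) hθ' hΦd).continuousAlternatingMapCompContinuousLinearMap hΦ2
  have hlam1 : ∀ z u, lam z ![u] = θ (Φ z) ![fderiv ℝ Φ z u] := by
    intro z u
    rw [hlam]
    simp only [ContinuousAlternatingMap.compContinuousLinearMap_apply]
    congr 1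
    ext i; fin_cases i; rfl
  have h1 := extDeriv_pullback hθ' hΦ minSmoothness_two_le_infty
  have h2 := extDeriv_apply_vectorField_one hlamd
    (X := fun _ => ((ξ, 0) : S × V)) (Y := fun _ => ((0, v) : S × V))
    (differentiableAt_const _) (differentiableAt_const _)
  have hlie : VectorField.lieBracket ℝ (fun _ => ((ξ, 0) : S × V)) (fun _ => ((0, v) : S × V))
      (s, x) = 0 := by
    simp [VectorField.lieBracket]
  have hz : lam (s, x) ![(0 : S × V)] = 0 := (lam (s, x)).map_coord_zero 0 rfl
  rw [hlie, hz, sub_zero] at h2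
  -- By invariance λ on `(0, v)` does not depend on the group variable, so its derivative along `ξ`
  -- is zero.
  have h3 : fderiv ℝ (fun z => lam z ![((0, v) : S × V)]) (s, x) (ξ, 0) = 0 := by
    have e : (fun z => lam z ![((0, v) : S × V)]) =ᶠ[𝓝 (s, x)] fun z => θ z.2 ![v] := by
      filter_upwards [hinv] with z hz
      rw [hlam1, hz]
    have hd : HasFDerivAt (fun z : S × V => θ z.2 ![v])
        ((fderiv ℝ (fun y => θ y ![v]) x) ∘L .snd ℝ S V) (s, x) := by
      have hθv : DifferentiableAt ℝ (fun y => θ y ![v]) x := by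
        fun_prop
      exact HasFDerivAt.comp (s, x) (f := Prod.snd) hθv.hasFDerivAt hasFDerivAt_snd
    rw [e.fderiv_eq, hd.fderiv]
    simp
  have h4 : fderiv ℝ (fun z => lam z ![((ξ, 0) : S × V)]) (s, x) (0, v) =
      fderiv ℝ (fun y => θ y ![fderiv ℝ Φ (s, y) (ξ, 0)]) x v := by
    have hd : DifferentiableAt ℝ (fun z => lam z ![((ξ, 0) : S × V)]) (s, x) := by
      fun_prop
    have h : HasFDerivAt (fun y => lam (s, y) ![((ξ, 0) : S × V)])
        (fderiv ℝ (fun z => lam z ![((ξ, 0) : S × V)]) (s, x) ∘L .inr ℝ S V) x :=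
      HasFDerivAt.comp x (f := fun y => (s, y)) hd.hasFDerivAt (hasFDerivAt_prodMk_right s x)
    have e : (fun y => θ y ![fderiv ℝ Φ (s, y) (ξ, 0)]) =ᶠ[𝓝 x]
        fun y => lam (s, y) ![((ξ, 0) : S × V)] := by
      filter_upwards [hid] with y hy
      rw [hlam1, hy]
    rw [e.fderiv_eq, h.fderiv]
    rfl
  rw [h3, h4, zero_sub] at h2
  rw [← h2, h1, hx]
  simp only [ContinuousAlternatingMap.compContinuousLinearMap_apply]
  congr 1
  ext i; fin_cases i
  · rfl
  · exact hv.symm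

end Momentum

/-! ### Smooth dependence of inverses, kernels and projections on parameters. -/

section SmoothFamilies

variable {Z : Type*} [NormedAddCommGroup Z] [NormedSpace ℝ Z]
  {R : Type*} [NormedAddCommGroup R] [NormedSpace ℝ R] [FiniteDimensional ℝ R]
  {F : Type*} [NormedAddCommGroup F] [NormedSpace ℝ F] [FiniteDimensional ℝ F]
  {V : Type*} [NormedAddCommGroup V] [NormedSpace ℝ V]

/-- A smooth family of linear maps that is injective at a point has a smooth family of left
inverses near this point. -/
theorem exists_contDiffAt_leftInverse {T : Z → R →L[ℝ] F} {z : Z} (hT : ContDiffAt ℝ ∞ T z)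
    (hinj : Function.Injective (T z)) :
    ∃ K : Z → F →L[ℝ] R, ContDiffAt ℝ ∞ K z ∧
      ∀ᶠ y in 𝓝 z, K y ∘L T y = ContinuousLinearMap.id ℝ R := by
  -- For a left inverse `k` at the single point `z`, the endomorphism `k ∘ T y` is invertible for
  -- `y` near `z`; correcting `k` by its inverse, which depends smoothly on `y`, gives the family.
  obtain ⟨k, hk⟩ := LinearMap.exists_leftInverse_of_injective (T z).toLinearMap
    (LinearMap.ker_eq_bot.2 hinj)
  have : CompleteSpace R := FiniteDimensional.complete ℝ R
  let k' : F →L[ℝ] R := LinearMap.toContinuousLinearMap k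
  have hkT : k' ∘L T z = ContinuousLinearMap.id ℝ R := by
    ext v
    exact LinearMap.congr_fun hk v
  have hS : ContDiffAt ℝ ∞ (fun y => k' ∘L T y) z := contDiffAt_const.clm_comp hT
  have hu : IsUnit (k' ∘L T z) := by rw [hkT]; exact isUnit_one
  refine ⟨fun y => (Ring.inverse (k' ∘L T y) : R →L[ℝ] R) ∘L k', ?_, ?_⟩
  · have h : ContDiffAt ℝ ∞ (Ring.inverse : (R →L[ℝ] R) → (R →L[ℝ] R)) (k' ∘L T z) :=
      contDiffAt_ringInverse ℝ hu.unit
    have h2 : ContDiffAt ℝ ∞ (fun y => (Ring.inverse (k' ∘L T y) : R →L[ℝ] R)) z :=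
      ContDiffAt.comp (g := (Ring.inverse : (R →L[ℝ] R) → (R →L[ℝ] R))) z h hS
    exact h2.clm_comp contDiffAt_const
  · have h : ∀ᶠ y in 𝓝 z, IsUnit (k' ∘L T y) := by
      have := hS.continuousAt (Units.isOpen.mem_nhds hu)
      exact this
    filter_upwards [h] with y hy
    rw [ContinuousLinearMap.comp_assoc]
    exact Ring.inverse_mul_cancel _ hy

/-- A left inverse of `T` solves the equation `T A = B` for `A`. Both the connection form and the
gauge transformed bivector are known only through such an equation. -/
theorem ContDiffAt.of_injective_comp {T : Z → R →L[ℝ] F} {A : Z → V →L[ℝ] R} {B : Z → V →L[ℝ] F}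
    {z : Z} (hT : ContDiffAt ℝ ∞ T z) (hinj : Function.Injective (T z))
    (hB : ContDiffAt ℝ ∞ B z) (h : ∀ᶠ y in 𝓝 z, T y ∘L A y = B y) : ContDiffAt ℝ ∞ A z := by
  obtain ⟨K, hK, hKT⟩ := exists_contDiffAt_leftInverse hT hinj
  refine (hK.clm_comp hB).congr_of_eventuallyEq ?_
  filter_upwards [h, hKT] with y h1 h2
  rw [← h1, ← ContinuousLinearMap.comp_assoc, h2, ContinuousLinearMap.id_comp]

/-- A smooth frame is the kernel of a smooth family of linear maps. -/
theorem exists_contDiffAt_ker {s : Z → R →L[ℝ] F} {z : Z} (hs : ContDiffAt ℝ ∞ s z)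
    (hinj : Function.Injective (s z)) :
    ∃ N : Z → F →L[ℝ] F, ContDiffAt ℝ ∞ N z ∧
      ∀ᶠ y in 𝓝 z, ∀ v, N y v = 0 ↔ ∃ c, s y c = v := by
  obtain ⟨K, hK, hKs⟩ := exists_contDiffAt_leftInverse hs hinj
  -- `s ∘ K` is a projection onto the range of `s`, so its complement has exactly this range as
  -- kernel.
  refine ⟨fun y => ContinuousLinearMap.id ℝ F - s y ∘L K y,
    contDiffAt_const.sub (hs.clm_comp hK), ?_⟩
  filter_upwards [hKs] with y hy v
  constructor
  · intro h
    refine ⟨K y v, ?_⟩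
    have h' : v - s y (K y v) = 0 := h
    exact (sub_eq_zero.1 h').symm
  · rintro ⟨c, rfl⟩
    have h' : K y (s y c) = c := DFunLike.congr_fun hy c
    change s y c - s y (K y (s y c)) = 0
    rw [h', sub_self]

/-- The projection onto the span of a smooth frame, along the kernel of a smooth family of linear
maps, is smooth. -/
theorem contDiffAt_projection {L : Z → V →L[ℝ] F} {w : Z → R →L[ℝ] V} {P : Z → V →L[ℝ] V} {z : Z}
    (hL : ContDiffAt ℝ ∞ L z) (hw : ContDiffAt ℝ ∞ w z)
    (hinj : Function.Injective (L z ∘L w z))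
    (h : ∀ᶠ y in 𝓝 z, ∀ v, (∃ c, P y v = w y c) ∧ L y (v - P y v) = 0) :
    ContDiffAt ℝ ∞ P z := by
  obtain ⟨K, hK, hKs⟩ := exists_contDiffAt_leftInverse (hL.clm_comp hw) hinj
  -- If `P v = w c` and `L (v - P v) = 0`, then `L w c = L v`; with `K` a left inverse of `L w` this
  -- forces `P = w K L`.
  refine (hw.clm_comp (hK.clm_comp hL)).congr_of_eventuallyEq ?_
  filter_upwards [h, hKs] with y h1 h2
  ext v
  obtain ⟨⟨c, hc⟩, h3⟩ := h1 v
  rw [map_sub, sub_eq_zero] at h3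
  have h4 : K y (L y (w y c)) = c := DFunLike.congr_fun h2 c
  change P y v = w y (K y (L y v))
  rw [h3, hc, h4]

/-- A positive definite bilinear form on a finite-dimensional space. -/
theorem exists_definite_form (F : Type*) [NormedAddCommGroup F] [NormedSpace ℝ F]
    [FiniteDimensional ℝ F] : ∃ g : F →L[ℝ] F →L[ℝ] ℝ, ∀ v, g v v = 0 → v = 0 := by
  let e : F ≃L[ℝ] EuclideanSpace ℝ (Fin (Module.finrank ℝ F)) :=
    ContinuousLinearEquiv.ofFinrankEq (by simp)
  refine ⟨(innerSL ℝ (E := EuclideanSpace ℝ (Fin (Module.finrank ℝ F)))).bilinearComp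
    e.toContinuousLinearMap e.toContinuousLinearMap, fun v hv => ?_⟩
  have h : inner ℝ (e v) (e v) = (0 : ℝ) := hv
  rw [inner_self_eq_zero] at h
  exact (map_eq_zero_iff e e.injective).1 h

end SmoothFamilies

/-! ### Local left inverses of immersions and local sections of submersions. -/

section Embedding

variable {E : Type*} [NormedAddCommGroup E] [NormedSpace ℝ E]
  {H : Type*} [TopologicalSpace H] {I : ModelWithCorners ℝ E H} [I.Boundaryless]
  {X : Type*} [TopologicalSpace X] [ChartedSpace H X]
  {E' : Type*} [NormedAddCommGroup E'] [NormedSpace ℝ E']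
  {H' : Type*} [TopologicalSpace H'] {I' : ModelWithCorners ℝ E' H'}
  {Y : Type*} [TopologicalSpace Y] [ChartedSpace H' Y]
  {E'' : Type*} [NormedAddCommGroup E''] [NormedSpace ℝ E'']
  {H'' : Type*} [TopologicalSpace H''] {I'' : ModelWithCorners ℝ E'' H''}
  {Z : Type*} [TopologicalSpace Z] [ChartedSpace H'' Z] {n : WithTop ℕ∞}

/-- An immersion has smooth local left inverses. -/
theorem exists_local_leftInverse {ι : X → Y} {x : X} (hi : Manifold.IsImmersionAt I I' n ι x) :
    ∃ g : Y → X, ContMDiffAt I' I n g (ι x) ∧ ∀ᶠ x' in 𝓝 x, g (ι x') = x' := by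
  have hψ := hi.codChart.contMDiffOn_extend (I := I') hi.codChart_mem_maximalAtlas
  have hφ := contMDiffOn_extend_symm (I := I) hi.domChart_mem_maximalAtlas
  have hw := hi.writtenInCharts
  have hsrc := hi.mem_domChart_source
  set φ := hi.domChart with hφdef
  set ψ := hi.codChart with hψdef
  -- In adapted charts the immersion is `u ↦ (u, 0)`; the left inverse reads off the first
  -- component.
  have h2 : ContMDiffAt I' 𝓘(ℝ, E) n (Prod.fst ∘ hi.equiv.symm ∘ ψ.extend I') (ι x) := by
    have hl : ContMDiff 𝓘(ℝ, E') 𝓘(ℝ, E) n (Prod.fst ∘ hi.equiv.symm) := by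
      rw [contMDiff_iff_contDiff]
      exact contDiff_fst.comp hi.equiv.symm.contDiff
    exact hl.contMDiffAt.comp (ι x)
      (hψ.contMDiffAt (ψ.open_source.mem_nhds hi.mem_codChart_source))
  have hmem : ∀ x ∈ φ.source, (Prod.fst ∘ hi.equiv.symm ∘ ψ.extend I') (ι x) = φ.extend I x := by
    intro x hx
    have hx' : x ∈ (φ.extend I).source := by rwa [φ.extend_source]
    have h := hw ((φ.extend I).map_source hx')
    simp only [Function.comp_apply, (φ.extend I).left_inv hx'] at h
    simp only [Function.comp_apply]
    rw [h]
    simp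
  have himg : (I '' φ.target) ∈ 𝓝 ((Prod.fst ∘ hi.equiv.symm ∘ ψ.extend I') (ι x)) := by
    have : I '' φ.target = (φ.extend I).target := by
      rw [φ.extend_target, I.image_eq]
    rw [hmem x hsrc, this]
    exact (φ.isOpen_extend_target).mem_nhds
      ((φ.extend I).map_source (by rwa [φ.extend_source]))
  refine ⟨_, (hφ.contMDiffAt himg).comp (ι x) h2, ?_⟩
  filter_upwards [φ.open_source.mem_nhds hsrc] with y hy
  rw [Function.comp_apply, hmem y hy, (φ.extend I).left_inv (by rwa [φ.extend_source])]

/-- A map into an embedded submanifold is smooth if it is smooth as a map into the ambient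
manifold. -/
theorem contMDiffAt_of_comp_isSmoothEmbedding {ι : X → Y} (hι : Manifold.IsSmoothEmbedding I I' n ι)
    {f : Z → X} {z : Z} (hf : ContMDiffAt I'' I' n (ι ∘ f) z) : ContMDiffAt I'' I n f z := by
  -- Continuity comes from the topological part of the embedding; it keeps `f` inside the
  -- neighbourhood on which the local left inverse of `ι` is valid.
  have hcont : ContinuousAt f z :=
    hι.isEmbedding.continuousAt_iff.2 hf.continuousAt
  obtain ⟨g, hg, hgι⟩ := exists_local_leftInverse (hι.isImmersion.isImmersionAt (f z))
  refine (ContMDiffAt.comp z hg hf).congr_of_eventuallyEq ?_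
  filter_upwards [hcont.eventually hgι] with y hy
  exact hy.symm

theorem tderiv_injective_of_isImmersionAt {ι : X → Y} {x : X}
    (hi : Manifold.IsImmersionAt I I' ∞ ι x) : Function.Injective (tderiv I I' ι x) := by
  obtain ⟨g, hg, hgι⟩ := exists_local_leftInverse hi
  have h := (hg.mdifferentiableAt (by simp)).hasMFDerivAt.comp x
    (hi.contMDiffAt.mdifferentiableAt (by simp)).hasMFDerivAt
  have h2 : mfderiv I I (g ∘ ι) x = mfderiv I I id x :=
    Filter.EventuallyEq.mfderiv_eq hgι
  rw [h.mfderiv, mfderiv_id] at h2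
  intro v w hvw
  have hv := DFunLike.congr_fun h2 v
  have hw := DFunLike.congr_fun h2 w
  exact hv.symm.trans ((congrArg (mfderiv I' I g (ι x)) hvw).trans hw)

/-- A submersion has smooth local sections. -/
theorem exists_local_section [IsManifold I n X] {ρ : X → Z} [I''.Boundaryless]
    {x : X} (hρ : Manifold.IsSubmersionAt I I'' n ρ x) :
    ∃ s : Z → X, ContMDiffAt I'' I n s (ρ x) ∧ s (ρ x) = x ∧ ∀ᶠ z in 𝓝 (ρ x), ρ (s z) = z := by
  have hψ := hρ.codChart.contMDiffOn_extend (I := I'') hρ.codChart_mem_maximalAtlas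
  have hφ := contMDiffOn_extend_symm (I := I) hρ.domChart_mem_maximalAtlas
  have hw := hρ.writtenInCharts
  have hsrc := hρ.mem_domChart_source
  have hsrc' := hρ.mem_codChart_source
  have hms := hρ.source_subset_preimage_source
  set φ := hρ.domChart with hφdef
  set ψ := hρ.codChart with hψdef
  have hx' : x ∈ (φ.extend I).source := by rwa [φ.extend_source]
  have hz' : ρ x ∈ (ψ.extend I'').source := by rwa [ψ.extend_source]
  -- In adapted charts the submersion is `(u, c) ↦ u`; the section freezes the fibre coordinate at
  -- its value at `x`, so that it passes through `x`.
  set c := (hρ.equiv (φ.extend I x)).2 with hc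
  have hfst : (hρ.equiv (φ.extend I x)).1 = ψ.extend I'' (ρ x) := by
    have h := hw ((φ.extend I).map_source hx')
    simp only [Function.comp_apply, (φ.extend I).left_inv hx'] at h
    exact h.symm
  let u : Z → E := fun z => hρ.equiv.symm (ψ.extend I'' z, c)
  have hux : u (ρ x) = φ.extend I x := by
    simp only [u, ← hfst, hc]
    simp
  have hu : ContMDiffAt I'' 𝓘(ℝ, E) n u (ρ x) := by
    have h1 : ContMDiffAt I'' 𝓘(ℝ, E'') n (ψ.extend I'') (ρ x) :=
      hψ.contMDiffAt (ψ.open_source.mem_nhds hsrc')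
    have h2 : ContMDiff 𝓘(ℝ, E'') 𝓘(ℝ, E) n (fun y => hρ.equiv.symm (y, c)) := by
      rw [contMDiff_iff_contDiff]
      exact hρ.equiv.symm.contDiff.comp (contDiff_id.prodMk contDiff_const)
    exact h2.contMDiffAt.comp (ρ x) h1
  have hopen : (φ.extend I).target ∈ 𝓝 (u (ρ x)) := by
    rw [hux]
    exact (φ.isOpen_extend_target).mem_nhds ((φ.extend I).map_source hx')
  have himg : (I '' φ.target) ∈ 𝓝 (u (ρ x)) := by
    have : I '' φ.target = (φ.extend I).target := by
      rw [φ.extend_target, I.image_eq]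
    rwa [this]
  refine ⟨(φ.extend I).symm ∘ u, (hφ.contMDiffAt himg).comp (ρ x) hu, ?_, ?_⟩
  · rw [Function.comp_apply, hux, (φ.extend I).left_inv hx']
  · filter_upwards [hu.continuousAt hopen, ψ.open_source.mem_nhds hsrc'] with z hz hzs
    have h := hw hz
    simp only [Function.comp_apply] at h ⊢
    have h3 : ρ ((φ.extend I).symm (u z)) ∈ (ψ.extend I'').source := by
      rw [ψ.extend_source]
      apply hms
      rw [← φ.extend_source (I := I)]
      exact (φ.extend I).map_target hz
    refine (ψ.extend I'').injOn h3 (by rwa [ψ.extend_source]) ?_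
    rw [h]
    simp [u]

end Embedding

/-! ### Charts of the cotangent bundle and the Liouville form. -/

section CotangentCharts

variable {E : Type*} [NormedAddCommGroup E] [NormedSpace ℝ E]
  {Q : Type*} [TopologicalSpace Q] [ChartedSpace E Q]
  [IsManifold 𝓘(ℝ, E) ∞ Q]

/-- A covector in the preferred chart at `q₀`. -/
def covectorInChart (q₀ : Q) (p : CotangentBundle E Q) : E →L[ℝ] ℝ :=
  (show E →L[ℝ] ℝ from p.2) ∘L chartInv 𝓘(ℝ, E) q₀ (extChartAt 𝓘(ℝ, E) q₀ p.1)

/-- The bundle chart at `p` depends only on the base point of `p`: it consists of the base chart and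
the covector precomposed with the derivative of the inverse chart. All later computations on T*Q use
these coordinates (q, p). -/
theorem extChartAt_cotangent {p p' : CotangentBundle E Q}
    (hp : p'.1 ∈ (chartAt E p.1).source) :
    extChartAt (cotangentModel E) p p' =
      (extChartAt 𝓘(ℝ, E) p.1 p'.1, covectorInChart p.1 p') := by
  have h0 : extChartAt (cotangentModel E) p p' = chartAt (ModelProd E (E →L[ℝ] ℝ)) p p' := rfl
  have h := hom_chart (HB := E) p p'
  rw [h0, h]
  refine Prod.ext rfl ?_
  have h2 := TangentBundle.symmL_trivializationAt (I := 𝓘(ℝ, E)) hp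
  have h3 : ContinuousLinearMap.inCoordinates E (TangentSpace 𝓘(ℝ, E)) ℝ (fun _ : Q => ℝ)
      p.1 p'.1 p.1 p'.1 p'.2 = covectorInChart p.1 p' := by
    unfold ContinuousLinearMap.inCoordinates
    rw [h2]
    ext v
    simp [covectorInChart, chartInv]
    rfl
  exact h3

theorem mem_extChartAt_cotangent_source {p p' : CotangentBundle E Q} :
    p' ∈ (extChartAt (cotangentModel E) p).source ↔ p'.1 ∈ (chartAt E p.1).source := by
  rw [extChartAt_source, FiberBundle.chartedSpace_chartAt]
  simp only [hom_trivializationAt_source, OpenPartialHomeomorph.trans_toPartialEquiv,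
    PartialEquiv.trans_source, mfld_simps]
  exact ⟨fun h => h.1.1, fun h => ⟨⟨h, Set.mem_univ _⟩, h⟩⟩

theorem contMDiff_cotangentProj :
    ContMDiff (cotangentModel E) 𝓘(ℝ, E) ∞ (cotangentProj E Q) :=
  Bundle.contMDiff_proj (fun q : Q => TangentSpace 𝓘(ℝ, E) q →L[ℝ] ℝ)

theorem liouvilleForm_apply (p : CotangentBundle E Q) (v : E × (E →L[ℝ] ℝ)) :
    (liouvilleForm E Q p : (E × (E →L[ℝ] ℝ)) [⋀^Fin 1]→L[ℝ] ℝ) ![v] =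
      (show E →L[ℝ] ℝ from p.2) (tderiv (cotangentModel E) 𝓘(ℝ, E) (cotangentProj E Q) p v) :=
  rfl

/-- The Liouville form in the charts of the cotangent bundle is `p dq`. -/
theorem formInChart_liouvilleForm {p : CotangentBundle E Q} {z : E × (E →L[ℝ] ℝ)}
    (hz : z ∈ (extChartAt (cotangentModel E) p).target) (v : E × (E →L[ℝ] ℝ)) :
    formInChart (cotangentModel E) (liouvilleForm E Q) p z ![v] = z.2 v.1 := by
  have : IsManifold 𝓘(ℝ, E) 1 Q := .of_le (n := ∞) (by simp)
  have : IsManifold (cotangentModel E) 1 (CotangentBundle E Q) := .of_le (n := ∞) (by simp)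
  set p' := (extChartAt (cotangentModel E) p).symm z with hp'
  have hsrc : p' ∈ (extChartAt (cotangentModel E) p).source :=
    (extChartAt (cotangentModel E) p).map_target hz
  have hsrc' := mem_extChartAt_cotangent_source.1 hsrc
  have hzz : extChartAt (cotangentModel E) p p' = z := (extChartAt (cotangentModel E) p).right_inv hz
  rw [extChartAt_cotangent hsrc'] at hzz
  have h1 : formInChart (cotangentModel E) (liouvilleForm E Q) p z ![v] =
      (show E →L[ℝ] ℝ from p'.2) ((tderiv (cotangentModel E) 𝓘(ℝ, E) (cotangentProj E Q) p' ∘L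
        chartInv (cotangentModel E) p z) v) := by
    rfl
  have hloc : localExpr (cotangentModel E) 𝓘(ℝ, E) (cotangentProj E Q) p p.1 =ᶠ[𝓝 z] Prod.fst := by
    filter_upwards [chart_mem_nhds (I := cotangentModel E) hz] with w hw
    have hs := mem_extChartAt_cotangent_source.1 ((extChartAt (cotangentModel E) p).map_target hw)
    have h := (extChartAt (cotangentModel E) p).right_inv hw
    rw [extChartAt_cotangent hs] at h
    exact congrArg Prod.fst h
  rw [h1, tderiv_comp_chartInv (y₀ := p.1) hz
    (contMDiff_cotangentProj.mdifferentiable (by simp) _)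
    (by rw [extChartAt_source]; exact hsrc'), hloc.fderiv_eq, hloc.self_of_nhds, fderiv_fst]
  have h4 : z.2 = covectorInChart p.1 p' := (congrArg Prod.snd hzz).symm
  have h5 : z.1 = extChartAt 𝓘(ℝ, E) p.1 p'.1 := (congrArg Prod.fst hzz).symm
  rw [h4, h5]
  rfl

theorem contDiffAt_formInChart_liouvilleForm {p : CotangentBundle E Q} {z : E × (E →L[ℝ] ℝ)}
    (hz : z ∈ (extChartAt (cotangentModel E) p).target) :
    ContDiffAt ℝ ∞ (formInChart (cotangentModel E) (liouvilleForm E Q) p) z := by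
  let L := (ContinuousAlternatingMap.ofSubsingletonLIE (𝕜 := ℝ) (E := E × (E →L[ℝ] ℝ)) (F := ℝ)
    (0 : Fin 1))
  have h : ContDiffAt ℝ ∞ (fun z : E × (E →L[ℝ] ℝ) => L (z.2 ∘L ContinuousLinearMap.fst ℝ _ _)) z :=
    L.contDiff.contDiffAt.comp z (contDiffAt_snd.clm_comp contDiffAt_const)
  refine h.congr_of_eventuallyEq ?_
  filter_upwards [chart_mem_nhds (I := cotangentModel E) hz] with w hw
  ext v
  have e : v = ![v 0] := by funext i; fin_cases i; rfl
  rw [e]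
  exact formInChart_liouvilleForm hw (v 0)

end CotangentCharts

/-! ### Smoothness of pulled back 1-forms and of exterior derivatives. -/

section OneForms

variable {E : Type*} [NormedAddCommGroup E] [NormedSpace ℝ E]
  {H : Type*} [TopologicalSpace H] {I : ModelWithCorners ℝ E H} [I.Boundaryless]
  {X : Type*} [TopologicalSpace X] [ChartedSpace H X] [IsManifold I ∞ X]
  {E' : Type*} [NormedAddCommGroup E'] [NormedSpace ℝ E']
  {H' : Type*} [TopologicalSpace H'] {I' : ModelWithCorners ℝ E' H'} [I'.Boundaryless]
  {Y : Type*} [TopologicalSpace Y] [ChartedSpace H' Y] [IsManifold I' ∞ Y]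
  {F : Type*} [NormedAddCommGroup F] [NormedSpace ℝ F]

theorem contDiffAt_formInChart_pullForm_one (σ : ∀ y : Y, TangentSpace I' y [⋀^Fin 1]→L[ℝ] F)
    {f : X → Y} {x₀ : X} {y₀ : Y} {z : E}
    (hz : z ∈ (extChartAt I x₀).target)
    (hf : ContMDiffAt I I' ∞ f ((extChartAt I x₀).symm z))
    (hfz : f ((extChartAt I x₀).symm z) ∈ (extChartAt I' y₀).source)
    (hσ : ContDiffAt ℝ ∞ (formInChart I' σ y₀) (localExpr I I' f x₀ y₀ z)) :
    ContDiffAt ℝ ∞ (formInChart I (pullForm I I' f σ) x₀) z := by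
  let L := (ContinuousAlternatingMap.ofSubsingletonLIE (𝕜 := ℝ) (E := E) (F := F) (0 : Fin 1))
  let L' := (ContinuousAlternatingMap.ofSubsingletonLIE (𝕜 := ℝ) (E := E') (F := F) (0 : Fin 1))
  have hloc := contDiffAt_localExpr (k := ⊤) hz hf hfz
  -- Viewing 1-forms as linear maps turns their pullback into a composition, whose smoothness is
  -- immediate.
  have h1 : ContDiffAt ℝ ∞ (fun z => L'.symm (formInChart I' σ y₀ (localExpr I I' f x₀ y₀ z))) z :=
    L'.symm.contDiff.contDiffAt.comp z (ContDiffAt.comp z hσ hloc)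
  have h2 : ContDiffAt ℝ ∞ (fderiv ℝ (localExpr I I' f x₀ y₀)) z :=
    hloc.fderiv_right (m := ∞) le_rfl
  have h3 : ContDiffAt ℝ ∞ (fun z => L (L'.symm (formInChart I' σ y₀ (localExpr I I' f x₀ y₀ z)) ∘L
      fderiv ℝ (localExpr I I' f x₀ y₀) z)) z :=
    L.contDiff.contDiffAt.comp z (h1.clm_comp h2)
  refine h3.congr_of_eventuallyEq ?_
  filter_upwards [formInChart_eventuallyEq_pullForm σ hz (hf.of_le (by simp)) hfz] with w hw
  rw [hw]
  ext v
  have e : v = ![v 0] := by funext i; fin_cases i; rfl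
  rw [e]
  simp only [ContinuousAlternatingMap.compContinuousLinearMap_apply]
  change _ = formInChart I' σ y₀ (localExpr I I' f x₀ y₀ w) (fun _ => _)
  congr 1
  funext i
  fin_cases i
  rfl

theorem ContDiffAt.extDeriv {n : ℕ} {σ : E → E [⋀^Fin n]→L[ℝ] F} {z : E}
    (h : ContDiffAt ℝ ∞ σ z) : ContDiffAt ℝ ∞ (extDeriv σ) z :=
  ContDiffAt.comp (g := ContinuousAlternatingMap.alternatizeUncurryFinCLM ℝ E F)
    (f := fderiv ℝ σ) z (ContinuousLinearMap.contDiff _).contDiffAt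
    (h.fderiv_right (m := ∞) le_rfl)

end OneForms

/-! ### Smooth frames of distributions in charts. -/

section Distributions

variable {E : Type*} [NormedAddCommGroup E] [NormedSpace ℝ E]
  {X : Type*} [TopologicalSpace X] [ChartedSpace E X] [IsManifold 𝓘(ℝ, E) ∞ X]

theorem contDiffAt_section_inChart {s : ∀ x : X, TangentSpace 𝓘(ℝ, E) x} {x₀ : X}
    (hs : ContMDiffAt 𝓘(ℝ, E) 𝓘(ℝ, E).tangent ∞
      (fun x => (⟨x, s x⟩ : TangentBundle 𝓘(ℝ, E) X)) x₀) :
    ContDiffAt ℝ ∞ (fun y : E => chartFwd 𝓘(ℝ, E) x₀ ((extChartAt 𝓘(ℝ, E) x₀).symm y)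
      (s ((extChartAt 𝓘(ℝ, E) x₀).symm y))) (extChartAt 𝓘(ℝ, E) x₀ x₀) := by
  have : IsManifold 𝓘(ℝ, E) 1 X := .of_le (n := ∞) (by simp)
  have h1 := (Bundle.contMDiffAt_totalSpace.1 hs).2
  have h2 : ContMDiffAt 𝓘(ℝ, E) 𝓘(ℝ, E) ∞ (fun x => chartFwd 𝓘(ℝ, E) x₀ x (s x)) x₀ := by
    refine h1.congr_of_eventuallyEq ?_
    filter_upwards [(chartAt E x₀).open_source.mem_nhds (mem_chart_source E x₀)] with x hx
    have h := TangentBundle.continuousLinearMapAt_trivializationAt (I := 𝓘(ℝ, E)) hx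
    have h' := DFunLike.congr_fun h (s x)
    rw [Bundle.Trivialization.continuousLinearMapAt_apply,
      Bundle.Trivialization.coe_linearMapAt_of_mem _ (by simpa using hx)] at h'
    exact h'.symm
  have h3 : ContMDiffAt 𝓘(ℝ, E) 𝓘(ℝ, E) ∞ (extChartAt 𝓘(ℝ, E) x₀).symm
      (extChartAt 𝓘(ℝ, E) x₀ x₀) := by
    have := contMDiffWithinAt_extChartAt_symm_range (I := 𝓘(ℝ, E)) (n := ∞) x₀
      (mem_extChartAt_target x₀)
    rwa [ModelWithCorners.range_eq_univ, contMDiffWithinAt_univ] at this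
  exact (ContMDiffAt.comp (extChartAt 𝓘(ℝ, E) x₀ x₀) (by rwa [extChartAt_to_inv]) h3).contDiffAt

/-- A local frame is packaged as one smooth family of injective maps from ℝ^r whose range is the
distribution in the chart. This is the input for the lemmas on smooth families of linear maps. -/
theorem exists_frame_inChart [IsManifold 𝓘(ℝ, E) 1 X]
    {D : ∀ x : X, Submodule ℝ (TangentSpace 𝓘(ℝ, E) x)}
    (hD : IsSmoothDistribution 𝓘(ℝ, E) D) (x₀ : X) :
    ∃ (r : ℕ) (s : E → (Fin r → ℝ) →L[ℝ] E), ContDiffAt ℝ ∞ s (extChartAt 𝓘(ℝ, E) x₀ x₀) ∧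
      ∀ᶠ y in 𝓝 (extChartAt 𝓘(ℝ, E) x₀ x₀), Function.Injective (s y) ∧
        ∀ v, chartInv 𝓘(ℝ, E) x₀ y v ∈ D ((extChartAt 𝓘(ℝ, E) x₀).symm y) ↔ ∃ c, s y c = v := by
  obtain ⟨r, U, s, hU, hx₀, hs, hD⟩ := hD x₀
  let u : Fin r → E → E := fun i y => chartFwd 𝓘(ℝ, E) x₀ ((extChartAt 𝓘(ℝ, E) x₀).symm y)
      (s i ((extChartAt 𝓘(ℝ, E) x₀).symm y))
  have hu : ∀ i, ContDiffAt ℝ ∞ (u i) (extChartAt 𝓘(ℝ, E) x₀ x₀) := fun i =>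
    contDiffAt_section_inChart ((hs i).contMDiffAt (hU.mem_nhds hx₀))
  have hcomb : ∀ y c, (∑ i, (ContinuousLinearMap.proj (R := ℝ) (φ := fun _ : Fin r => ℝ) i).smulRight
      (u i y)) c = ∑ i, c i • u i y := by
    intro y c
    simp [sum_apply]
  refine ⟨r, fun y => ∑ i, (ContinuousLinearMap.proj (R := ℝ) (φ := fun _ : Fin r => ℝ) i).smulRight
    (u i y), ?_, ?_⟩
  · refine ContDiffAt.sum fun i _ => ?_
    exact ContDiffAt.smulRight contDiffAt_const (hu i)
  · have hev : ∀ᶠ y in 𝓝 (extChartAt 𝓘(ℝ, E) x₀ x₀), (extChartAt 𝓘(ℝ, E) x₀).symm y ∈ U :=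
      (continuousAt_extChartAt_symm x₀) (by rw [extChartAt_to_inv]; exact hU.mem_nhds hx₀)
    filter_upwards [hev, chart_mem_nhds (mem_extChartAt_target (I := 𝓘(ℝ, E)) x₀)] with y hy hyt
    obtain ⟨hli, hspan⟩ := hD _ hy
    have hIu : ∀ i, chartInv 𝓘(ℝ, E) x₀ y (u i y) = s i ((extChartAt 𝓘(ℝ, E) x₀).symm y) := fun i =>
      DFunLike.congr_fun (chartInv_comp_chartFwd (I := 𝓘(ℝ, E)) hyt) _
    have hInj : Function.Injective (chartInv 𝓘(ℝ, E) x₀ y) := by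
      intro a b hab
      have h := chartFwd_comp_chartInv (I := 𝓘(ℝ, E)) hyt
      have ha := DFunLike.congr_fun h a
      have hb := DFunLike.congr_fun h b
      simp only [ContinuousLinearMap.comp_apply, hab] at ha hb
      exact ha.symm.trans hb
    have hsum : ∀ c : Fin r → ℝ, chartInv 𝓘(ℝ, E) x₀ y (∑ i, c i • u i y) =
        (∑ i, c i • (s i ((extChartAt 𝓘(ℝ, E) x₀).symm y) : E) : E) := by
      intro c
      simp only [map_sum, map_smul, hIu]
      rfl
    constructor
    · rw [injective_iff_map_eq_zero]
      intro c hc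
      rw [hcomb] at hc
      have h0 := hsum c
      rw [hc, map_zero] at h0
      funext i
      exact Fintype.linearIndependent_iff.1 hli c h0.symm i
    · intro v
      rw [← hspan]
      refine Iff.trans (Submodule.mem_span_range_iff_exists_fun (M := E) ℝ) ?_
      constructor
      · rintro ⟨c, hc⟩
        refine ⟨c, hInj ?_⟩
        rw [hcomb, hsum]
        exact hc
      · rintro ⟨c, rfl⟩
        refine ⟨c, ?_⟩
        rw [hcomb, hsum]
        rfl

end Distributions

/-! ### The canonical 2-form at a point. -/

section Canonical

variable {E : Type*} [NormedAddCommGroup E] [NormedSpace ℝ E]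
  {Q : Type*} [TopologicalSpace Q] [ChartedSpace E Q]
  [IsManifold 𝓘(ℝ, E) ∞ Q]

/-- The canonical symplectic form is `dq ∧ dp`. -/
theorem canonicalForm_apply (p : CotangentBundle E Q) (v w : E × (E →L[ℝ] ℝ)) :
    (canonicalForm E Q p : (E × (E →L[ℝ] ℝ)) [⋀^Fin 2]→L[ℝ] ℝ) ![v, w] = w.2 v.1 - v.2 w.1 := by
  have : IsManifold (cotangentModel E) 1 (CotangentBundle E Q) := .of_le (n := ∞) (by simp)
  have hz := mem_extChartAt_target (I := cotangentModel E) p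
  have hd := (contDiffAt_formInChart_liouvilleForm hz).differentiableAt (by simp)
  have h := extDeriv_apply_vectorField_one hd (X := fun _ => v) (Y := fun _ => w)
    (differentiableAt_const _) (differentiableAt_const _)
  have he : ∀ u : E × (E →L[ℝ] ℝ), (fun z => formInChart (cotangentModel E) (liouvilleForm E Q) p z ![u])
      =ᶠ[𝓝 (extChartAt (cotangentModel E) p p)] fun z => z.2 u.1 := by
    intro u
    filter_upwards [chart_mem_nhds (I := cotangentModel E) hz] with w hw
    exact formInChart_liouvilleForm hw u
  have hf : ∀ u u' : E × (E →L[ℝ] ℝ), ∀ z, fderiv ℝ (fun z : E × (E →L[ℝ] ℝ) => z.2 u.1) z u' =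
      u'.2 u.1 := by
    intro u u' z
    have : HasFDerivAt (fun z : E × (E →L[ℝ] ℝ) => z.2 u.1)
        ((ContinuousLinearMap.apply ℝ ℝ u.1) ∘L ContinuousLinearMap.snd ℝ E (E →L[ℝ] ℝ)) z :=
      ((ContinuousLinearMap.apply ℝ ℝ u.1) ∘L
        ContinuousLinearMap.snd ℝ E (E →L[ℝ] ℝ)).hasFDerivAt
    rw [this.fderiv]
    rfl
  have hlie : VectorField.lieBracket ℝ (fun _ : E × (E →L[ℝ] ℝ) => v) (fun _ => w)
      (extChartAt (cotangentModel E) p p) = 0 := by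
    simp [VectorField.lieBracket]
  rw [(he v).fderiv_eq, (he w).fderiv_eq, hf, hf, hlie] at h
  have h0 : ∀ A : (E × (E →L[ℝ] ℝ)) [⋀^Fin 1]→L[ℝ] ℝ, A ![0] = 0 := fun A => A.map_coord_zero 0 rfl
  rw [h0, sub_zero] at h
  have e : (canonicalForm E Q p : (E × (E →L[ℝ] ℝ)) [⋀^Fin 2]→L[ℝ] ℝ) =
    -extDeriv (formInChart (cotangentModel E) (liouvilleForm E Q) p)
      (extChartAt (cotangentModel E) p p) := by
    rw [← mextDeriv_eq]
    rfl
  refine (DFunLike.congr_fun e ![v, w]).trans ?_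
  change -(extDeriv _ _ ![v, w]) = _
  rw [h, neg_sub]

end Canonical

/-! ### Invertibility of a nondegenerate 2-form on a subspace. -/

section LinearAlgebra

variable {V : Type*} [NormedAddCommGroup V] [NormedSpace ℝ V] [FiniteDimensional ℝ V]

theorem restrictedFlat_isInvertible {C : Submodule ℝ V} {σ : V [⋀^Fin 2]→L[ℝ] ℝ}
    (h : ∀ v ∈ C, (∀ w ∈ C, σ ![v, w] = 0) → v = 0) : (restrictedFlat C σ).IsInvertible := by
  have hinj : Function.Injective (restrictedFlat C σ).toLinearMap := by
    rw [← LinearMap.ker_eq_bot, LinearMap.ker_eq_bot']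
    rintro ⟨v, hv⟩ h0
    refine Subtype.ext (h v hv fun w hw => ?_)
    rw [← flat_apply]
    exact DFunLike.congr_fun h0 (⟨w, hw⟩ : C)
  have hdim : Module.finrank ℝ C = Module.finrank ℝ (C →L[ℝ] ℝ) := by
    rw [← (LinearMap.toContinuousLinearMap (𝕜 := ℝ) (E := C) (F' := ℝ)).finrank_eq]
    exact (Subspace.dual_finrank_eq (K := ℝ) (V := C)).symm
  have : FiniteDimensional ℝ (C →L[ℝ] ℝ) := inferInstance
  let e := (LinearEquiv.ofInjectiveOfFinrankEq (restrictedFlat C σ).toLinearMap hinj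
    hdim).toContinuousLinearEquiv
  refine ⟨e, ?_⟩
  ext v w
  rfl

end LinearAlgebra

/-! ### Smooth maps into the cotangent bundle. -/

section CotangentSmooth

variable {E : Type*} [NormedAddCommGroup E] [NormedSpace ℝ E]
  {Q : Type*} [TopologicalSpace Q] [ChartedSpace E Q] [IsManifold 𝓘(ℝ, E) ∞ Q]
  {E' : Type*} [NormedAddCommGroup E'] [NormedSpace ℝ E']
  {H' : Type*} [TopologicalSpace H'] {I' : ModelWithCorners ℝ E' H'}
  {Y : Type*} [TopologicalSpace Y] [ChartedSpace H' Y]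

theorem contMDiffAt_cotangent_iff {f : Y → CotangentBundle E Q} {y : Y} :
    ContMDiffAt I' (cotangentModel E) ∞ f y ↔
      ContMDiffAt I' 𝓘(ℝ, E) ∞ (fun z => (f z).1) y ∧
      ContMDiffAt I' 𝓘(ℝ, E →L[ℝ] ℝ) ∞ (fun z => covectorInChart (f y).1 (f z)) y := by
  rw [Bundle.contMDiffAt_totalSpace]
  refine and_congr_right fun h => ?_
  have hev : ∀ᶠ z in 𝓝 y, (f z).1 ∈ (chartAt E (f y).1).source :=
    h.continuousAt ((chartAt E (f y).1).open_source.mem_nhds (mem_chart_source E _))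
  refine Filter.EventuallyEq.contMDiffAt_iff ?_
  filter_upwards [hev] with z hz
  have h2 := extChartAt_cotangent hz
  exact congrArg Prod.snd h2

theorem tderiv_cotangentProj (p : CotangentBundle E Q) :
    tderiv (cotangentModel E) 𝓘(ℝ, E) (cotangentProj E Q) p =
      ContinuousLinearMap.fst ℝ E (E →L[ℝ] ℝ) := by
  have : IsManifold 𝓘(ℝ, E) 1 Q := .of_le (n := ∞) (by simp)
  have : IsManifold (cotangentModel E) 1 (CotangentBundle E Q) := .of_le (n := ∞) (by simp)
  rw [tderiv_eq_fderiv_localExpr (contMDiff_cotangentProj.mdifferentiable (by simp) p)]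
  have hloc : localExpr (cotangentModel E) 𝓘(ℝ, E) (cotangentProj E Q) p (cotangentProj E Q p)
      =ᶠ[𝓝 (extChartAt (cotangentModel E) p p)] Prod.fst := by
    filter_upwards [chart_mem_nhds (mem_extChartAt_target (I := cotangentModel E) p)] with w hw
    have hs := mem_extChartAt_cotangent_source.1 ((extChartAt (cotangentModel E) p).map_target hw)
    have h := (extChartAt (cotangentModel E) p).right_inv hw
    rw [extChartAt_cotangent hs] at h
    exact congrArg Prod.fst h
  rw [hloc.fderiv_eq, fderiv_fst]

end CotangentSmooth

/-! ### The tangent spaces of the constraint submanifold. -/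

namespace NonholonomicSystem

variable {E : Type*} [NormedAddCommGroup E] [NormedSpace ℝ E]
  {Q : Type*} [TopologicalSpace Q] [ChartedSpace E Q] [IsManifold 𝓘(ℝ, E) ∞ Q]
  (S : NonholonomicSystem E Q)

/-- The kinetic energy metric in the preferred chart at `q₀`. -/
def metricInChart (q₀ : Q) (y : E) : E →L[ℝ] E →L[ℝ] ℝ :=
  ContinuousLinearMap.precomp ℝ (chartInv 𝓘(ℝ, E) q₀ y) ∘L
    (show E →L[ℝ] E →L[ℝ] ℝ from S.metric.inner ((extChartAt 𝓘(ℝ, E) q₀).symm y)) ∘L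
      chartInv 𝓘(ℝ, E) q₀ y

theorem contDiffAt_metricInChart (q₀ : Q) :
    ContDiffAt ℝ ∞ (S.metricInChart q₀) (extChartAt 𝓘(ℝ, E) q₀ q₀) := by
  have h1 := ((Bundle.contMDiffAt_totalSpace).1 (S.metric.contMDiff q₀)).2
  have h3 : ContMDiffAt 𝓘(ℝ, E) 𝓘(ℝ, E) ∞ (extChartAt 𝓘(ℝ, E) q₀).symm
      (extChartAt 𝓘(ℝ, E) q₀ q₀) := by
    have := contMDiffWithinAt_extChartAt_symm_range (I := 𝓘(ℝ, E)) (n := ∞) q₀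
      (mem_extChartAt_target q₀)
    rwa [ModelWithCorners.range_eq_univ, contMDiffWithinAt_univ] at this
  have h4 := (ContMDiffAt.comp (extChartAt 𝓘(ℝ, E) q₀ q₀) (by rwa [extChartAt_to_inv]) h3).contDiffAt
  refine h4.congr_of_eventuallyEq ?_
  filter_upwards [chart_mem_nhds (mem_extChartAt_target (I := 𝓘(ℝ, E)) q₀)] with y hy
  set q := (extChartAt 𝓘(ℝ, E) q₀).symm y with hq
  have hqs : q ∈ (chartAt E q₀).source := by
    rw [← extChartAt_source 𝓘(ℝ, E)]
    exact (extChartAt 𝓘(ℝ, E) q₀).map_target hy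
  have hs := TangentBundle.symmL_trivializationAt (I := 𝓘(ℝ, E)) hqs
  have hyq : extChartAt 𝓘(ℝ, E) q₀ q = y := (extChartAt 𝓘(ℝ, E) q₀).right_inv hy
  ext u v
  have hsu : ∀ u : E, (trivializationAt E (TangentSpace 𝓘(ℝ, E)) q₀).symmL ℝ q u =
      chartInv 𝓘(ℝ, E) q₀ y u := fun u => by rw [hs, hyq]; rfl
  have e : ((trivializationAt (E →L[ℝ] ℝ) (fun q : Q => TangentSpace 𝓘(ℝ, E) q →L[ℝ] ℝ)
      q₀).continuousLinearMapAt ℝ q (S.metric.inner q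
        ((trivializationAt E (TangentSpace 𝓘(ℝ, E)) q₀).symmL ℝ q u))) v =
      S.metric.inner q ((trivializationAt E (TangentSpace 𝓘(ℝ, E)) q₀).symmL ℝ q u)
        ((trivializationAt E (TangentSpace 𝓘(ℝ, E)) q₀).symmL ℝ q v) := by
    rw [Bundle.Trivialization.continuousLinearMapAt_apply,
      Bundle.Trivialization.coe_linearMapAt_of_mem _ (by simpa using hqs)]
    change ContinuousLinearMap.inCoordinates E (TangentSpace 𝓘(ℝ, E)) ℝ (fun _ : Q => ℝ)
      q₀ q q₀ q (S.metric.inner q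
        ((trivializationAt E (TangentSpace 𝓘(ℝ, E)) q₀).symmL ℝ q u)) v = _
    simp [ContinuousLinearMap.inCoordinates]
  rw [hsu u, hsu v] at e
  refine Eq.trans ?_ (e.symm.trans ?_)
  · rfl
  · rw [← hsu u]
    rfl

/-- Composing a chart with its inverse returns a point only up to a proved equality, while fibres
are indexed by points; this moves the metric along such an equality. -/
theorem metric_congr {q q' : Q} (h : q' = q) (u v : E) :
    (show E →L[ℝ] E →L[ℝ] ℝ from S.metric.inner q') u v =
      (show E →L[ℝ] E →L[ℝ] ℝ from S.metric.inner q) u v := by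
  subst h; rfl

theorem constraint_congr {q q' : Q} (h : q' = q) :
    (show Submodule ℝ E from S.constraint q') = (show Submodule ℝ E from S.constraint q) := by
  subst h; rfl

theorem metricInChart_self (q : Q) :
    S.metricInChart q (extChartAt 𝓘(ℝ, E) q q) = (show E →L[ℝ] E →L[ℝ] ℝ from S.metric.inner q) := by
  have : IsManifold 𝓘(ℝ, E) 1 Q := .of_le (n := ∞) (by simp)
  ext u v
  have e : S.metricInChart q (extChartAt 𝓘(ℝ, E) q q) u v =
    (show E →L[ℝ] E →L[ℝ] ℝ from
      S.metric.inner ((extChartAt 𝓘(ℝ, E) q).symm (extChartAt 𝓘(ℝ, E) q q)))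
      (chartInv 𝓘(ℝ, E) q (extChartAt 𝓘(ℝ, E) q q) u)
      (chartInv 𝓘(ℝ, E) q (extChartAt 𝓘(ℝ, E) q q) v) := rfl
  rw [e, chartInv_self]
  exact S.metric_congr (extChartAt_to_inv q) u v

theorem metric_definite (q : Q) (v : E)
    (h : (show E →L[ℝ] E →L[ℝ] ℝ from S.metric.inner q) v v = 0) : v = 0 := by
  by_contra hv
  exact (S.metric.pos q v hv).ne' h

/-- In coordinates the Legendre transform is multiplication by the matrix of the metric, so 𝓜 is
locally the set of pairs (y, κ_y u) with u in the frame's span. -/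
theorem covectorInChart_legendre {q₀ q : Q} (hq : q ∈ (extChartAt 𝓘(ℝ, E) q₀).source) (v : E) :
    covectorInChart q₀ (S.legendre ⟨q, v⟩) =
      S.metricInChart q₀ (extChartAt 𝓘(ℝ, E) q₀ q) (chartFwd 𝓘(ℝ, E) q₀ q v) := by
  have : IsManifold 𝓘(ℝ, E) 1 Q := .of_le (n := ∞) (by simp)
  ext w
  have h := chartInv_comp_chartFwd ((extChartAt 𝓘(ℝ, E) q₀).map_source hq)
  rw [(extChartAt 𝓘(ℝ, E) q₀).left_inv hq] at h
  have h' : chartInv 𝓘(ℝ, E) q₀ (extChartAt 𝓘(ℝ, E) q₀ q) (chartFwd 𝓘(ℝ, E) q₀ q v) = v :=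
    DFunLike.congr_fun h v
  have e : S.metricInChart q₀ (extChartAt 𝓘(ℝ, E) q₀ q) (chartFwd 𝓘(ℝ, E) q₀ q v) w =
    (show E →L[ℝ] E →L[ℝ] ℝ from
      S.metric.inner ((extChartAt 𝓘(ℝ, E) q₀).symm (extChartAt 𝓘(ℝ, E) q₀ q)))
      (chartInv 𝓘(ℝ, E) q₀ (extChartAt 𝓘(ℝ, E) q₀ q) (chartFwd 𝓘(ℝ, E) q₀ q v))
      (chartInv 𝓘(ℝ, E) q₀ (extChartAt 𝓘(ℝ, E) q₀ q) w) := rfl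
  rw [e, h']
  exact (S.metric_congr ((extChartAt 𝓘(ℝ, E) q₀).left_inv hq) _ _).symm

variable {EM : Type*} [NormedAddCommGroup EM] [NormedSpace ℝ EM]
  [ChartedSpace EM S.M]

theorem contMDiff_proj (hι : ContMDiff 𝓘(ℝ, EM) (cotangentModel E) ∞ S.incl) :
    ContMDiff 𝓘(ℝ, EM) 𝓘(ℝ, E) ∞ S.proj :=
  contMDiff_cotangentProj.comp hι

theorem tderiv_proj (hι : ContMDiff 𝓘(ℝ, EM) (cotangentModel E) ∞ S.incl) (m : S.M) :
    tderiv 𝓘(ℝ, EM) 𝓘(ℝ, E) S.proj m = ContinuousLinearMap.fst ℝ E (E →L[ℝ] ℝ) ∘L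
      tderiv 𝓘(ℝ, EM) (cotangentModel E) S.incl m := by
  have h := (contMDiff_cotangentProj.mdifferentiable (by simp) (S.incl m)).hasMFDerivAt.comp m
    (hι.mdifferentiable (by simp) m).hasMFDerivAt
  rw [← tderiv_cotangentProj (S.incl m)]
  exact h.mfderiv

/-- These three facts are all that nondegeneracy needs to know about T𝓜 inside T(T*Q). With `s` a
frame of D in a chart, 𝓜 is locally the image of (y, c) ↦ (y, κ_y s_y c). Differentiating this
parametrization produces the first two kinds of tangent vectors. For the third, the fibre coordinate
on 𝓜 is annihilated by a smooth family `N` with kernel κ(D), and differentiating this equation in a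
vertical direction gives the constraint. -/
theorem exists_tderiv_incl_eq [IsManifold 𝓘(ℝ, EM) ∞ S.M] [FiniteDimensional ℝ EM]
    [FiniteDimensional ℝ E]
    (hι : Manifold.IsSmoothEmbedding 𝓘(ℝ, EM) (cotangentModel E) ∞ S.incl) (m : S.M) :
    (∀ δ : E, ∃ w, (tderiv 𝓘(ℝ, EM) (cotangentModel E) S.incl m w).1 = δ) ∧
    (∀ u ∈ S.constraint (S.proj m), ∃ w, tderiv 𝓘(ℝ, EM) (cotangentModel E) S.incl m w =
      (0, (show E →L[ℝ] E →L[ℝ] ℝ from S.metric.inner (S.proj m)) u)) ∧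
    ∀ v, (tderiv 𝓘(ℝ, EM) (cotangentModel E) S.incl m v).1 = 0 →
      ∃ u ∈ S.constraint (S.proj m), (tderiv 𝓘(ℝ, EM) (cotangentModel E) S.incl m v).2 =
        (show E →L[ℝ] E →L[ℝ] ℝ from S.metric.inner (S.proj m)) u := by
  have : IsManifold 𝓘(ℝ, E) 1 Q := .of_le (n := ∞) (by simp)
  have : IsManifold 𝓘(ℝ, EM) 1 S.M := .of_le (n := ∞) (by simp)
  have : IsManifold (cotangentModel E) 1 (CotangentBundle E Q) := .of_le (n := ∞) (by simp)
  classical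
  set p : CotangentBundle E Q := S.incl m with hp
  have hpq : S.proj m = p.1 := rfl
  rw [hpq]
  set y₀ := extChartAt 𝓘(ℝ, E) p.1 p.1 with hy₀
  obtain ⟨r, s, hs, hsD⟩ := exists_frame_inChart S.smooth_constraint p.1
  have hκ := S.contDiffAt_metricInChart p.1
  set g : E → (Fin r → ℝ) →L[ℝ] E →L[ℝ] ℝ := fun y => S.metricInChart p.1 y ∘L s y with hg
  have hgs : ContDiffAt ℝ ∞ g y₀ := hκ.clm_comp hs
  have hsD₀ := hsD.self_of_nhds
  have hg₀ : ∀ c, g y₀ c = (show E →L[ℝ] E →L[ℝ] ℝ from S.metric.inner p.1) (s y₀ c) := by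
    intro c
    rw [← S.metricInChart_self p.1]
    rfl
  have hD₀ : ∀ v : E, v ∈ S.constraint p.1 ↔ ∃ c, s y₀ c = v := by
    intro v
    rw [← hsD₀.2 v, chartInv_self]
    have := S.constraint_congr (extChartAt_to_inv (I := 𝓘(ℝ, E)) p.1)
    exact Iff.of_eq (congrArg (fun D : Submodule ℝ E => v ∈ D) this.symm)
  -- covectors in the constraint submanifold
  have hcov : ∀ y, (∀ v, chartInv 𝓘(ℝ, E) p.1 y v ∈
      S.constraint ((extChartAt 𝓘(ℝ, E) p.1).symm y) ↔ ∃ c, s y c = v) →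
      ∀ m' : S.M, (S.incl m').1 ∈ (extChartAt 𝓘(ℝ, E) p.1).source →
      extChartAt 𝓘(ℝ, E) p.1 (S.incl m').1 = y → ∃ c, covectorInChart p.1 (S.incl m') = g y c := by
    rintro y hy ⟨_, ⟨q, v⟩, hv, rfl⟩ hq rfl
    have hq' : q ∈ (extChartAt 𝓘(ℝ, E) p.1).source := hq
    have h := chartInv_comp_chartFwd ((extChartAt 𝓘(ℝ, E) p.1).map_source hq')
    rw [(extChartAt 𝓘(ℝ, E) p.1).left_inv hq'] at h
    have h' : chartInv 𝓘(ℝ, E) p.1 (extChartAt 𝓘(ℝ, E) p.1 q) (chartFwd 𝓘(ℝ, E) p.1 q v) = v :=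
      DFunLike.congr_fun h v
    obtain ⟨c, hc⟩ := (hy (chartFwd 𝓘(ℝ, E) p.1 q v)).1 (by
      have e := S.constraint_congr ((extChartAt 𝓘(ℝ, E) p.1).left_inv hq')
      have hv' : v ∈ (show Submodule ℝ E from S.constraint q) := hv
      rw [← e] at hv'
      exact h'.symm ▸ hv')
    refine ⟨c, ?_⟩
    refine (S.covectorInChart_legendre hq' v).trans ?_
    rw [← hc]
    rfl
  have hinj : Function.Injective (g y₀) := by
    rw [injective_iff_map_eq_zero]
    intro c hc
    rw [hg₀] at hc
    have := S.metric_definite p.1 (s y₀ c) (by rw [hc]; rfl)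
    exact hsD₀.1 (this.trans (map_zero _).symm)
  have hpp : extChartAt (cotangentModel E) p p = (y₀, covectorInChart p.1 p) :=
    extChartAt_cotangent (mem_chart_source E p.1)
  obtain ⟨a₀, ha₀⟩ := hcov y₀ hsD₀.2 m (mem_extChartAt_source (I := 𝓘(ℝ, E)) p.1) rfl
  change covectorInChart p.1 p = _ at ha₀
  rw [ha₀] at hpp
  have hιm := hι.contMDiff.contMDiffAt (x := m)
  have hzM := mem_extChartAt_target (I := 𝓘(ℝ, EM)) m
  set x₀ := extChartAt 𝓘(ℝ, EM) m m with hx₀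
  set J := localExpr 𝓘(ℝ, EM) (cotangentModel E) S.incl m p with hJ
  have hJs : ContDiffAt ℝ ∞ J x₀ := contDiffAt_localExpr (k := ⊤) hzM
    (by rw [extChartAt_to_inv]; exact hιm)
    (by rw [extChartAt_to_inv]; exact mem_extChartAt_source _)
  have hJd : DifferentiableAt ℝ J x₀ := hJs.differentiableAt (by simp)
  have hJ₀ : J x₀ = (y₀, g y₀ a₀) := by
    rw [← hpp]
    simp [hJ, localExpr, hx₀, hp]
  rw [show tderiv 𝓘(ℝ, EM) (cotangentModel E) S.incl m = fderiv ℝ J x₀ from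
    tderiv_eq_fderiv_localExpr (hιm.mdifferentiableAt (by simp))]
  -- the parametrization of the constraint submanifold by a frame of the constraint distribution
  have hgz : ContDiffAt ℝ ∞ (fun z : E × (Fin r → ℝ) => (z.1, g z.1 z.2)) (y₀, a₀) :=
    contDiffAt_fst.prodMk ((ContDiffAt.comp (y₀, a₀) (f := Prod.fst) hgs contDiffAt_fst).clm_apply
      contDiffAt_snd)
  set Ψ : E × (Fin r → ℝ) → CotangentBundle E Q :=
    fun z => (extChartAt (cotangentModel E) p).symm (z.1, g z.1 z.2) with hΨ
  have hΨ₀ : Ψ (y₀, a₀) = p := by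
    simp only [hΨ, ← hpp, extChartAt_to_inv]
  have hΨs : ContMDiffAt 𝓘(ℝ, E × (Fin r → ℝ)) (cotangentModel E) ∞ Ψ (y₀, a₀) := by
    have h1 := contMDiffWithinAt_extChartAt_symm_range (I := cotangentModel E) (n := ∞) p
      (mem_extChartAt_target p)
    rw [ModelWithCorners.range_eq_univ, contMDiffWithinAt_univ, hpp] at h1
    exact ContMDiffAt.comp (y₀, a₀) (f := fun z : E × (Fin r → ℝ) => (z.1, g z.1 z.2)) h1
      hgz.contMDiffAt
  have hfst : Filter.Tendsto (Prod.fst : E × (Fin r → ℝ) → E) (𝓝 (y₀, a₀)) (𝓝 y₀) :=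
    continuousAt_fst
  have hΨM : ∀ᶠ z in 𝓝 (y₀, a₀), Ψ z ∈ S.constraintSet ∧
      extChartAt (cotangentModel E) p (Ψ z) = (z.1, g z.1 z.2) := by
    filter_upwards [hfst.eventually hsD, hfst.eventually
      (chart_mem_nhds (mem_extChartAt_target (I := 𝓘(ℝ, E)) p.1))] with z hz hzt
    set q := (extChartAt 𝓘(ℝ, E) p.1).symm z.1 with hq
    have hqs : q ∈ (extChartAt 𝓘(ℝ, E) p.1).source := (extChartAt 𝓘(ℝ, E) p.1).map_target hzt
    have hqz : extChartAt 𝓘(ℝ, E) p.1 q = z.1 := (extChartAt 𝓘(ℝ, E) p.1).right_inv hzt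
    set v : E := chartInv 𝓘(ℝ, E) p.1 z.1 (s z.1 z.2) with hv
    have hvD : v ∈ S.constraint q := (hz.2 _).2 ⟨z.2, rfl⟩
    have h1 : chartFwd 𝓘(ℝ, E) p.1 q v = s z.1 z.2 :=
      DFunLike.congr_fun (chartFwd_comp_chartInv (I := 𝓘(ℝ, E)) hzt) _
    have h2 : extChartAt (cotangentModel E) p (S.legendre ⟨q, v⟩) = (z.1, g z.1 z.2) := by
      rw [extChartAt_cotangent (by rwa [extChartAt_source] at hqs)]
      refine Prod.ext hqz ?_
      refine (S.covectorInChart_legendre hqs v).trans ?_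
      rw [h1, hqz]
      rfl
    have h3 : Ψ z = S.legendre ⟨q, v⟩ := by
      simp only [hΨ]
      rw [← h2]
      exact (extChartAt (cotangentModel E) p).left_inv
        (mem_extChartAt_cotangent_source.2 (by rwa [extChartAt_source] at hqs))
    rw [h3]
    exact ⟨⟨_, hvD, rfl⟩, h2⟩
  -- The value `m` off the constraint set only makes the map total: near the base point `Ψ` lands in
  -- 𝓜.
  set Ψ' : E × (Fin r → ℝ) → S.M := fun z => if h : Ψ z ∈ S.constraintSet then ⟨Ψ z, h⟩ else m with hΨ'
  have hΨ'₀ : Ψ' (y₀, a₀) = m := by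
    simp only [hΨ']
    split_ifs with h
    · exact Subtype.ext hΨ₀
    · rfl
  have hιΨ : S.incl ∘ Ψ' =ᶠ[𝓝 (y₀, a₀)] Ψ := by
    filter_upwards [hΨM] with z hz
    simp only [Function.comp_apply, hΨ', dif_pos hz.1]
    rfl
  -- The smooth structure of 𝓜 is known only through the embedding, so smoothness of the
  -- parametrization is tested in T*Q.
  have hΨ's : ContMDiffAt 𝓘(ℝ, E × (Fin r → ℝ)) 𝓘(ℝ, EM) ∞ Ψ' (y₀, a₀) :=
    contMDiffAt_of_comp_isSmoothEmbedding hι (hΨs.congr_of_eventuallyEq hιΨ)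
  set R := extChartAt 𝓘(ℝ, EM) m ∘ Ψ' with hR
  have hRs : ContDiffAt ℝ ∞ R (y₀, a₀) := by
    rw [← contMDiffAt_iff_contDiffAt]
    refine ContMDiffAt.comp (y₀, a₀) ?_ hΨ's
    rw [hΨ'₀]
    exact contMDiffAt_extChartAt
  have hR₀ : R (y₀, a₀) = x₀ := by simp [hR, hΨ'₀, hx₀]
  have hJR : J ∘ R =ᶠ[𝓝 (y₀, a₀)] fun z => (z.1, g z.1 z.2) := by
    have hev : ∀ᶠ z in 𝓝 (y₀, a₀), Ψ' z ∈ (extChartAt 𝓘(ℝ, EM) m).source :=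
      hΨ's.continuousAt ((isOpen_extChartAt_source m).mem_nhds
        (by rw [hΨ'₀]; exact mem_extChartAt_source m))
    filter_upwards [hev, hιΨ, hΨM] with z h1 h2 h3
    simp only [hJ, hR, localExpr, Function.comp_apply, (extChartAt 𝓘(ℝ, EM) m).left_inv h1]
    rw [← h3.2, ← h2]
    rfl
  have hgd : HasFDerivAt (fun z : E × (Fin r → ℝ) => g z.1 z.2)
      (fderiv ℝ (fun z : E × (Fin r → ℝ) => g z.1 z.2) (y₀, a₀)) (y₀, a₀) :=
    ((contDiffAt_snd.comp (y₀, a₀) hgz).differentiableAt (by simp)).hasFDerivAt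
  have hJR' : ∀ w, fderiv ℝ J x₀ (fderiv ℝ R (y₀, a₀) w) =
      (w.1, fderiv ℝ (fun z : E × (Fin r → ℝ) => g z.1 z.2) (y₀, a₀) w) := by
    intro w
    have hJd' : HasFDerivAt J (fderiv ℝ J x₀) (R (y₀, a₀)) := by rw [hR₀]; exact hJd.hasFDerivAt
    have h1 := hJd'.comp (y₀, a₀) (hRs.differentiableAt (by simp)).hasFDerivAt
    have h2 : HasFDerivAt (fun z : E × (Fin r → ℝ) => (z.1, g z.1 z.2)) _ (y₀, a₀) :=
      hasFDerivAt_fst.prodMk hgd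
    exact DFunLike.congr_fun ((h1.congr_of_eventuallyEq hJR.symm).unique h2) w
  refine ⟨fun δ => ⟨fderiv ℝ R (y₀, a₀) (δ, 0), by rw [hJR']⟩, ?_, ?_⟩
  · intro u hu
    obtain ⟨b, rfl⟩ := (hD₀ u).1 hu
    refine ⟨fderiv ℝ R (y₀, a₀) (0, b), ?_⟩
    rw [hJR', ← hg₀]
    have h1 : HasFDerivAt (fun c => g y₀ c) ((fderiv ℝ (fun z : E × (Fin r → ℝ) => g z.1 z.2)
        (y₀, a₀)) ∘L .inr ℝ E (Fin r → ℝ)) a₀ :=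
      HasFDerivAt.comp a₀ (f := fun c => (y₀, c)) hgd (hasFDerivAt_prodMk_right y₀ a₀)
    have h2 := DFunLike.congr_fun (h1.unique (g y₀).hasFDerivAt) b
    refine Prod.ext rfl h2
  · intro v hv
    obtain ⟨N, hN, hNg⟩ := exists_contDiffAt_ker hgs hinj
    have hx₀c : ∀ᶠ x in 𝓝 x₀, S.incl ((extChartAt 𝓘(ℝ, EM) m).symm x) ∈
        (extChartAt (cotangentModel E) p).source := by
      have h1 : ContinuousAt (fun x => S.incl ((extChartAt 𝓘(ℝ, EM) m).symm x)) x₀ :=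
        ContinuousAt.comp (g := S.incl) (by rw [extChartAt_to_inv]; exact hιm.continuousAt)
          (continuousAt_extChartAt_symm m)
      refine h1 ((isOpen_extChartAt_source p).mem_nhds ?_)
      simp only [hx₀, extChartAt_to_inv]
      exact mem_extChartAt_source p
    have hJ1 : Filter.Tendsto (fun x => (J x).1) (𝓝 x₀) (𝓝 y₀) := by
      have := (continuous_fst.continuousAt.comp hJs.continuousAt)
      unfold ContinuousAt at this
      rwa [Function.comp_apply, hJ₀] at this
    -- Points of 𝓜 have their fibre coordinate in the range of `g`, which is the kernel of `N`.
    have hN0 : (fun x => N (J x).1 (J x).2) =ᶠ[𝓝 x₀] fun _ => 0 := by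
      filter_upwards [hx₀c, hJ1.eventually hsD, hJ1.eventually hNg] with x hx h1 h2
      have hxs := mem_extChartAt_cotangent_source.1 hx
      have hJx : J x = _ := extChartAt_cotangent hxs
      obtain ⟨c, hc⟩ := hcov (J x).1 h1.2 _ (by rw [extChartAt_source]; exact hxs)
        (congrArg Prod.fst hJx.symm)
      rw [h2]
      exact ⟨c, (hc.symm.trans (congrArg Prod.snd hJx.symm))⟩
    have hN1 : DifferentiableAt ℝ (fun x => N (J x).1) x₀ := by
      have : DifferentiableAt ℝ N (J x₀).1 := by rw [hJ₀]; exact hN.differentiableAt (by simp)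
      exact DifferentiableAt.comp x₀ (f := fun x => (J x).1) this hJd.fst
    have h3 := hN0.fderiv_eq (𝕜 := ℝ)
    rw [fderiv_clm_apply hN1 hJd.snd] at h3
    have h4 := DFunLike.congr_fun h3 v
    have hfst' : fderiv ℝ (fun x => (J x).1) x₀ v = (fderiv ℝ J x₀ v).1 := by
      have h : HasFDerivAt (fun x => (J x).1) _ x₀ := hasFDerivAt_fst.comp x₀ hJd.hasFDerivAt
      rw [h.fderiv]
      rfl
    have hsnd' : fderiv ℝ (fun x => (J x).2) x₀ v = (fderiv ℝ J x₀ v).2 := by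
      have h : HasFDerivAt (fun x => (J x).2) _ x₀ := hasFDerivAt_snd.comp x₀ hJd.hasFDerivAt
      rw [h.fderiv]
      rfl
    -- `N` depends on the base coordinate only, which does not move along the vertical vector `v`;
    -- the product rule then leaves `N` applied to the fibre component.
    have hN1' : fderiv ℝ (fun x => N (J x).1) x₀ v = 0 := by
      have h5 : HasFDerivAt N (fderiv ℝ N y₀) ((J x₀).1) := by
        rw [hJ₀]; exact (hN.differentiableAt (by simp)).hasFDerivAt
      have h : HasFDerivAt (fun x => N (J x).1) _ x₀ :=
        HasFDerivAt.comp x₀ (f := fun x => (J x).1) h5 hJd.fst.hasFDerivAt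
      rw [h.fderiv]
      change fderiv ℝ N y₀ (fderiv ℝ (fun x => (J x).1) x₀ v) = 0
      rw [hfst', hv, map_zero]
    have h6 : N y₀ (fderiv ℝ J x₀ v).2 = 0 := by
      rw [← hsnd']
      have h7 : N (J x₀).1 (fderiv ℝ (fun x => (J x).2) x₀ v) +
          (fderiv ℝ (fun x => N (J x).1) x₀ v) (J x₀).2 = 0 := by
        simpa using h4
      rw [hN1', hJ₀] at h7
      simpa using h7
    obtain ⟨c, hc⟩ := (hNg.self_of_nhds _).1 h6
    refine ⟨s y₀ c, (hD₀ _).2 ⟨c, rfl⟩, ?_⟩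
    rw [← hg₀, hc]

end NonholonomicSystem

theorem vec_one_eta {V : Type*} (v : Fin 1 → V) : v = ![v 0] := by
  funext i; fin_cases i; rfl

theorem comp_vec_one {V V' : Type*} (f : V → V') (a : V) :
    (fun i => f ((![a] : Fin 1 → V) i)) = ![f a] := by
  funext i; fin_cases i; rfl

theorem comp_vec_two {V V' : Type*} (f : V → V') (a b : V) :
    (fun i => f ((![a, b] : Fin 2 → V) i)) = ![f a, f b] := by
  funext i; fin_cases i <;> rfl

/-! ### The forms Θ and Ω on 𝓜, and nondegeneracy on 𝓒. -/

namespace NonholonomicSystem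

variable {E : Type*} [NormedAddCommGroup E] [NormedSpace ℝ E]
  {Q : Type*} [TopologicalSpace Q] [ChartedSpace E Q] [IsManifold 𝓘(ℝ, E) ∞ Q]
  (S : NonholonomicSystem E Q)
  {EM : Type*} [NormedAddCommGroup EM] [NormedSpace ℝ EM]
  [ChartedSpace EM S.M]

theorem liouville_apply (hι : ContMDiff 𝓘(ℝ, EM) (cotangentModel E) ∞ S.incl) (m : S.M) (v : EM) :
    (S.liouville m : EM [⋀^Fin 1]→L[ℝ] ℝ) ![v] =
      (show E →L[ℝ] ℝ from (S.incl m).2) (tderiv 𝓘(ℝ, EM) 𝓘(ℝ, E) S.proj m v) := by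
  rw [S.tderiv_proj hι]
  have e : (S.liouville m : EM [⋀^Fin 1]→L[ℝ] ℝ) ![v] =
      (liouvilleForm E Q (S.incl m) : (E × (E →L[ℝ] ℝ)) [⋀^Fin 1]→L[ℝ] ℝ)
        (fun i => tderiv 𝓘(ℝ, EM) (cotangentModel E) S.incl m ((![v] : Fin 1 → EM) i)) := rfl
  rw [e, comp_vec_one]
  refine (liouvilleForm_apply (S.incl m) _).trans ?_
  rw [tderiv_cotangentProj]
  rfl

theorem twoForm_apply (m : S.M) (v w : EM) :
    (S.twoForm m : EM [⋀^Fin 2]→L[ℝ] ℝ) ![v, w] =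
      (tderiv 𝓘(ℝ, EM) (cotangentModel E) S.incl m w).2
          (tderiv 𝓘(ℝ, EM) (cotangentModel E) S.incl m v).1
        - (tderiv 𝓘(ℝ, EM) (cotangentModel E) S.incl m v).2
          (tderiv 𝓘(ℝ, EM) (cotangentModel E) S.incl m w).1 := by
  have e : (S.twoForm m : EM [⋀^Fin 2]→L[ℝ] ℝ) ![v, w] =
      (canonicalForm E Q (S.incl m) : (E × (E →L[ℝ] ℝ)) [⋀^Fin 2]→L[ℝ] ℝ)
        (fun i => tderiv 𝓘(ℝ, EM) (cotangentModel E) S.incl m ((![v, w] : Fin 2 → EM) i)) := rfl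
  rw [e, comp_vec_two]
  exact canonicalForm_apply (S.incl m) _ _

theorem mem_constraintDist (m : S.M) (v : EM) :
    v ∈ (S.constraintDist m : Submodule ℝ EM) ↔
      tderiv 𝓘(ℝ, EM) 𝓘(ℝ, E) S.proj m v ∈ (show Submodule ℝ E from S.constraint (S.proj m)) :=
  Iff.rfl

variable [IsManifold 𝓘(ℝ, EM) ∞ S.M]

theorem twoForm_eq_neg_mextDeriv (hι : ContMDiff 𝓘(ℝ, EM) (cotangentModel E) ∞ S.incl) (m : S.M) :
    S.twoForm m = -mextDeriv 𝓘(ℝ, EM) S.liouville m := by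
  have h := mextDeriv_pullForm (liouvilleForm E Q) (hι m)
    ((contDiffAt_formInChart_liouvilleForm (mem_extChartAt_target _)).differentiableAt (by simp))
  have e : pullForm 𝓘(ℝ, EM) (cotangentModel E) S.incl (liouvilleForm E Q) = S.liouville := rfl
  rw [e] at h
  rw [h]
  rfl

theorem contDiffAt_formInChart_liouville (hι : ContMDiff 𝓘(ℝ, EM) (cotangentModel E) ∞ S.incl)
    {m : S.M} {z : EM} (hz : z ∈ (extChartAt 𝓘(ℝ, EM) m).target) :
    ContDiffAt ℝ ∞ (formInChart 𝓘(ℝ, EM) S.liouville m) z := by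
  set p := S.incl ((extChartAt 𝓘(ℝ, EM) m).symm z) with hp
  refine contDiffAt_formInChart_pullForm_one (liouvilleForm E Q) (f := S.incl) (y₀ := p) hz
    (hι _) (mem_extChartAt_source _) ?_
  exact contDiffAt_formInChart_liouvilleForm (mem_extChartAt_target p)

theorem formInChart_twoForm (hι : ContMDiff 𝓘(ℝ, EM) (cotangentModel E) ∞ S.incl)
    {m : S.M} {z : EM} (hz : z ∈ (extChartAt 𝓘(ℝ, EM) m).target) :
    formInChart 𝓘(ℝ, EM) S.twoForm m z = -extDeriv (formInChart 𝓘(ℝ, EM) S.liouville m) z := by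
  rw [← formInChart_mextDeriv _ hz ((S.contDiffAt_formInChart_liouville hι
    (mem_extChartAt_target _)).differentiableAt (by simp))]
  have e : S.twoForm = -mextDeriv 𝓘(ℝ, EM) S.liouville := by
    funext m; exact S.twoForm_eq_neg_mextDeriv hι m
  rw [e]
  rfl

theorem contDiffAt_formInChart_twoForm (hι : ContMDiff 𝓘(ℝ, EM) (cotangentModel E) ∞ S.incl)
    {m : S.M} {z : EM} (hz : z ∈ (extChartAt 𝓘(ℝ, EM) m).target) :
    ContDiffAt ℝ ∞ (formInChart 𝓘(ℝ, EM) S.twoForm m) z := by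
  refine (ContDiffAt.extDeriv (S.contDiffAt_formInChart_liouville hι hz)).neg.congr_of_eventuallyEq ?_
  filter_upwards [chart_mem_nhds hz] with w hw
  exact S.formInChart_twoForm hι hw

/-- Ω_𝓜 is exact, since pullback commutes with d. Its closedness is why only dB survives from d(Ω_𝓜
− B) in the final formula. -/
theorem extDeriv_formInChart_twoForm (hι : ContMDiff 𝓘(ℝ, EM) (cotangentModel E) ∞ S.incl)
    {m : S.M} {z : EM} (hz : z ∈ (extChartAt 𝓘(ℝ, EM) m).target) :
    extDeriv (formInChart 𝓘(ℝ, EM) S.twoForm m) z = 0 := by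
  have h : formInChart 𝓘(ℝ, EM) S.twoForm m =ᶠ[𝓝 z]
      -extDeriv (formInChart 𝓘(ℝ, EM) S.liouville m) := by
    filter_upwards [chart_mem_nhds hz] with w hw
    exact S.formInChart_twoForm hι hw
  have h2 : (-extDeriv (formInChart 𝓘(ℝ, EM) S.liouville m)) =
      (-1 : ℝ) • extDeriv (formInChart 𝓘(ℝ, EM) S.liouville m) := by
    rw [neg_one_smul]
  rw [h.extDeriv_eq, h2, extDeriv_smul, extDeriv_extDeriv_apply
    (S.contDiffAt_formInChart_liouville hι hz) minSmoothness_two_le_infty, smul_zero]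

variable [FiniteDimensional ℝ EM] [FiniteDimensional ℝ E]

/-- The canonical 2-form of the constraint submanifold is nondegenerate on the constraint
distribution. -/
theorem twoForm_nondegenerate
    (hι : Manifold.IsSmoothEmbedding 𝓘(ℝ, EM) (cotangentModel E) ∞ S.incl) (m : S.M) :
    ∀ v ∈ (S.constraintDist m : Submodule ℝ EM), (∀ w ∈ (S.constraintDist m : Submodule ℝ EM),
      (S.twoForm m : EM [⋀^Fin 2]→L[ℝ] ℝ) ![v, w] = 0) → v = 0 := by
  intro v hv h
  obtain ⟨h1, h2, h3⟩ := S.exists_tderiv_incl_eq hι m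
  set T := tderiv 𝓘(ℝ, EM) (cotangentModel E) S.incl m with hT
  have hC : ∀ w, w ∈ (S.constraintDist m : Submodule ℝ EM) ↔
      (T w).1 ∈ (show Submodule ℝ E from S.constraint (S.proj m)) := by
    intro w
    refine (S.mem_constraintDist (EM := EM) m w).trans ?_
    rw [S.tderiv_proj hι.contMDiff]
    rfl
  replace h : ∀ w, (T w).1 ∈ (show Submodule ℝ E from S.constraint (S.proj m)) →
      (T w).2 (T v).1 - (T v).2 (T w).1 = 0 := fun w hw =>
    (S.twoForm_apply (EM := EM) m v w).symm.trans (h w ((hC w).2 hw))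
  -- With u = Tτ(v) ∈ D, the tangent vector (0, κ(u)) lies in 𝓒 and pairs with `v` to κ(u, u).
  have hv1 : (T v).1 = 0 := by
    obtain ⟨w, hw⟩ := h2 _ ((hC v).1 hv)
    have h0 := h w (by rw [hw]; exact Submodule.zero_mem _)
    rw [hw, map_zero, sub_zero] at h0
    exact S.metric_definite _ _ h0
  -- Now `v` is vertical, hence (0, κ(u)) with u ∈ D. Pairing with a tangent vector over u, which
  -- lies in 𝓒, again gives κ(u, u) = 0 up to sign.
  obtain ⟨u, hu, hvu⟩ := h3 v hv1
  obtain ⟨w, hw⟩ := h1 u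
  have h0 := h w (by rw [hw]; exact hu)
  rw [hv1, map_zero, zero_sub, neg_eq_zero, hvu, hw] at h0
  have hu0 := S.metric_definite _ _ h0
  rw [hu0, map_zero] at hvu
  have hinj := tderiv_injective_of_isImmersionAt (hι.isImmersion.isImmersionAt m)
  exact hinj ((Prod.ext hv1 hvu : T v = 0).trans (map_zero T).symm)

/-- The constraint distribution, in a chart, as the kernel of a smooth family of linear maps. -/
theorem exists_constraintDist_ker
    (hι : ContMDiff 𝓘(ℝ, EM) (cotangentModel E) ∞ S.incl) (m : S.M) :
    ∃ L : EM → EM →L[ℝ] E, ContDiffAt ℝ ∞ L (extChartAt 𝓘(ℝ, EM) m m) ∧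
      ∀ᶠ z in 𝓝 (extChartAt 𝓘(ℝ, EM) m m), ∀ v, chartInv 𝓘(ℝ, EM) m z v ∈
        (show Submodule ℝ EM from S.constraintDist ((extChartAt 𝓘(ℝ, EM) m).symm z)) ↔ L z v = 0 := by
  have : IsManifold 𝓘(ℝ, E) 1 Q := .of_le (n := ∞) (by simp)
  have : IsManifold 𝓘(ℝ, EM) 1 S.M := .of_le (n := ∞) (by simp)
  obtain ⟨r, s, hs, hsD⟩ := exists_frame_inChart S.smooth_constraint (S.proj m)
  obtain ⟨N, hN, hNs⟩ := exists_contDiffAt_ker hs hsD.self_of_nhds.1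
  set t := localExpr 𝓘(ℝ, EM) 𝓘(ℝ, E) S.proj m (S.proj m) with ht
  set x₀ := extChartAt 𝓘(ℝ, EM) m m with hx₀
  have hτ := S.contMDiff_proj hι
  have ht₀ : t x₀ = extChartAt 𝓘(ℝ, E) (S.proj m) (S.proj m) := by simp [ht, localExpr, hx₀]
  have hts : ContDiffAt ℝ ∞ t x₀ := contDiffAt_localExpr (k := ⊤) (mem_extChartAt_target m) (hτ _)
    (by rw [extChartAt_to_inv]; exact mem_extChartAt_source _)
  have htc : Filter.Tendsto t (𝓝 x₀) (𝓝 (extChartAt 𝓘(ℝ, E) (S.proj m) (S.proj m))) := by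
    rw [← ht₀]; exact hts.continuousAt
  -- 𝓒 is the preimage of D under Tτ: in charts Tτ is the derivative of `t`, and `N` cuts out D.
  refine ⟨fun z => N (t z) ∘L fderiv ℝ t z, ?_, ?_⟩
  · rw [← ht₀] at hN
    exact (ContDiffAt.comp x₀ hN hts).clm_comp (hts.fderiv_right (m := ∞) le_rfl)
  · have hsrc : ∀ᶠ z in 𝓝 x₀, S.proj ((extChartAt 𝓘(ℝ, EM) m).symm z) ∈
        (extChartAt 𝓘(ℝ, E) (S.proj m)).source := by
      have hc : ContinuousAt (fun z => S.proj ((extChartAt 𝓘(ℝ, EM) m).symm z)) x₀ :=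
        ContinuousAt.comp (g := S.proj) (hτ _).continuousAt (continuousAt_extChartAt_symm m)
      refine hc ((isOpen_extChartAt_source _).mem_nhds ?_)
      simp only [hx₀, extChartAt_to_inv]
      exact mem_extChartAt_source _
    filter_upwards [hsrc, chart_mem_nhds (mem_extChartAt_target (I := 𝓘(ℝ, EM)) m),
      htc.eventually hsD, htc.eventually hNs] with z h1 h2 h3 h4 v
    have h5 := DFunLike.congr_fun (tderiv_comp_chartInv (y₀ := S.proj m) h2
      (hτ.mdifferentiable (by simp) _) h1) v
    have h6 : tderiv 𝓘(ℝ, EM) 𝓘(ℝ, E) S.proj ((extChartAt 𝓘(ℝ, EM) m).symm z)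
        (chartInv 𝓘(ℝ, EM) m z v) = chartInv 𝓘(ℝ, E) (S.proj m) (t z) (fderiv ℝ t z v) := h5
    refine (S.mem_constraintDist _ _).trans ?_
    rw [h6, ← S.constraint_congr ((extChartAt 𝓘(ℝ, E) (S.proj m)).left_inv h1)]
    exact (h3.2 _).trans (h4 _).symm

end NonholonomicSystem

/-! ### Bivectors determined by a subspace and a 2-form; gauge transformations. -/

section Sharp

variable {V : Type*} [NormedAddCommGroup V] [NormedSpace ℝ V]

theorem alternating_two_sub (σ τ : V [⋀^Fin 2]→L[ℝ] ℝ) (v w : V) :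
    (σ - τ) ![v, w] = σ ![v, w] - τ ![v, w] := rfl

/-- A 2-form is nondegenerate on a subspace. -/
def NondegenerateOn (C : Submodule ℝ V) (σ : V [⋀^Fin 2]→L[ℝ] ℝ) : Prop :=
  ∀ v ∈ C, (∀ w ∈ C, σ ![v, w] = 0) → v = 0

/-- The bivector determined by a subspace and a 2-form. -/
def IsSharp (C : Submodule ℝ V) (σ : V [⋀^Fin 2]→L[ℝ] ℝ) (π : (V →L[ℝ] ℝ) →L[ℝ] V) : Prop :=
  ∀ β, π β ∈ C ∧ ∀ v ∈ C, σ ![π β, v] = -β v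

variable {C : Submodule ℝ V} {σ B : V [⋀^Fin 2]→L[ℝ] ℝ} {π : (V →L[ℝ] ℝ) →L[ℝ] V}

/-- Uniqueness by nondegeneracy: two solutions in `C` differ by a vector of `C` that is σ-orthogonal
to `C`. -/
theorem IsSharp.eq_of (hσ : NondegenerateOn C σ) (hπ : IsSharp C σ π) {X : V} {β : V →L[ℝ] ℝ}
    (hX : X ∈ C) (h : ∀ v ∈ C, σ ![X, v] = -β v) : π β = X := by
  rw [← sub_eq_zero]
  refine hσ _ (C.sub_mem (hπ β).1 hX) fun w hw => ?_
  rw [sub_eq_add_neg, alternating_two_add_left, alternating_two_neg_left, (hπ β).2 w hw, h w hw]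
  ring

theorem IsSharp.skew (hπ : IsSharp C σ π) (α β : V →L[ℝ] ℝ) : β (π α) = -α (π β) := by
  have h1 := (hπ α).2 _ (hπ β).1
  have h2 := (hπ β).2 _ (hπ α).1
  rw [alternating_two_swap] at h2
  linarith

theorem isSharp_sharpOfPair [FiniteDimensional ℝ V] (hσ : NondegenerateOn C σ) :
    IsSharp C σ (sharpOfPair C σ) := by
  intro β
  have h := (sharpOfPair_iff C σ (restrictedFlat_isInvertible hσ) β (-sharpOfPair C σ β)).1
    (neg_neg _).symm
  refine ⟨by simpa using C.neg_mem h.1, fun v hv => ?_⟩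
  rw [← h.2 v hv, alternating_two_neg_left, neg_neg]

/-- If `v ∈ C` is orthogonal to `C` for `σ - B`, then σ and B agree on `v` against `C`, so `π (B♭ v)
= -v` by uniqueness. Therefore `(Id + B♭ π)(B♭ v) = B♭ v - B♭ v = 0`, and invertibility gives `B♭ v
= 0`, hence `v = 0`. -/
theorem IsSharp.nondegenerateOn_sub (hσ : NondegenerateOn C σ) (hπ : IsSharp C σ π)
    (hB : (gaugeEndo π B).IsInvertible) : NondegenerateOn C (σ - B) := by
  intro v hv h
  have h1 : π (flat B v) = -v := by
    refine hπ.eq_of hσ (C.neg_mem hv) fun w hw => ?_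
    have h2 := h w hw
    rw [alternating_two_sub, sub_eq_zero] at h2
    rw [flat_apply, alternating_two_neg_left, h2]
  have h2 : gaugeEndo π B (flat B v) = 0 := by
    change flat B v + flat B (π (flat B v)) = 0
    rw [h1, map_neg, add_neg_cancel]
  have h3 : flat B v = 0 := by
    obtain ⟨e, he⟩ := hB
    rw [← he] at h2
    exact e.map_eq_zero_iff.1 h2
  rw [h3, map_zero] at h1
  exact neg_eq_zero.1 h1.symm

/-- Writing `β = γ + B♭ π γ`, the transformed bivector sends `β` to `π γ`, and pairing `π γ` with `v
∈ C` under `σ - B` gives `-γ v - B(π γ, v) = -β v`. Thus the gauge transformation only changes the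
2-form. -/
theorem IsSharp.gaugeSharp (hπ : IsSharp C σ π)
    (hB : (gaugeEndo π B).IsInvertible) : IsSharp C (σ - B) (gaugeSharp π B) := by
  intro β
  set γ := (gaugeEndo π B).inverse β with hγ
  have h1 : gaugeEndo π B γ = β := (hB.inverse_apply_eq.mp rfl).symm
  have h2 : NonholonomicGeometry.gaugeSharp π B β = π γ := rfl
  rw [h2]
  refine ⟨(hπ γ).1, fun v hv => ?_⟩
  have h3 : β v = γ v + B ![π γ, v] := by
    rw [← h1, ← flat_apply]
    rfl
  rw [alternating_two_sub, (hπ γ).2 v hv, h3]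
  ring

theorem contDiffAt_flat {Z : Type*} [NormedAddCommGroup Z] [NormedSpace ℝ Z]
    {σ : Z → V [⋀^Fin 2]→L[ℝ] ℝ} {z : Z} (hσ : ContDiffAt ℝ ∞ σ z) :
    ContDiffAt ℝ ∞ (fun y => flat (σ y)) z := by
  have h := LinearIsometry.contDiff (𝕜 := ℝ) (E := V [⋀^Fin 2]→L[ℝ] ℝ)
    (F := V →L[ℝ] V [⋀^Fin 1]→L[ℝ] ℝ) (n := ∞) ContinuousAlternatingMap.curryLeftLI
  exact contDiffAt_const.clm_comp (ContDiffAt.comp z h.contDiffAt hσ)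

theorem ContDiffAt.precomp {Z : Type*} [NormedAddCommGroup Z] [NormedSpace ℝ Z]
    {W : Type*} [NormedAddCommGroup W] [NormedSpace ℝ W]
    {P : Z → V →L[ℝ] W} {z : Z} (hP : ContDiffAt ℝ ∞ P z) :
    ContDiffAt ℝ ∞ (fun y => (ContinuousLinearMap.precomp ℝ (P y) :
      (W →L[ℝ] ℝ) →L[ℝ] V →L[ℝ] ℝ)) z := by
  have h := ContinuousLinearMap.contDiff (𝕜 := ℝ) (E := V →L[ℝ] W)
    (F := (W →L[ℝ] ℝ) →L[ℝ] V →L[ℝ] ℝ) (n := ∞) (ContinuousLinearMap.compL ℝ V W ℝ).flip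
  exact ContDiffAt.comp z h.contDiffAt hP

/-- Inverting a form on a varying subspace is reduced to a fixed space: with `P` a smooth projection
onto `C` and `g` a definite form, `T = P^*σ + (1 - P)^*g` is nondegenerate on all of `V` at the
point, and `T π = -P^*`. Smoothness then follows by solving this equation for `π`. -/
theorem contDiffAt_of_isSharp [FiniteDimensional ℝ V] {Z : Type*} [NormedAddCommGroup Z]
    [NormedSpace ℝ Z] {P : Z → V →L[ℝ] V} {σ : Z → V [⋀^Fin 2]→L[ℝ] ℝ} {C : Z → Submodule ℝ V}
    {π : Z → (V →L[ℝ] ℝ) →L[ℝ] V} {z : Z}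
    (hP : ContDiffAt ℝ ∞ P z) (hσ : ContDiffAt ℝ ∞ σ z)
    (hPC : ∀ᶠ y in 𝓝 z, (∀ v, P y v ∈ C y) ∧ ∀ v ∈ C y, P y v = v)
    (hπ : ∀ᶠ y in 𝓝 z, IsSharp (C y) (σ y) (π y)) (hnd : NondegenerateOn (C z) (σ z)) :
    ContDiffAt ℝ ∞ π z := by
  obtain ⟨g, hg⟩ := exists_definite_form V
  let P' : Z → V →L[ℝ] V := fun y => ContinuousLinearMap.id ℝ V - P y
  have hP' : ContDiffAt ℝ ∞ P' z := contDiffAt_const.sub hP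
  let T : Z → V →L[ℝ] V →L[ℝ] ℝ := fun y =>
    ContinuousLinearMap.precomp ℝ (P y) ∘L flat (σ y) ∘L P y +
      ContinuousLinearMap.precomp ℝ (P' y) ∘L g ∘L P' y
  have hT : ContDiffAt ℝ ∞ T z := ((ContDiffAt.precomp hP).clm_comp
    ((contDiffAt_flat hσ).clm_comp hP)).add
      ((ContDiffAt.precomp hP').clm_comp (contDiffAt_const.clm_comp hP'))
  have hTa : ∀ y v w, T y v w = σ y ![P y v, P y w] + g (v - P y v) (w - P y w) := by
    intro y v w
    rw [← flat_apply]
    rfl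
  have hinj : Function.Injective (T z) := by
    rw [injective_iff_map_eq_zero]
    intro v hv
    obtain ⟨h1, h2⟩ := hPC.self_of_nhds
    have h0 : ∀ w, σ z ![P z v, P z w] + g (v - P z v) (w - P z w) = 0 := by
      intro w
      rw [← hTa, hv]
      rfl
    have hPv : P z v = 0 := by
      refine hnd _ (h1 v) fun w hw => ?_
      have h3 := h0 w
      rwa [h2 w hw, sub_self, map_zero, add_zero] at h3
    have h4 := h0 v
    have h5 : σ z ![(0 : V), 0] = 0 := (σ z).map_coord_zero 0 rfl
    rw [hPv, sub_zero, h5, zero_add] at h4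
    exact hg v h4
  refine ContDiffAt.of_injective_comp (B := fun y => -ContinuousLinearMap.precomp ℝ (P y))
    hT hinj (ContDiffAt.precomp hP).neg ?_
  filter_upwards [hPC, hπ] with y h1 h2
  ext β w
  change T y (π y β) w = -(β (P y w))
  rw [hTa, h1.2 _ (h2 β).1, sub_self, map_zero, (h2 β).2 _ (h1.1 w)]
  simp

end Sharp

/-! ### Distributions and sharp maps read in a chart. -/

section Transfer

variable {E : Type*} [NormedAddCommGroup E] [NormedSpace ℝ E]
  {X : Type*} [TopologicalSpace X] [ChartedSpace E X] [IsManifold 𝓘(ℝ, E) 1 X]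
  {F : Type*} [NormedAddCommGroup F] [NormedSpace ℝ F]

/-- The expression of a family of subspaces of the tangent spaces in the preferred chart at `x₀`. -/
def distInChart (C : ∀ x : X, Submodule ℝ (TangentSpace 𝓘(ℝ, E) x)) (x₀ : X) (y : E) :
    Submodule ℝ E :=
  (show Submodule ℝ E from C ((extChartAt 𝓘(ℝ, E) x₀).symm y)).comap
    (chartInv 𝓘(ℝ, E) x₀ y).toLinearMap

theorem mem_distInChart {C : ∀ x : X, Submodule ℝ (TangentSpace 𝓘(ℝ, E) x)} {x₀ : X} {y v : E} :
    v ∈ distInChart C x₀ y ↔ chartInv 𝓘(ℝ, E) x₀ y v ∈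
      (show Submodule ℝ E from C ((extChartAt 𝓘(ℝ, E) x₀).symm y)) := Iff.rfl

theorem formInChart_apply_one (σ : ∀ x : X, TangentSpace 𝓘(ℝ, E) x [⋀^Fin 1]→L[ℝ] F) (x₀ : X)
    (y v : E) : formInChart 𝓘(ℝ, E) σ x₀ y ![v] =
      (σ ((extChartAt 𝓘(ℝ, E) x₀).symm y) : E [⋀^Fin 1]→L[ℝ] F) ![chartInv 𝓘(ℝ, E) x₀ y v] := by
  exact congrArg (σ ((extChartAt 𝓘(ℝ, E) x₀).symm y) : E [⋀^Fin 1]→L[ℝ] F)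
    (comp_vec_one (chartInv 𝓘(ℝ, E) x₀ y) v)

theorem formInChart_apply_two (σ : ∀ x : X, TangentSpace 𝓘(ℝ, E) x [⋀^Fin 2]→L[ℝ] F) (x₀ : X)
    (y v w : E) : formInChart 𝓘(ℝ, E) σ x₀ y ![v, w] =
      (σ ((extChartAt 𝓘(ℝ, E) x₀).symm y) : E [⋀^Fin 2]→L[ℝ] F)
        ![chartInv 𝓘(ℝ, E) x₀ y v, chartInv 𝓘(ℝ, E) x₀ y w] := by
  exact congrArg (σ ((extChartAt 𝓘(ℝ, E) x₀).symm y) : E [⋀^Fin 2]→L[ℝ] F)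
    (comp_vec_two (chartInv 𝓘(ℝ, E) x₀ y) v w)

/-- The relation between distribution, 2-form and bivector is pointwise linear algebra, so it is
carried to the chart by the linear isomorphism given by the chart derivative. -/
theorem IsSharp.inChart {C : ∀ x : X, Submodule ℝ (TangentSpace 𝓘(ℝ, E) x)}
    {σ : ∀ x : X, TangentSpace 𝓘(ℝ, E) x [⋀^Fin 2]→L[ℝ] ℝ} {π : SharpField 𝓘(ℝ, E) X}
    {x₀ : X} {y : E} (hy : y ∈ (extChartAt 𝓘(ℝ, E) x₀).target)
    (h : IsSharp (V := E) (C ((extChartAt 𝓘(ℝ, E) x₀).symm y))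
      (σ ((extChartAt 𝓘(ℝ, E) x₀).symm y)) (π ((extChartAt 𝓘(ℝ, E) x₀).symm y))) :
    IsSharp (distInChart C x₀ y) (formInChart 𝓘(ℝ, E) σ x₀ y)
      (bivectorInChart 𝓘(ℝ, E) π x₀ y) := by
  intro β
  set x := (extChartAt 𝓘(ℝ, E) x₀).symm y with hx
  obtain ⟨h1, h2⟩ := h (β ∘L chartFwd 𝓘(ℝ, E) x₀ x)
  have e : bivectorInChart 𝓘(ℝ, E) π x₀ y β =
    chartFwd 𝓘(ℝ, E) x₀ x ((show (E →L[ℝ] ℝ) →L[ℝ] E from π x) (β ∘L chartFwd 𝓘(ℝ, E) x₀ x)) := rfl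
  have e2 : chartInv 𝓘(ℝ, E) x₀ y (bivectorInChart 𝓘(ℝ, E) π x₀ y β) =
      (show (E →L[ℝ] ℝ) →L[ℝ] E from π x) (β ∘L chartFwd 𝓘(ℝ, E) x₀ x) := by
    rw [e]
    exact DFunLike.congr_fun (chartInv_comp_chartFwd (I := 𝓘(ℝ, E)) hy) _
  refine ⟨?_, fun v hv => ?_⟩
  · rw [mem_distInChart, e2]
    exact h1
  · rw [formInChart_apply_two, e2]
    refine (h2 _ hv).trans ?_
    rw [neg_inj]
    exact congrArg β (DFunLike.congr_fun (chartFwd_comp_chartInv (I := 𝓘(ℝ, E)) hy) v)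

end Transfer

/-! ### Smoothness of the projections and of π_B. -/

namespace NonholonomicSystem

variable {E : Type*} [NormedAddCommGroup E] [NormedSpace ℝ E] [FiniteDimensional ℝ E]
  {Q : Type*} [TopologicalSpace Q] [ChartedSpace E Q] [IsManifold 𝓘(ℝ, E) ∞ Q]
  {S : NonholonomicSystem E Q}
  {EM : Type*} [NormedAddCommGroup EM] [NormedSpace ℝ EM] [FiniteDimensional ℝ EM]
  [ChartedSpace EM S.M]

theorem isSharp_gaugeBivector [IsManifold 𝓘(ℝ, EM) ∞ S.M]
    (hι : Manifold.IsSmoothEmbedding 𝓘(ℝ, EM) (cotangentModel E) ∞ S.incl)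
    {B : ∀ m : S.M, TangentSpace 𝓘(ℝ, EM) m [⋀^Fin 2]→L[ℝ] ℝ} (hB : S.IsGauge B) (m : S.M) :
    IsSharp (V := EM) (S.constraintDist m) (S.twoForm m - B m) (S.gaugeBivector B m) :=
  (isSharp_sharpOfPair (V := EM) (S.twoForm_nondegenerate hι m)).gaugeSharp (hB m)

theorem nondegenerateOn_twoForm_sub [IsManifold 𝓘(ℝ, EM) ∞ S.M]
    (hι : Manifold.IsSmoothEmbedding 𝓘(ℝ, EM) (cotangentModel E) ∞ S.incl)
    {B : ∀ m : S.M, TangentSpace 𝓘(ℝ, EM) m [⋀^Fin 2]→L[ℝ] ℝ} (hB : S.IsGauge B) (m : S.M) :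
    NondegenerateOn (V := EM) (S.constraintDist m) (S.twoForm m - B m) :=
  (isSharp_sharpOfPair (V := EM) (S.twoForm_nondegenerate hι m)).nondegenerateOn_sub
    (S.twoForm_nondegenerate hι m) (hB m)

namespace VerticalComplement

variable [IsManifold 𝓘(ℝ, EM) 1 S.M]
  {EG : Type*} [NormedAddCommGroup EG] [NormedSpace ℝ EG]
  {G : Type*} [TopologicalSpace G] [ChartedSpace EG G] [Group G]
  [MulAction G Q] [S.IsSymmetric G] (W : S.VerticalComplement EM EG G)

theorem projW_mem (m : S.M) (v : EM) : W.projW m v ∈ (show Submodule ℝ EM from W.dist m) :=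
  Submodule.projection_apply_mem (W.isCompl m).symm v

theorem projC_mem (m : S.M) (v : EM) :
    W.projC m v ∈ (show Submodule ℝ EM from S.constraintDist m) :=
  Submodule.projection_apply_mem (W.isCompl m) v

theorem projC_add_projW (m : S.M) (v : EM) : W.projC m v + W.projW m v = v := by
  exact Submodule.projection_add_projection_eq_self (W.isCompl m) v

theorem projC_of_mem (m : S.M) {v : EM}
    (hv : v ∈ (show Submodule ℝ EM from S.constraintDist m)) : W.projC m v = v :=
  Submodule.projection_apply_of_mem_left (W.isCompl m) hv

/-- The projection onto `𝓦` in the preferred chart at `m`. -/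
def projWInChart (m : S.M) (z : EM) : EM →L[ℝ] EM :=
  chartFwd 𝓘(ℝ, EM) m ((extChartAt 𝓘(ℝ, EM) m).symm z) ∘L
    W.projW ((extChartAt 𝓘(ℝ, EM) m).symm z) ∘L chartInv 𝓘(ℝ, EM) m z

theorem chartInv_projWInChart {m : S.M} {z : EM} (hz : z ∈ (extChartAt 𝓘(ℝ, EM) m).target) (v : EM) :
    chartInv 𝓘(ℝ, EM) m z (W.projWInChart m z v) =
      W.projW ((extChartAt 𝓘(ℝ, EM) m).symm z) (chartInv 𝓘(ℝ, EM) m z v) :=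
  DFunLike.congr_fun (chartInv_comp_chartFwd (I := 𝓘(ℝ, EM)) hz) _

theorem chartInv_sub_projWInChart {m : S.M} {z : EM} (hz : z ∈ (extChartAt 𝓘(ℝ, EM) m).target)
    (v : EM) : chartInv 𝓘(ℝ, EM) m z (v - W.projWInChart m z v) =
      W.projC ((extChartAt 𝓘(ℝ, EM) m).symm z) (chartInv 𝓘(ℝ, EM) m z v) := by
  rw [map_sub, W.chartInv_projWInChart hz, sub_eq_iff_eq_add]
  exact (W.projC_add_projW _ _).symm

/-- 𝓒 is the kernel of a smooth family `L` and 𝓦 the range of a smooth frame `w`. Complementarity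
says that `L ∘ w` is injective, which is what `contDiffAt_projection` requires. -/
theorem contDiffAt_projWInChart [IsManifold 𝓘(ℝ, EM) ∞ S.M]
    (hι : ContMDiff 𝓘(ℝ, EM) (cotangentModel E) ∞ S.incl) (m : S.M) :
    ContDiffAt ℝ ∞ (W.projWInChart m) (extChartAt 𝓘(ℝ, EM) m m) := by
  obtain ⟨L, hL, hLC⟩ := S.exists_constraintDist_ker hι m
  obtain ⟨r, w, hw, hwW⟩ := exists_frame_inChart W.smooth m
  refine contDiffAt_projection hL hw ?_ ?_
  · rw [injective_iff_map_eq_zero]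
    intro c hc
    have h1 := (hLC.self_of_nhds (w (extChartAt 𝓘(ℝ, EM) m m) c)).2 hc
    have h2 := (hwW.self_of_nhds.2 (w (extChartAt 𝓘(ℝ, EM) m m) c)).2 ⟨c, rfl⟩
    have h3 : chartInv 𝓘(ℝ, EM) m (extChartAt 𝓘(ℝ, EM) m m) (w (extChartAt 𝓘(ℝ, EM) m m) c) = 0 :=
      (Submodule.disjoint_def.1 (W.isCompl _).disjoint) _ h1 h2
    rw [chartInv_self] at h3
    exact hwW.self_of_nhds.1 (h3.trans (map_zero _).symm)
  · filter_upwards [hLC, hwW, chart_mem_nhds (mem_extChartAt_target (I := 𝓘(ℝ, EM)) m)]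
      with z h1 h2 hz v
    constructor
    · obtain ⟨c, hc⟩ := (h2.2 (W.projWInChart m z v)).1
        ((W.chartInv_projWInChart hz v).symm ▸ W.projW_mem _ _)
      exact ⟨c, hc.symm⟩
    · exact (h1 _).1 ((W.chartInv_sub_projWInChart hz v).symm ▸ W.projC_mem _ _)

/-- The complement 𝓦 provides the smooth projection onto 𝓒 needed to invert Ω − B on the varying
spaces 𝓒. -/
theorem contDiffAt_gaugeBivector [IsManifold 𝓘(ℝ, EM) ∞ S.M] (W : S.VerticalComplement EM EG G)
    (hι : Manifold.IsSmoothEmbedding 𝓘(ℝ, EM) (cotangentModel E) ∞ S.incl)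
    {B : ∀ m : S.M, TangentSpace 𝓘(ℝ, EM) m [⋀^Fin 2]→L[ℝ] ℝ}
    (hBs : IsSmoothForm 𝓘(ℝ, EM) B) (hB : S.IsGauge B) (m : S.M) :
    ContDiffAt ℝ ∞ (bivectorInChart 𝓘(ℝ, EM) (S.gaugeBivector B) m)
      (extChartAt 𝓘(ℝ, EM) m m) := by
  have hmt := mem_extChartAt_target (I := 𝓘(ℝ, EM)) m
  refine contDiffAt_of_isSharp (C := distInChart S.constraintDist m)
    (P := fun z => ContinuousLinearMap.id ℝ EM - W.projWInChart m z)
    (σ := formInChart 𝓘(ℝ, EM) (S.twoForm - B) m) ?_ ?_ ?_ ?_ ?_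
  · exact contDiffAt_const.sub (W.contDiffAt_projWInChart hι.contMDiff m)
  · exact (S.contDiffAt_formInChart_twoForm hι.contMDiff hmt).sub
      ((hBs m).contDiffAt (chart_mem_nhds hmt))
  · filter_upwards [chart_mem_nhds hmt] with z hz
    have key : ∀ v, chartInv 𝓘(ℝ, EM) m z ((ContinuousLinearMap.id ℝ EM - W.projWInChart m z) v) =
      W.projC ((extChartAt 𝓘(ℝ, EM) m).symm z) (chartInv 𝓘(ℝ, EM) m z v) :=
      W.chartInv_sub_projWInChart hz
    refine ⟨fun v => ?_, fun v hv => ?_⟩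
    · rw [mem_distInChart, key]
      exact W.projC_mem _ _
    · have h1 := key v
      replace h1 := h1.trans (W.projC_of_mem _ hv)
      have h2 := congrArg (chartFwd 𝓘(ℝ, EM) m ((extChartAt 𝓘(ℝ, EM) m).symm z)) h1
      have h3 := fun u => DFunLike.congr_fun (chartFwd_comp_chartInv (I := 𝓘(ℝ, EM)) hz) u
      exact (h3 _).symm.trans (h2.trans (h3 v))
  · filter_upwards [chart_mem_nhds hmt] with z hz
    exact IsSharp.inChart hz (isSharp_gaugeBivector hι hB _)
  · intro v hv h
    rw [mem_distInChart] at hv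
    have h0 := nondegenerateOn_twoForm_sub hι hB
      ((extChartAt 𝓘(ℝ, EM) m).symm (extChartAt 𝓘(ℝ, EM) m m)) _ hv
    rw [chartInv_self] at h0
    refine h0 fun w hw => ?_
    have h1 := h w (by rw [mem_distInChart, chartInv_self]; exact hw)
    rw [formInChart_apply_two, chartInv_self] at h1
    exact h1

end VerticalComplement

end NonholonomicSystem

/-! ### Partial derivatives of local expressions on products. -/

section Product

variable {E₁ : Type*} [NormedAddCommGroup E₁] [NormedSpace ℝ E₁]
  {X₁ : Type*} [TopologicalSpace X₁] [ChartedSpace E₁ X₁] [IsManifold 𝓘(ℝ, E₁) ∞ X₁]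
  {E₂ : Type*} [NormedAddCommGroup E₂] [NormedSpace ℝ E₂]
  {X₂ : Type*} [TopologicalSpace X₂] [ChartedSpace E₂ X₂] [IsManifold 𝓘(ℝ, E₂) ∞ X₂]
  {E' : Type*} [NormedAddCommGroup E'] [NormedSpace ℝ E']
  {Y : Type*} [TopologicalSpace Y] [ChartedSpace E' Y] [IsManifold 𝓘(ℝ, E') ∞ Y]

theorem mem_extChartAt_prod_target {x : X₁ × X₂} {z : E₁ × E₂} :
    z ∈ (extChartAt (𝓘(ℝ, E₁).prod 𝓘(ℝ, E₂)) x).target ↔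
      z.1 ∈ (extChartAt 𝓘(ℝ, E₁) x.1).target ∧ z.2 ∈ (extChartAt 𝓘(ℝ, E₂) x.2).target := by
  rw [extChartAt_prod, PartialEquiv.prod_target, Set.mem_prod]

theorem extChartAt_prod_symm_apply (x : X₁ × X₂) (z : E₁ × E₂) :
    (extChartAt (𝓘(ℝ, E₁).prod 𝓘(ℝ, E₂)) x).symm z =
      ((extChartAt 𝓘(ℝ, E₁) x.1).symm z.1, (extChartAt 𝓘(ℝ, E₂) x.2).symm z.2) := by
  rw [extChartAt_prod]
  rfl

variable {Φ : X₁ × X₂ → Y} {x₁ : X₁} {x₂ : X₂} {y₀ : Y} {t : E₁} {z : E₂}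

theorem localExpr_prod_apply (t : E₁) (z : E₂) :
    localExpr (𝓘(ℝ, E₁).prod 𝓘(ℝ, E₂)) 𝓘(ℝ, E') Φ (x₁, x₂) y₀ (t, z) =
      extChartAt 𝓘(ℝ, E') y₀ (Φ ((extChartAt 𝓘(ℝ, E₁) x₁).symm t, (extChartAt 𝓘(ℝ, E₂) x₂).symm z)) := by
  simp only [localExpr, Function.comp_apply, extChartAt_prod_symm_apply]

theorem contDiffAt_localExpr_prod (ht : t ∈ (extChartAt 𝓘(ℝ, E₁) x₁).target)
    (hz : z ∈ (extChartAt 𝓘(ℝ, E₂) x₂).target)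
    (hΦ : ContMDiff (𝓘(ℝ, E₁).prod 𝓘(ℝ, E₂)) 𝓘(ℝ, E') ∞ Φ)
    (hy : Φ ((extChartAt 𝓘(ℝ, E₁) x₁).symm t, (extChartAt 𝓘(ℝ, E₂) x₂).symm z) ∈
      (extChartAt 𝓘(ℝ, E') y₀).source) :
    ContDiffAt ℝ ∞ (localExpr (𝓘(ℝ, E₁).prod 𝓘(ℝ, E₂)) 𝓘(ℝ, E') Φ (x₁, x₂) y₀) (t, z) :=
  contDiffAt_localExpr (k := ⊤) (mem_extChartAt_prod_target.2 ⟨ht, hz⟩) (hΦ _)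
    (by rw [extChartAt_prod_symm_apply]; exact hy)

theorem fderiv_localExpr_prod_right (ht : t ∈ (extChartAt 𝓘(ℝ, E₁) x₁).target)
    (hz : z ∈ (extChartAt 𝓘(ℝ, E₂) x₂).target)
    (hΦ : ContMDiff (𝓘(ℝ, E₁).prod 𝓘(ℝ, E₂)) 𝓘(ℝ, E') ∞ Φ)
    (hy : Φ ((extChartAt 𝓘(ℝ, E₁) x₁).symm t, (extChartAt 𝓘(ℝ, E₂) x₂).symm z) ∈
      (extChartAt 𝓘(ℝ, E') y₀).source) :
    fderiv ℝ (localExpr 𝓘(ℝ, E₂) 𝓘(ℝ, E')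
      (fun x => Φ ((extChartAt 𝓘(ℝ, E₁) x₁).symm t, x)) x₂ y₀) z =
    fderiv ℝ (localExpr (𝓘(ℝ, E₁).prod 𝓘(ℝ, E₂)) 𝓘(ℝ, E') Φ (x₁, x₂) y₀) (t, z) ∘L
      .inr ℝ E₁ E₂ := by
  have h := ((contDiffAt_localExpr_prod ht hz hΦ hy).differentiableAt (by simp)).hasFDerivAt
  have h2 := HasFDerivAt.comp z (f := fun z => (t, z)) h (hasFDerivAt_prodMk_right t z)
  rw [← h2.fderiv]
  congr 1

theorem fderiv_localExpr_prod_left (ht : t ∈ (extChartAt 𝓘(ℝ, E₁) x₁).target)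
    (hz : z ∈ (extChartAt 𝓘(ℝ, E₂) x₂).target)
    (hΦ : ContMDiff (𝓘(ℝ, E₁).prod 𝓘(ℝ, E₂)) 𝓘(ℝ, E') ∞ Φ)
    (hy : Φ ((extChartAt 𝓘(ℝ, E₁) x₁).symm t, (extChartAt 𝓘(ℝ, E₂) x₂).symm z) ∈
      (extChartAt 𝓘(ℝ, E') y₀).source) :
    fderiv ℝ (localExpr 𝓘(ℝ, E₁) 𝓘(ℝ, E')
      (fun x => Φ (x, (extChartAt 𝓘(ℝ, E₂) x₂).symm z)) x₁ y₀) t =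
    fderiv ℝ (localExpr (𝓘(ℝ, E₁).prod 𝓘(ℝ, E₂)) 𝓘(ℝ, E') Φ (x₁, x₂) y₀) (t, z) ∘L
      .inl ℝ E₁ E₂ := by
  have h := ((contDiffAt_localExpr_prod ht hz hΦ hy).differentiableAt (by simp)).hasFDerivAt
  have h2 := HasFDerivAt.comp t (f := fun t => (t, z)) h (hasFDerivAt_prodMk_left t z)
  rw [← h2.fderiv]
  congr 1

end Product

/-! ### Joint smoothness of the action on 𝓜. -/

namespace NonholonomicSystem

variable {E : Type*} [NormedAddCommGroup E] [NormedSpace ℝ E]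
  {Q : Type*} [TopologicalSpace Q] [ChartedSpace E Q] [IsManifold 𝓘(ℝ, E) ∞ Q]
  (S : NonholonomicSystem E Q)
  {EM : Type*} [NormedAddCommGroup EM] [NormedSpace ℝ EM]
  [ChartedSpace EM S.M]
  {EG : Type*} [NormedAddCommGroup EG] [NormedSpace ℝ EG]
  {G : Type*} [TopologicalSpace G] [ChartedSpace EG G] [Group G] [LieGroup 𝓘(ℝ, EG) ∞ G]
  [MulAction G Q] [ContMDiffSMul 𝓘(ℝ, EG) 𝓘(ℝ, E) ∞ G Q] [hS : S.IsSymmetric G]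

/-- The cotangent lift composes a covector with the derivative of `q ↦ g⁻¹ • q`. In charts this is
the partial derivative in q of the jointly smooth map `(g, q) ↦ g⁻¹ • q`, which makes smoothness in
both variables visible. -/
theorem covectorInChart_smul {g₀ g : G} {q₀ : Q} {m : S.M}
    (hg : g ∈ (extChartAt 𝓘(ℝ, EG) g₀).source)
    (hm : S.proj m ∈ (extChartAt 𝓘(ℝ, E) q₀).source)
    (hgm : g • S.proj m ∈ (extChartAt 𝓘(ℝ, E) (g₀ • q₀)).source) :
    covectorInChart (g₀ • q₀) (S.incl (g • m)) = covectorInChart q₀ (S.incl m) ∘L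
      fderiv ℝ (localExpr (𝓘(ℝ, EG).prod 𝓘(ℝ, E)) 𝓘(ℝ, E) (fun x : G × Q => x.1⁻¹ • x.2)
        (g₀, g₀ • q₀) q₀) (extChartAt 𝓘(ℝ, EG) g₀ g, extChartAt 𝓘(ℝ, E) (g₀ • q₀) (g • S.proj m)) ∘L
      .inr ℝ EG E := by
  have : IsManifold 𝓘(ℝ, E) 1 Q := .of_le (n := ∞) (by simp)
  have : IsManifold 𝓘(ℝ, EG) ∞ G := LieGroup.toContMDiffMul.toIsManifold
  set q := S.proj m with hq
  have hF : ContMDiff (𝓘(ℝ, EG).prod 𝓘(ℝ, E)) 𝓘(ℝ, E) ∞ (fun x : G × Q => x.1⁻¹ • x.2) :=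
    (contMDiff_fst.inv).smul contMDiff_snd
  have hgl := (extChartAt 𝓘(ℝ, EG) g₀).left_inv hg
  have hql := (extChartAt 𝓘(ℝ, E) (g₀ • q₀)).left_inv hgm
  have hy := (extChartAt 𝓘(ℝ, E) (g₀ • q₀)).map_source hgm
  have h1 := fderiv_localExpr_prod_right (y₀ := q₀) ((extChartAt 𝓘(ℝ, EG) g₀).map_source hg)
    hy hF (by
      rw [hgl, hql]
      simpa using hm)
  rw [hgl] at h1
  rw [← h1]
  have hf : MDifferentiable 𝓘(ℝ, E) 𝓘(ℝ, E) (fun x : Q => g⁻¹ • x) := fun x =>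
    mdifferentiableAt_smul (IsSymmetric.contMDiff_smul (S := S)) g⁻¹ x
  have h2 := tderiv_comp_chartInv (f := fun x : Q => g⁻¹ • x) (y₀ := q₀) hy (hf _) (by
    rw [hql, inv_smul_smul]; exact hm)
  have h3 : localExpr 𝓘(ℝ, E) 𝓘(ℝ, E) (fun x : Q => g⁻¹ • x) (g₀ • q₀) q₀
      (extChartAt 𝓘(ℝ, E) (g₀ • q₀) (g • q)) = extChartAt 𝓘(ℝ, E) q₀ q := by
    simp only [localExpr, Function.comp_apply, hql, inv_smul_smul]
  rw [hql, h3] at h2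
  have h4 : covectorInChart (g₀ • q₀) (S.incl (g • m)) = (show E →L[ℝ] ℝ from (S.incl m).2) ∘L
      (tderiv 𝓘(ℝ, E) 𝓘(ℝ, E) (fun x : Q => g⁻¹ • x) (g • q) ∘L
        chartInv 𝓘(ℝ, E) (g₀ • q₀) (extChartAt 𝓘(ℝ, E) (g₀ • q₀) (g • q))) := by
    have h := IsSymmetric.contMDiff_smul (S := S) (G := G)
    rw [tderiv, ← ContinuousLinearMap.inverse_eq (mfderiv_smul_comp' h g q) (mfderiv_smul_comp h g q)]
    rfl
  rw [h4, h2]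
  rfl

/-- Smoothness is tested in T*Q, because 𝓜 is embedded, and there separately on base points and on
covectors in a chart. -/
theorem contMDiff_smul_M
    (hι : Manifold.IsSmoothEmbedding 𝓘(ℝ, EM) (cotangentModel E) ∞ S.incl) :
    ContMDiff (𝓘(ℝ, EG).prod 𝓘(ℝ, EM)) 𝓘(ℝ, EM) ∞ (fun x : G × S.M => x.1 • x.2) := by
  rintro ⟨g₀, m₀⟩
  have : IsManifold 𝓘(ℝ, EG) ∞ G := LieGroup.toContMDiffMul.toIsManifold
  refine contMDiffAt_of_comp_isSmoothEmbedding hι ?_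
  have hF : ContMDiff (𝓘(ℝ, EG).prod 𝓘(ℝ, E)) 𝓘(ℝ, E) ∞ (fun x : G × Q => x.1⁻¹ • x.2) :=
    (contMDiff_fst.inv).smul contMDiff_snd
  have hτ := S.contMDiff_proj hι.contMDiff
  have hbase : ContMDiff (𝓘(ℝ, EG).prod 𝓘(ℝ, EM)) 𝓘(ℝ, E) ∞
      (fun x : G × S.M => x.1 • S.proj x.2) :=
    contMDiff_fst.smul (hτ.comp contMDiff_snd)
  refine contMDiffAt_cotangent_iff.2 ⟨hbase _, ?_⟩
  set q₀ := S.proj m₀ with hq₀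
  set H := localExpr (𝓘(ℝ, EG).prod 𝓘(ℝ, E)) 𝓘(ℝ, E) (fun x : G × Q => x.1⁻¹ • x.2)
        (g₀, g₀ • q₀) q₀ with hH
  have hHs : ContDiffAt ℝ ∞ H (extChartAt 𝓘(ℝ, EG) g₀ g₀,
      extChartAt 𝓘(ℝ, E) (g₀ • q₀) (g₀ • q₀)) :=
    contDiffAt_localExpr_prod (mem_extChartAt_target _) (mem_extChartAt_target _) hF (by
      simp only [extChartAt_to_inv, inv_smul_smul]
      exact mem_extChartAt_source _)
  have hc : ContMDiffAt (𝓘(ℝ, EG).prod 𝓘(ℝ, EM)) 𝓘(ℝ, EG × E) ∞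
      (fun x : G × S.M => (extChartAt 𝓘(ℝ, EG) g₀ x.1,
        extChartAt 𝓘(ℝ, E) (g₀ • q₀) (x.1 • S.proj x.2))) (g₀, m₀) := by
    refine ContMDiffAt.prodMk_space ?_ ?_
    · exact ContMDiffAt.comp (g₀, m₀) (f := Prod.fst) contMDiffAt_extChartAt contMDiffAt_fst
    · exact ContMDiffAt.comp (g₀, m₀) (f := fun x : G × S.M => x.1 • S.proj x.2)
        contMDiffAt_extChartAt (hbase _)
  have hDH := (hHs.fderiv_right (m := ∞) le_rfl).contMDiffAt.comp (g₀, m₀) hc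
  have hcov : ContMDiffAt (𝓘(ℝ, EG).prod 𝓘(ℝ, EM)) 𝓘(ℝ, E →L[ℝ] ℝ) ∞
      (fun x : G × S.M => covectorInChart q₀ (S.incl x.2)) (g₀, m₀) :=
    ContMDiffAt.comp (g₀, m₀) (f := Prod.snd)
      (contMDiffAt_cotangent_iff.1 (hι.contMDiff m₀)).2 contMDiffAt_snd
  have hall := hcov.clm_comp (hDH.clm_comp (contMDiffAt_const (c := ContinuousLinearMap.inr ℝ EG E)))
  refine hall.congr_of_eventuallyEq ?_
  have e1 : ∀ᶠ x : G × S.M in 𝓝 (g₀, m₀), x.1 ∈ (extChartAt 𝓘(ℝ, EG) g₀).source :=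
    continuousAt_fst ((isOpen_extChartAt_source g₀).mem_nhds (mem_extChartAt_source g₀))
  have e2 : ∀ᶠ x : G × S.M in 𝓝 (g₀, m₀), S.proj x.2 ∈ (extChartAt 𝓘(ℝ, E) q₀).source :=
    (hτ.continuous.comp continuous_snd).continuousAt
      ((isOpen_extChartAt_source q₀).mem_nhds (mem_extChartAt_source q₀))
  have e3 : ∀ᶠ x : G × S.M in 𝓝 (g₀, m₀),
      x.1 • S.proj x.2 ∈ (extChartAt 𝓘(ℝ, E) (g₀ • q₀)).source :=
    hbase.continuous.continuousAt
      ((isOpen_extChartAt_source (g₀ • q₀)).mem_nhds (mem_extChartAt_source (g₀ • q₀)))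
  filter_upwards [e1, e2, e3] with x h1 h2 h3
  exact S.covectorInChart_smul h1 h2 h3

end NonholonomicSystem

/-! ### Invariance of 𝓒, Θ, Ω and π_B. -/

namespace NonholonomicSystem

variable {E : Type*} [NormedAddCommGroup E] [NormedSpace ℝ E]
  {Q : Type*} [TopologicalSpace Q] [ChartedSpace E Q] [IsManifold 𝓘(ℝ, E) ∞ Q]
  (S : NonholonomicSystem E Q)
  {EM : Type*} [NormedAddCommGroup EM] [NormedSpace ℝ EM]
  [ChartedSpace EM S.M]

section Maps

variable {G : Type*} [Group G] [MulAction G Q] [hS : S.IsSymmetric G]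

/-- The derivative of the action of a group element on the constraint submanifold. -/
abbrev tsmul (g : G) (m : S.M) : EM →L[ℝ] EM :=
  tderiv 𝓘(ℝ, EM) 𝓘(ℝ, EM) (fun m : S.M => g • m) m

theorem tderiv_proj_tsmul
    (hι : ContMDiff 𝓘(ℝ, EM) (cotangentModel E) ∞ S.incl)
    (hg : ∀ g : G, ContMDiff 𝓘(ℝ, EM) 𝓘(ℝ, EM) ∞ (fun m : S.M => g • m))
    (g : G) (m : S.M) (v : EM) :
    tderiv 𝓘(ℝ, EM) 𝓘(ℝ, E) S.proj (g • m) (S.tsmul g m v) =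
      tderiv 𝓘(ℝ, E) 𝓘(ℝ, E) (fun q : Q => g • q) (S.proj m)
        (tderiv 𝓘(ℝ, EM) 𝓘(ℝ, E) S.proj m v) := by
  have hτ := (S.contMDiff_proj hι).mdifferentiable (by simp)
  have h1 := (hτ (g • m)).hasMFDerivAt.comp m
    ((hg g).mdifferentiable (by simp) m).hasMFDerivAt
  have h2 := (mdifferentiableAt_smul (IsSymmetric.contMDiff_smul (S := S) (G := G)) g
    (S.proj m)).hasMFDerivAt.comp m (hτ m).hasMFDerivAt
  exact DFunLike.congr_fun (h1.mfderiv.symm.trans h2.mfderiv) v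

theorem tsmul_inv_comp
    (hg : ∀ g : G, ContMDiff 𝓘(ℝ, EM) 𝓘(ℝ, EM) ∞ (fun m : S.M => g • m))
    (g : G) (m : S.M) :
    S.tsmul g⁻¹ (g • m) ∘L S.tsmul g m = ContinuousLinearMap.id ℝ EM := by
  have h1 := ((hg g⁻¹).mdifferentiable (by simp)
    (g • m)).hasMFDerivAt.comp m
    ((hg g).mdifferentiable (by simp) m).hasMFDerivAt
  have e : (fun m : S.M => g⁻¹ • m) ∘ (fun m : S.M => g • m) = id := by
    funext m; simp
  rw [e] at h1
  exact h1.mfderiv.symm.trans mfderiv_id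

theorem tsmul_comp_inv
    (hg : ∀ g : G, ContMDiff 𝓘(ℝ, EM) 𝓘(ℝ, EM) ∞ (fun m : S.M => g • m))
    (g : G) (m : S.M) :
    S.tsmul g m ∘L S.tsmul g⁻¹ (g • m) = ContinuousLinearMap.id ℝ EM := by
  have h := S.tsmul_inv_comp hg g⁻¹ (g • m)
  rwa [inv_inv, inv_smul_smul] at h

/-- The lift composes the covector with the inverse of Tg, while the projected tangent vector is
moved by Tg; the two cancel. -/
theorem liouville_tsmul
    (hι : ContMDiff 𝓘(ℝ, EM) (cotangentModel E) ∞ S.incl)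
    (hg : ∀ g : G, ContMDiff 𝓘(ℝ, EM) 𝓘(ℝ, EM) ∞ (fun m : S.M => g • m))
    (g : G) (m : S.M) (v : EM) :
    (S.liouville (g • m) : EM [⋀^Fin 1]→L[ℝ] ℝ) (![S.tsmul g m v] : Fin 1 → EM) =
      (S.liouville m : EM [⋀^Fin 1]→L[ℝ] ℝ) ![v] := by
  refine (S.liouville_apply hι (g • m) _).trans
    (Eq.trans ?_ (S.liouville_apply hι m v).symm)
  rw [S.tderiv_proj_tsmul hι hg]
  have hi := mfderiv_smul_isInvertible (IsSymmetric.contMDiff_smul (S := S) (G := G)) g (S.proj m)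
  have h : (mfderiv 𝓘(ℝ, E) 𝓘(ℝ, E) (fun q : Q => g • q) (S.proj m)).inverse
      (mfderiv 𝓘(ℝ, E) 𝓘(ℝ, E) (fun q : Q => g • q) (S.proj m)
        (tderiv 𝓘(ℝ, EM) 𝓘(ℝ, E) S.proj m v)) = tderiv 𝓘(ℝ, EM) 𝓘(ℝ, E) S.proj m v :=
    hi.inverse_apply_eq.mpr rfl
  exact congrArg (show E →L[ℝ] ℝ from (S.incl m).2) h

theorem pullForm_liouville
    (hι : ContMDiff 𝓘(ℝ, EM) (cotangentModel E) ∞ S.incl)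
    (hg : ∀ g : G, ContMDiff 𝓘(ℝ, EM) 𝓘(ℝ, EM) ∞ (fun m : S.M => g • m))
    (g : G) :
    pullForm 𝓘(ℝ, EM) 𝓘(ℝ, EM) (fun m : S.M => g • m) S.liouville = S.liouville (EM := EM) := by
  funext m
  ext v
  obtain ⟨a, rfl⟩ : ∃ a : EM, v = (![a] : Fin 1 → EM) := ⟨_, vec_one_eta (V := EM) v⟩
  exact (congrArg (S.liouville (g • m) : EM [⋀^Fin 1]→L[ℝ] ℝ)
    (comp_vec_one (S.tsmul g m) a)).trans (S.liouville_tsmul hι hg g m a)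

theorem pullForm_twoForm
    [IsManifold 𝓘(ℝ, EM) ∞ S.M]
    (hι : ContMDiff 𝓘(ℝ, EM) (cotangentModel E) ∞ S.incl)
    (hg : ∀ g : G, ContMDiff 𝓘(ℝ, EM) 𝓘(ℝ, EM) ∞ (fun m : S.M => g • m))
    (g : G) :
    pullForm 𝓘(ℝ, EM) 𝓘(ℝ, EM) (fun m : S.M => g • m) S.twoForm = S.twoForm (EM := EM) := by
  funext m
  have h := mextDeriv_pullForm S.liouville (hg g m)
    ((S.contDiffAt_formInChart_liouville hι (mem_extChartAt_target _)).differentiableAt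
      (by simp))
  rw [S.pullForm_liouville hι hg] at h
  rw [S.twoForm_eq_neg_mextDeriv hι m, h]
  unfold pullForm
  rw [S.twoForm_eq_neg_mextDeriv hι (g • m)]
  rfl

theorem twoForm_tsmul
    [IsManifold 𝓘(ℝ, EM) ∞ S.M]
    (hι : ContMDiff 𝓘(ℝ, EM) (cotangentModel E) ∞ S.incl)
    (hg : ∀ g : G, ContMDiff 𝓘(ℝ, EM) 𝓘(ℝ, EM) ∞ (fun m : S.M => g • m))
    (g : G) (m : S.M) (v w : EM) :
    (S.twoForm (g • m) : EM [⋀^Fin 2]→L[ℝ] ℝ) (![S.tsmul g m v, S.tsmul g m w] : Fin 2 → EM) =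
      (S.twoForm m : EM [⋀^Fin 2]→L[ℝ] ℝ) ![v, w] := by
  refine Eq.trans ?_ (congrArg (fun σ => (σ m : EM [⋀^Fin 2]→L[ℝ] ℝ) ![v, w])
    (S.pullForm_twoForm hι hg g))
  rw [← comp_vec_two (S.tsmul g m)]
  rfl

theorem tsmul_mem_constraintDist
    (hι : ContMDiff 𝓘(ℝ, EM) (cotangentModel E) ∞ S.incl)
    (hg : ∀ g : G, ContMDiff 𝓘(ℝ, EM) 𝓘(ℝ, EM) ∞ (fun m : S.M => g • m))
    (g : G) (m : S.M) {v : EM}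
    (hv : v ∈ (show Submodule ℝ EM from S.constraintDist m)) :
    S.tsmul g m v ∈ (show Submodule ℝ EM from S.constraintDist (g • m)) := by
  refine (S.mem_constraintDist (EM := EM) _ _).2 ?_
  rw [S.tderiv_proj_tsmul hι hg]
  exact hS.constraint_smul g ⟨S.proj m, tderiv 𝓘(ℝ, EM) 𝓘(ℝ, E) S.proj m v⟩
    ((S.mem_constraintDist (EM := EM) m v).1 hv)

end Maps

section Equivariance

variable [FiniteDimensional ℝ E] [FiniteDimensional ℝ EM] [IsManifold 𝓘(ℝ, EM) ∞ S.M]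
  {G : Type*} [Group G] [MulAction G Q] [hS : S.IsSymmetric G]

/-- The gauge transformed bivector field of an invariant 2-form is invariant. -/
theorem gaugeBivector_smul
    (hι : Manifold.IsSmoothEmbedding 𝓘(ℝ, EM) (cotangentModel E) ∞ S.incl)
    (hg : ∀ g : G, ContMDiff 𝓘(ℝ, EM) 𝓘(ℝ, EM) ∞ (fun m : S.M => g • m))
    {B : ∀ m : S.M, TangentSpace 𝓘(ℝ, EM) m [⋀^Fin 2]→L[ℝ] ℝ}
    (hB : S.IsGauge B) (hBi : S.IsInvariantForm G B) (g : G) (m : S.M) (β : EM →L[ℝ] ℝ) :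
    (show (EM →L[ℝ] ℝ) →L[ℝ] EM from S.gaugeBivector B (g • m)) β =
      S.tsmul g m ((show (EM →L[ℝ] ℝ) →L[ℝ] EM from S.gaugeBivector B m) (β ∘L S.tsmul g m)) := by
  obtain ⟨h1, h2⟩ := isSharp_gaugeBivector hι hB m (β ∘L S.tsmul g m)
  set X : EM := (show (EM →L[ℝ] ℝ) →L[ℝ] EM from S.gaugeBivector B m) (β ∘L S.tsmul g m) with hX
  -- By uniqueness it suffices that the transported vector solves the equations at `g • m`. Test
  -- vectors in 𝓒 there are moved back to `m` by `g⁻¹`, where the invariance of Ω and of B applies.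
  refine (isSharp_gaugeBivector hι hB (g • m)).eq_of (nondegenerateOn_twoForm_sub hι hB (g • m))
    (S.tsmul_mem_constraintDist hι.contMDiff hg g m h1) fun w hw => ?_
  have hw' := S.tsmul_mem_constraintDist hι.contMDiff hg g⁻¹ (g • m) hw
  set v : EM := S.tsmul g⁻¹ (g • m) w with hv
  have hvw : S.tsmul g m v = w := DFunLike.congr_fun (S.tsmul_comp_inv hg g m) w
  rw [inv_smul_smul] at hw'
  have hBt : (B (g • m) : EM [⋀^Fin 2]→L[ℝ] ℝ) (![S.tsmul g m X, S.tsmul g m v] : Fin 2 → EM) =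
      (B m : EM [⋀^Fin 2]→L[ℝ] ℝ) ![X, v] :=
    (congrArg (B (g • m) : EM [⋀^Fin 2]→L[ℝ] ℝ) (comp_vec_two (S.tsmul g m) X v)).symm.trans
      (DFunLike.congr_fun (hBi g m) (![X, v] : Fin 2 → EM))
  have hΩ := S.twoForm_tsmul hι.contMDiff hg g m X v
  have h3 : (S.twoForm m : EM [⋀^Fin 2]→L[ℝ] ℝ) ![X, v] - (B m : EM [⋀^Fin 2]→L[ℝ] ℝ) ![X, v] =
      -β (S.tsmul g m v) := h2 v hw'
  rw [hvw] at hBt hΩ h3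
  refine Eq.trans ?_ h3
  rw [← hBt, ← hΩ]
  rfl

end Equivariance

/-! ### Infinitesimal freeness of the action. -/

section LieGroup

variable [IsManifold 𝓘(ℝ, EM) ∞ S.M]

theorem contMDiff_smul_const (EG : Type*) [NormedAddCommGroup EG] [NormedSpace ℝ EG]
    {G : Type*} [TopologicalSpace G] [ChartedSpace EG G] [Group G] [LieGroup 𝓘(ℝ, EG) ∞ G]
    [MulAction G Q] [ContMDiffSMul 𝓘(ℝ, EG) 𝓘(ℝ, E) ∞ G Q] [S.IsSymmetric G]
    (hι : Manifold.IsSmoothEmbedding 𝓘(ℝ, EM) (cotangentModel E) ∞ S.incl) (g : G) :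
    ContMDiff 𝓘(ℝ, EM) 𝓘(ℝ, EM) ∞ (fun m : S.M => g • m) :=
  (S.contMDiff_smul_M (EG := EG) (G := G) hι).comp (contMDiff_const.prodMk contMDiff_id)

variable {EG : Type*} [NormedAddCommGroup EG] [NormedSpace ℝ EG]
  {G : Type*} [TopologicalSpace G] [ChartedSpace EG G] [Group G] [LieGroup 𝓘(ℝ, EG) ∞ G]
  [MulAction G Q] [ContMDiffSMul 𝓘(ℝ, EG) 𝓘(ℝ, E) ∞ G Q] [hS : S.IsSymmetric G]

theorem contMDiff_orbitMap
    (hι : Manifold.IsSmoothEmbedding 𝓘(ℝ, EM) (cotangentModel E) ∞ S.incl) (m : S.M) :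
    ContMDiff 𝓘(ℝ, EG) 𝓘(ℝ, EM) ∞ (fun g : G => g • m) :=
  (S.contMDiff_smul_M (EG := EG) (G := G) hι).comp (contMDiff_id.prodMk contMDiff_const)

/-- A free action is infinitesimally free. -/
theorem infAction_injective [FiniteDimensional ℝ EG] [IsCancelSMul G Q]
    (hι : Manifold.IsSmoothEmbedding 𝓘(ℝ, EM) (cotangentModel E) ∞ S.incl) (m : S.M) :
    Function.Injective (S.infAction EM EG G m) := by
  have : CompleteSpace EG := FiniteDimensional.complete ℝ EG
  have : IsManifold 𝓘(ℝ, EG) ∞ G := LieGroup.toContMDiffMul.toIsManifold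
  have : IsManifold 𝓘(ℝ, EG) 1 G := .of_le (n := ∞) (by simp)
  have : IsManifold 𝓘(ℝ, EM) 1 S.M := .of_le (n := ∞) (by simp)
  have : LieGroup 𝓘(ℝ, EG) (minSmoothness ℝ 3) G := .of_le (n := ∞) (by
    simpa using WithTop.coe_le_coe.2 (le_top : (3 : ℕ∞) ≤ ⊤))
  rw [injective_iff_map_eq_zero]
  intro ξ hξ
  set o : G → S.M := fun g => g • m with ho
  have hos := S.contMDiff_orbitMap (EG := EG) (G := G) hι m
  have hod := hos.mdifferentiable (by simp)
  -- The orbit map intertwines left translation by `h` with the action of `h`. If ξ generates zero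
  -- at `m`, the derivative of the orbit map therefore kills the left-invariant field of ξ at every
  -- point.
  have hzero : ∀ h : G, mfderiv 𝓘(ℝ, EG) 𝓘(ℝ, EM) o h
      (mulInvariantVectorField (I := 𝓘(ℝ, EG)) ξ h) = 0 := by
    intro h
    have h1 : MDifferentiableAt 𝓘(ℝ, EG) 𝓘(ℝ, EG) (h * ·) (1 : G) :=
      (contMDiff_mul_left (I := 𝓘(ℝ, EG)) (n := ∞)).mdifferentiableAt (by simp)
    have h2 : HasMFDerivAt 𝓘(ℝ, EG) 𝓘(ℝ, EM) o (h * 1) (mfderiv 𝓘(ℝ, EG) 𝓘(ℝ, EM) o (h * 1)) :=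
      (hod _).hasMFDerivAt
    have h3 := HasMFDerivAt.comp (1 : G) h2 h1.hasMFDerivAt
    have h4 := ((S.contMDiff_smul_const EG hι h).mdifferentiable (by simp) (o 1)).hasMFDerivAt.comp
      (1 : G) (hod 1).hasMFDerivAt
    have e : (fun m : S.M => h • m) ∘ o = o ∘ (h * ·) := by
      funext g; simp [ho, mul_smul]
    rw [e] at h4
    have h5 := DFunLike.congr_fun (h3.mfderiv.symm.trans h4.mfderiv) ξ
    have h6 : tderiv 𝓘(ℝ, EG) 𝓘(ℝ, EM) o (h * 1) (mulInvariantVectorField (I := 𝓘(ℝ, EG)) ξ h) = 0 :=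
      h5.trans ((congrArg (S.tsmul (EM := EM) h (o 1)) (show (tderiv 𝓘(ℝ, EG) 𝓘(ℝ, EM) o 1) ξ = 0
        from hξ)).trans (map_zero (S.tsmul (EM := EM) h (o 1))))
    rw [mul_one] at h6
    exact h6
  -- A local integral curve suffices; no exponential map is used. The orbit map is constant along
  -- it, so freeness makes the curve constant and its velocity ξ at time zero vanishes.
  obtain ⟨γ, hγ₀, hγ⟩ := exists_isMIntegralCurveAt_of_contMDiffAt_boundaryless (I := 𝓘(ℝ, EG))
    (v := mulInvariantVectorField (I := 𝓘(ℝ, EG)) ξ) (x₀ := (1 : G)) 0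
    ((contMDiff_mulInvariantVectorField (I := 𝓘(ℝ, EG)) ξ).of_le (by simp) 1)
  have hγc : ContinuousAt γ 0 := hγ.self_of_nhds.continuousAt
  have hsrc : ∀ᶠ t in 𝓝 (0 : ℝ), o (γ t) ∈ (chartAt EM m).source := by
    have h1 : ContinuousAt (fun t => o (γ t)) 0 :=
      ContinuousAt.comp (g := o) hos.continuous.continuousAt hγc
    refine h1 ((chartAt EM m).open_source.mem_nhds ?_)
    simp only [ho, hγ₀, one_smul]
    exact mem_chart_source EM m
  obtain ⟨ε, hε, hball⟩ := Metric.eventually_nhds_iff_ball.1 (hγ.and hsrc)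
  have hd : ∀ t ∈ Metric.ball (0 : ℝ) ε,
      HasFDerivAt (fun t => extChartAt 𝓘(ℝ, EM) m (o (γ t))) (0 : ℝ →L[ℝ] EM) t := by
    intro t ht
    obtain ⟨h1, h2⟩ := hball t ht
    have h3 := (hod (γ t)).hasMFDerivAt.comp t h1
    have h4 := ((mdifferentiableAt_extChartAt (I := 𝓘(ℝ, EM)) h2).hasMFDerivAt.comp t h3).hasFDerivAt
    refine h4.congr_fderiv (ContinuousLinearMap.ext_ring ?_)
    have h5 := congrArg (mfderiv 𝓘(ℝ, EM) 𝓘(ℝ, EM) (extChartAt 𝓘(ℝ, EM) m) (o (γ t))) (hzero (γ t))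
    rw [map_zero] at h5
    refine Eq.trans ?_ h5
    refine congrArg (tderiv 𝓘(ℝ, EM) 𝓘(ℝ, EM) (extChartAt 𝓘(ℝ, EM) m) (o (γ t)))
      (congrArg (tderiv 𝓘(ℝ, EG) 𝓘(ℝ, EM) o (γ t)) (one_smul ℝ _))
  have hconst : ∀ t ∈ Metric.ball (0 : ℝ) ε, γ t = 1 := by
    intro t ht
    have h1 := Metric.isOpen_ball.is_const_of_fderiv_eq_zero (𝕜 := ℝ)
      (convex_ball (0 : ℝ) ε).isPreconnected
      (fun t ht => (hd t ht).differentiableAt.differentiableWithinAt)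
      (fun t ht => (hd t ht).fderiv) ht (Metric.mem_ball_self hε)
    have h2 := (chartAt EM m).injOn (hball t ht).2 (hball 0 (Metric.mem_ball_self hε)).2 h1
    simp only [ho, hγ₀, one_smul] at h2
    -- Freeness is assumed on Q; projecting from 𝓜 transfers it.
    have h3 : γ t • S.proj m = (1 : G) • S.proj m := by
      rw [one_smul]
      exact congrArg S.proj h2
    exact IsCancelSMul.right_cancel _ _ _ h3
  have hev : γ =ᶠ[𝓝 0] fun _ => 1 := by
    filter_upwards [Metric.ball_mem_nhds (0 : ℝ) hε] with t ht
    exact hconst t ht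
  have h1 := hγ.self_of_nhds.mfderiv
  rw [hev.mfderiv_eq, mfderiv_const] at h1
  have h2 := DFunLike.congr_fun h1 (1 : ℝ)
  have h3 : (0 : EG) = mulInvariantVectorField (I := 𝓘(ℝ, EG)) ξ (γ 0) := by
    exact h2.trans (one_smul ℝ _)
  rw [hγ₀] at h3
  have h4 : mulInvariantVectorField (I := 𝓘(ℝ, EG)) ξ (1 : G) = ξ := by
    unfold mulInvariantVectorField
    have : (fun a : G => 1 * a) = id := by funext a; simp
    rw [this, mfderiv_id]
    rfl
  exact h4.symm.trans h3.symm

end LieGroup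

end NonholonomicSystem

/-! ### The action in charts, the momentum equation and the connection form. -/

namespace NonholonomicSystem

section ActionCharts

variable {E : Type*} [NormedAddCommGroup E] [NormedSpace ℝ E]
  {Q : Type*} [TopologicalSpace Q] [ChartedSpace E Q] [IsManifold 𝓘(ℝ, E) ∞ Q]
  (S : NonholonomicSystem E Q)
  {EM : Type*} [NormedAddCommGroup EM] [NormedSpace ℝ EM]
  [ChartedSpace EM S.M] [IsManifold 𝓘(ℝ, EM) ∞ S.M]
  (EG : Type*) [NormedAddCommGroup EG] [NormedSpace ℝ EG]
  (G : Type*) [TopologicalSpace G] [ChartedSpace EG G] [Group G] [LieGroup 𝓘(ℝ, EG) ∞ G]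
  [MulAction G Q] [ContMDiffSMul 𝓘(ℝ, EG) 𝓘(ℝ, E) ∞ G Q] [hS : S.IsSymmetric G]

/-- The action on the constraint submanifold in the preferred charts at `1` and `m`. -/
def smulInChart (m : S.M) : EG × EM → EM :=
  localExpr (𝓘(ℝ, EG).prod 𝓘(ℝ, EM)) 𝓘(ℝ, EM) (fun x : G × S.M => x.1 • x.2) (1, m) m

/-- The infinitesimal action in the preferred chart at `m`. -/
def infActionInChart (m : S.M) (z : EM) : EG →L[ℝ] EM :=
  fderiv ℝ (S.smulInChart EG G m) (extChartAt 𝓘(ℝ, EG) (1 : G) 1, z) ∘L .inl ℝ EG EM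

variable {EG G}

theorem eventually_smul_mem_source
    (hι : Manifold.IsSmoothEmbedding 𝓘(ℝ, EM) (cotangentModel E) ∞ S.incl) (m : S.M) :
    ∀ᶠ w in 𝓝 (extChartAt 𝓘(ℝ, EG) (1 : G) 1, extChartAt 𝓘(ℝ, EM) m m),
      w.1 ∈ (extChartAt 𝓘(ℝ, EG) (1 : G)).target ∧ w.2 ∈ (extChartAt 𝓘(ℝ, EM) m).target ∧
        (extChartAt 𝓘(ℝ, EG) (1 : G)).symm w.1 • (extChartAt 𝓘(ℝ, EM) m).symm w.2 ∈
          (extChartAt 𝓘(ℝ, EM) m).source := by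
  have : IsManifold 𝓘(ℝ, EG) ∞ G := LieGroup.toContMDiffMul.toIsManifold
  have h1 := chart_mem_nhds (mem_extChartAt_target (I := 𝓘(ℝ, EG)) (1 : G))
  have h2 := chart_mem_nhds (mem_extChartAt_target (I := 𝓘(ℝ, EM)) m)
  have hs := (S.contMDiff_smul_M (EG := EG) (G := G) hι).continuous
  have h3 : ContinuousAt (fun w : EG × EM => (extChartAt 𝓘(ℝ, EG) (1 : G)).symm w.1 •
      (extChartAt 𝓘(ℝ, EM) m).symm w.2)
      (extChartAt 𝓘(ℝ, EG) (1 : G) 1, extChartAt 𝓘(ℝ, EM) m m) := by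
    refine ContinuousAt.comp (g := fun x : G × S.M => x.1 • x.2) hs.continuousAt
      (ContinuousAt.prodMk ?_ ?_)
    · exact ContinuousAt.comp (g := (extChartAt 𝓘(ℝ, EG) (1 : G)).symm) (f := Prod.fst)
        (continuousAt_extChartAt_symm'' (mem_extChartAt_target (1 : G))) continuousAt_fst
    · exact ContinuousAt.comp (g := (extChartAt 𝓘(ℝ, EM) m).symm) (f := Prod.snd)
        (continuousAt_extChartAt_symm'' (mem_extChartAt_target m)) continuousAt_snd
  have h4 := h3.eventually ((isOpen_extChartAt_source (I := 𝓘(ℝ, EM)) m).mem_nhds (by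
    simp only [extChartAt_to_inv, one_smul]
    exact mem_extChartAt_source m))
  filter_upwards [continuousAt_fst h1, continuousAt_snd h2, h4] with w w1 w2 w3
  exact ⟨w1, w2, w3⟩

theorem contDiffAt_smulInChart
    (hι : Manifold.IsSmoothEmbedding 𝓘(ℝ, EM) (cotangentModel E) ∞ S.incl) (m : S.M) {z : EM}
    (hz : z ∈ (extChartAt 𝓘(ℝ, EM) m).target) :
    ContDiffAt ℝ ∞ (S.smulInChart EG G m) (extChartAt 𝓘(ℝ, EG) (1 : G) 1, z) := by
  have : IsManifold 𝓘(ℝ, EG) ∞ G := LieGroup.toContMDiffMul.toIsManifold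
  refine contDiffAt_localExpr_prod (mem_extChartAt_target _) hz (S.contMDiff_smul_M hι) ?_
  rw [extChartAt_to_inv, one_smul]
  exact (extChartAt 𝓘(ℝ, EM) m).map_target hz

theorem contDiffAt_infActionInChart
    (hι : Manifold.IsSmoothEmbedding 𝓘(ℝ, EM) (cotangentModel E) ∞ S.incl) (m : S.M) {z : EM}
    (hz : z ∈ (extChartAt 𝓘(ℝ, EM) m).target) :
    ContDiffAt ℝ ∞ (S.infActionInChart EG G m) z := by
  have h := (S.contDiffAt_smulInChart (EG := EG) (G := G) hι m hz).fderiv_right (m := ∞) le_rfl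
  have h2 : ContDiffAt ℝ ∞ (fun z => fderiv ℝ (S.smulInChart EG G m)
      (extChartAt 𝓘(ℝ, EG) (1 : G) 1, z)) z :=
    ContDiffAt.comp (g := fderiv ℝ (S.smulInChart EG G m)) z h
      (contDiffAt_const.prodMk contDiffAt_id)
  exact h2.clm_comp contDiffAt_const

theorem smulInChart_one (m : S.M) {z : EM} (hz : z ∈ (extChartAt 𝓘(ℝ, EM) m).target) :
    S.smulInChart EG G m (extChartAt 𝓘(ℝ, EG) (1 : G) 1, z) = z := by
  refine (localExpr_prod_apply _ _).trans ?_
  rw [extChartAt_to_inv, one_smul]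
  exact (extChartAt 𝓘(ℝ, EM) m).right_inv hz

/-- The partial derivative of the action at the identity of G represents the generators at all
nearby points in a single chart, so they vary smoothly with the point. -/
theorem chartInv_infActionInChart
    (hι : Manifold.IsSmoothEmbedding 𝓘(ℝ, EM) (cotangentModel E) ∞ S.incl) (m : S.M) {z : EM}
    (hz : z ∈ (extChartAt 𝓘(ℝ, EM) m).target) :
    chartInv 𝓘(ℝ, EM) m z ∘L S.infActionInChart EG G m z =
      (S.infAction EM EG G ((extChartAt 𝓘(ℝ, EM) m).symm z) : EG →L[ℝ] EM) := by
  have : IsManifold 𝓘(ℝ, EG) ∞ G := LieGroup.toContMDiffMul.toIsManifold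
  have : IsManifold 𝓘(ℝ, EG) 1 G := .of_le (n := ∞) (by simp)
  have : IsManifold 𝓘(ℝ, EM) 1 S.M := .of_le (n := ∞) (by simp)
  have hmem : (extChartAt 𝓘(ℝ, EG) (1 : G)).symm (extChartAt 𝓘(ℝ, EG) (1 : G) 1) •
      (extChartAt 𝓘(ℝ, EM) m).symm z ∈ (extChartAt 𝓘(ℝ, EM) m).source := by
    rw [extChartAt_to_inv, one_smul]
    exact (extChartAt 𝓘(ℝ, EM) m).map_target hz
  have h1 := fderiv_localExpr_prod_left (y₀ := m) (mem_extChartAt_target (I := 𝓘(ℝ, EG)) (1 : G))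
    hz (S.contMDiff_smul_M hι) hmem
  have h2 := tderiv_comp_chartInv (y₀ := m) (f := fun g : G => g • (extChartAt 𝓘(ℝ, EM) m).symm z)
    (mem_extChartAt_target (I := 𝓘(ℝ, EG)) (1 : G))
    ((S.contMDiff_orbitMap (EG := EG) (G := G) hι _).mdifferentiable (by simp) _) hmem
  have h3 : localExpr 𝓘(ℝ, EG) 𝓘(ℝ, EM) (fun g : G => g • (extChartAt 𝓘(ℝ, EM) m).symm z) 1 m
      (extChartAt 𝓘(ℝ, EG) (1 : G) 1) = z := by
    simp only [localExpr, Function.comp_apply, extChartAt_to_inv, one_smul]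
    exact (extChartAt 𝓘(ℝ, EM) m).right_inv hz
  rw [h3, h1, extChartAt_to_inv, chartInv_self, ContinuousLinearMap.comp_id] at h2
  exact h2.symm

theorem infActionInChart_self
    (hι : Manifold.IsSmoothEmbedding 𝓘(ℝ, EM) (cotangentModel E) ∞ S.incl) (m : S.M) :
    S.infActionInChart EG G m (extChartAt 𝓘(ℝ, EM) m m) =
      (S.infAction EM EG G m : EG →L[ℝ] EM) := by
  have h := S.chartInv_infActionInChart (EG := EG) (G := G) hι m (mem_extChartAt_target m)
  rw [chartInv_self, ContinuousLinearMap.id_comp, extChartAt_to_inv] at h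
  exact h

theorem formInChart_liouville_smulInChart
    (hι : Manifold.IsSmoothEmbedding 𝓘(ℝ, EM) (cotangentModel E) ∞ S.incl) (m : S.M) :
    ∀ᶠ w in 𝓝 (extChartAt 𝓘(ℝ, EG) (1 : G) 1, extChartAt 𝓘(ℝ, EM) m m), ∀ v : EM,
      formInChart 𝓘(ℝ, EM) S.liouville m (S.smulInChart EG G m w)
          ![fderiv ℝ (S.smulInChart EG G m) w (0, v)] =
        formInChart 𝓘(ℝ, EM) S.liouville m w.2 ![v] := by
  have : IsManifold 𝓘(ℝ, EG) ∞ G := LieGroup.toContMDiffMul.toIsManifold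
  have : IsManifold 𝓘(ℝ, EG) 1 G := .of_le (n := ∞) (by simp)
  have : IsManifold 𝓘(ℝ, EM) 1 S.M := .of_le (n := ∞) (by simp)
  filter_upwards [S.eventually_smul_mem_source (EG := EG) (G := G) hι m] with w hw v
  obtain ⟨t, z⟩ := w
  obtain ⟨ht, hz, hs⟩ := hw
  have hg := S.contMDiff_smul_const EG hι (G := G)
  set g := (extChartAt 𝓘(ℝ, EG) (1 : G)).symm t with hgdef
  have h1 := fderiv_localExpr_prod_right (y₀ := m) ht hz (S.contMDiff_smul_M hι) hs
  have h2 := formInChart_pullForm S.liouville (f := fun x : S.M => g • x) (y₀ := m) hz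
    ((hg g).mdifferentiable (by simp) _) hs
  rw [S.pullForm_liouville hι.contMDiff hg g, h1] at h2
  have h3 := DFunLike.congr_fun h2 (![v] : Fin 1 → EM)
  refine Eq.trans ?_ h3.symm
  rw [ContinuousAlternatingMap.compContinuousLinearMap_apply]
  refine congrArg _ ?_
  funext i; fin_cases i; rfl

theorem momentum_apply (m : S.M) (ξ : EG) :
    S.momentum EM EG G m ξ =
      (S.liouville m : EM [⋀^Fin 1]→L[ℝ] ℝ) ![(S.infAction EM EG G m : EG →L[ℝ] EM) ξ] := by
  have h : S.momentum EM EG G m ξ =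
    (S.liouville m : EM [⋀^Fin 1]→L[ℝ] ℝ) (fun _ => (S.infAction EM EG G m : EG →L[ℝ] EM) ξ) := rfl
  rw [h, vec_one_eta (fun _ => _)]

theorem momentum_chart_symm
    (hι : Manifold.IsSmoothEmbedding 𝓘(ℝ, EM) (cotangentModel E) ∞ S.incl) (m : S.M) {z : EM}
    (hz : z ∈ (extChartAt 𝓘(ℝ, EM) m).target) (ξ : EG) :
    S.momentum EM EG G ((extChartAt 𝓘(ℝ, EM) m).symm z) ξ =
      formInChart 𝓘(ℝ, EM) S.liouville m z ![S.infActionInChart EG G m z ξ] := by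
  rw [formInChart_apply_one]
  refine (S.momentum_apply _ ξ).trans (congrArg _ ?_)
  rw [← S.chartInv_infActionInChart hι m hz]
  rfl

/-- The momentum map in the preferred chart at `m`. -/
def momentumInChart (EG G) [NormedAddCommGroup EG] [NormedSpace ℝ EG]
    [TopologicalSpace G] [ChartedSpace EG G] [Group G] [LieGroup 𝓘(ℝ, EG) ∞ G]
    [MulAction G Q] [ContMDiffSMul 𝓘(ℝ, EG) 𝓘(ℝ, E) ∞ G Q] [S.IsSymmetric G]
    (m : S.M) (z : EM) : EG →L[ℝ] ℝ :=
  (((ContinuousAlternatingMap.ofSubsingletonLIE (𝕜 := ℝ) (E := EM) (F := ℝ)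
    (0 : Fin 1)).symm.toContinuousLinearEquiv : (EM [⋀^Fin 1]→L[ℝ] ℝ) →L[ℝ] (EM →L[ℝ] ℝ))
    (formInChart 𝓘(ℝ, EM) S.liouville m z)) ∘L S.infActionInChart EG G m z

theorem momentumInChart_apply (m : S.M) (z : EM) (ξ : EG) :
    S.momentumInChart EG G m z ξ =
      formInChart 𝓘(ℝ, EM) S.liouville m z ![S.infActionInChart EG G m z ξ] := by
  have h : S.momentumInChart EG G m z ξ =
    formInChart 𝓘(ℝ, EM) S.liouville m z (fun _ => S.infActionInChart EG G m z ξ) := rfl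
  rw [h, vec_one_eta (fun _ => _)]

theorem contDiffAt_momentumInChart
    (hι : Manifold.IsSmoothEmbedding 𝓘(ℝ, EM) (cotangentModel E) ∞ S.incl) (m : S.M) {z : EM}
    (hz : z ∈ (extChartAt 𝓘(ℝ, EM) m).target) :
    ContDiffAt ℝ ∞ (S.momentumInChart EG G m) z := by
  refine ContDiffAt.clm_comp ?_ (S.contDiffAt_infActionInChart hι m hz)
  exact (ContinuousLinearMap.contDiff _).contDiffAt.comp z
    (S.contDiffAt_formInChart_liouville hι.contMDiff hz)

theorem tderiv_momentum
    (hι : Manifold.IsSmoothEmbedding 𝓘(ℝ, EM) (cotangentModel E) ∞ S.incl) (m : S.M) :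
    tderiv 𝓘(ℝ, EM) 𝓘(ℝ, EG →L[ℝ] ℝ) (S.momentum EM EG G) m =
      fderiv ℝ (S.momentumInChart EG G m) (extChartAt 𝓘(ℝ, EM) m m) := by
  have : IsManifold 𝓘(ℝ, EM) 1 S.M := .of_le (n := ∞) (by simp)
  have hd := ((S.contDiffAt_momentumInChart (EG := EG) (G := G) hι m
    (mem_extChartAt_target m)).differentiableAt (by simp)).hasFDerivAt.hasMFDerivAt
  have hc := (mdifferentiableAt_extChartAt (I := 𝓘(ℝ, EM)) (mem_chart_source EM m)).hasMFDerivAt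
  have h1 := hd.comp m hc
  have e : S.momentum EM EG G =ᶠ[𝓝 m] S.momentumInChart EG G m ∘ extChartAt 𝓘(ℝ, EM) m := by
    filter_upwards [(isOpen_extChartAt_source (I := 𝓘(ℝ, EM)) m).mem_nhds (mem_extChartAt_source m)]
      with x hx
    ext ξ
    rw [Function.comp_apply, momentumInChart_apply, ← S.momentum_chart_symm hι m
      ((extChartAt 𝓘(ℝ, EM) m).map_source hx), (extChartAt 𝓘(ℝ, EM) m).left_inv hx]
  have h2 : tderiv 𝓘(ℝ, EM) 𝓘(ℝ, EG →L[ℝ] ℝ) (S.momentum EM EG G) m =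
      fderiv ℝ (S.momentumInChart EG G m) (extChartAt 𝓘(ℝ, EM) m m) ∘L chartFwd 𝓘(ℝ, EM) m m :=
    (h1.congr_of_eventuallyEq e).mfderiv
  rw [h2, chartFwd_self, ContinuousLinearMap.comp_id]

/-- The momentum equation `i_ξ Ω = d⟨J, ξ⟩`. -/
theorem twoForm_infAction
    (hι : Manifold.IsSmoothEmbedding 𝓘(ℝ, EM) (cotangentModel E) ∞ S.incl) (m : S.M)
    (ξ : EG) (v : EM) :
    (S.twoForm m : EM [⋀^Fin 2]→L[ℝ] ℝ) ![(S.infAction EM EG G m : EG →L[ℝ] EM) ξ, v] =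
      tderiv 𝓘(ℝ, EM) 𝓘(ℝ, EG →L[ℝ] ℝ) (S.momentum EM EG G) m v ξ := by
  have : IsManifold 𝓘(ℝ, EM) 1 S.M := .of_le (n := ∞) (by simp)
  have hmt := mem_extChartAt_target (I := 𝓘(ℝ, EM)) m
  -- The cotangent lift preserves Θ, so Cartan's formula gives i_ξ dΘ = −d(Θ(ξ_𝓜)), and Ω = −dΘ
  -- reverses the sign.
  have h1 := extDeriv_invariant_apply (S.contDiffAt_smulInChart (EG := EG) (G := G) hι m hmt)
    ((S.contDiffAt_formInChart_liouville hι.contMDiff hmt).differentiableAt (by simp))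
    (by filter_upwards [chart_mem_nhds hmt] with z hz using S.smulInChart_one m hz)
    (S.formInChart_liouville_smulInChart hι m) ξ v
  have h2 := congrArg (fun σ => σ ![(S.infAction EM EG G m : EG →L[ℝ] EM) ξ, v])
    (S.formInChart_twoForm hι.contMDiff hmt)
  have h3 := formInChart_apply_two S.twoForm m (extChartAt 𝓘(ℝ, EM) m m)
    ((S.infAction EM EG G m : EG →L[ℝ] EM) ξ) v
  rw [chartInv_self, extChartAt_to_inv] at h3
  have h4 : fderiv ℝ (S.smulInChart EG G m) (extChartAt 𝓘(ℝ, EG) (1 : G) 1,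
      extChartAt 𝓘(ℝ, EM) m m) (ξ, 0) = (S.infAction EM EG G m : EG →L[ℝ] EM) ξ :=
    DFunLike.congr_fun (S.infActionInChart_self (EG := EG) (G := G) hι m) ξ
  rw [h4] at h1
  refine h3.symm.trans (h2.trans ?_)
  rw [ContinuousAlternatingMap.neg_apply, h1, neg_neg, S.tderiv_momentum hι]
  -- The contraction of Θ with the generator of the fixed ξ is the pairing of J with ξ, so its
  -- derivative is dJ evaluated on ξ.
  have h5 : (fun z => formInChart 𝓘(ℝ, EM) S.liouville m z
      ![fderiv ℝ (S.smulInChart EG G m) (extChartAt 𝓘(ℝ, EG) (1 : G) 1, z) (ξ, 0)]) =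
      fun z => S.momentumInChart EG G m z ξ := by
    funext z
    exact (S.momentumInChart_apply m z ξ).symm
  have hd := ((S.contDiffAt_momentumInChart (EG := EG) (G := G) hι m hmt).differentiableAt
    (by simp)).hasFDerivAt.clm_apply (hasFDerivAt_const ξ _)
  rw [h5, hd.fderiv]
  simp

namespace VerticalComplement

variable {S} [FiniteDimensional ℝ E] [FiniteDimensional ℝ EM] [FiniteDimensional ℝ EG]
  [IsManifold 𝓘(ℝ, EM) 1 S.M] [IsCancelSMul G Q]

theorem infAction_connForm
    (hι : Manifold.IsSmoothEmbedding 𝓘(ℝ, EM) (cotangentModel E) ∞ S.incl)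
    (W : S.VerticalComplement EM EG G) (m : S.M) (v : EM) :
    (S.infAction EM EG G m : EG →L[ℝ] EM) ((W.connForm m : EM [⋀^Fin 1]→L[ℝ] EG) ![v]) =
      W.projW m v :=
  ((W.connForm_iff m (S.infAction_injective hι m) v _).1 rfl).symm

/-- A_𝓦 is given pointwise by a chosen linear left inverse, which carries no smoothness. It is
however the solution of (infinitesimal action) ∘ A_𝓦 = P_𝓦, whose data are smooth and whose left
factor is injective. -/
theorem contDiffAt_formInChart_connForm
    (hι : Manifold.IsSmoothEmbedding 𝓘(ℝ, EM) (cotangentModel E) ∞ S.incl)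
    (W : S.VerticalComplement EM EG G) (m : S.M) :
    ContDiffAt ℝ ∞ (formInChart 𝓘(ℝ, EM) W.connForm m) (extChartAt 𝓘(ℝ, EM) m m) := by
  have hmt := mem_extChartAt_target (I := 𝓘(ℝ, EM)) m
  let e := (ContinuousAlternatingMap.ofSubsingletonLIE (𝕜 := ℝ) (E := EM) (F := EG)
    (0 : Fin 1)).toContinuousLinearEquiv
  have hA : ContDiffAt ℝ ∞ (fun z => e.symm (formInChart 𝓘(ℝ, EM) W.connForm m z))
      (extChartAt 𝓘(ℝ, EM) m m) := by
    refine ContDiffAt.of_injective_comp (S.contDiffAt_infActionInChart (EG := EG) (G := G) hι m hmt)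
      ?_ (W.contDiffAt_projWInChart hι.contMDiff m) ?_
    · rw [S.infActionInChart_self hι]
      exact S.infAction_injective hι m
    · filter_upwards [chart_mem_nhds hmt] with z hz
      ext v
      have h1 : e.symm (formInChart 𝓘(ℝ, EM) W.connForm m z) v =
          (W.connForm ((extChartAt 𝓘(ℝ, EM) m).symm z) : EM [⋀^Fin 1]→L[ℝ] EG)
            ![chartInv 𝓘(ℝ, EM) m z v] := by
        have h : e.symm (formInChart 𝓘(ℝ, EM) W.connForm m z) v =
          formInChart 𝓘(ℝ, EM) W.connForm m z (fun _ => v) := rfl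
        rw [← formInChart_apply_one, h, vec_one_eta (fun _ => _)]
      have h2 := DFunLike.congr_fun (S.chartInv_infActionInChart (EG := EG) (G := G) hι m hz)
        (e.symm (formInChart 𝓘(ℝ, EM) W.connForm m z) v)
      have h3 := (h2.trans (congrArg _ h1)).trans ((W.infAction_connForm hι _ _).trans
        (W.chartInv_projWInChart hz v).symm)
      have h4 := congrArg (chartFwd 𝓘(ℝ, EM) m ((extChartAt 𝓘(ℝ, EM) m).symm z)) h3
      have h5 := fun u => DFunLike.congr_fun (chartFwd_comp_chartInv (I := 𝓘(ℝ, EM)) hz) u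
      exact (h5 _).symm.trans (h4.trans (h5 _))
  have h := e.contDiff.contDiffAt.comp _ hA
  refine h.congr_of_eventuallyEq (Filter.Eventually.of_forall fun z => ?_)
  exact (e.apply_symm_apply _).symm

end VerticalComplement

end ActionCharts

end NonholonomicSystem

/-! ### Tensors evaluated at the centre of a chart. -/

section Centers

variable {E : Type*} [NormedAddCommGroup E] [NormedSpace ℝ E]
  {X : Type*} [TopologicalSpace X] [ChartedSpace E X] [IsManifold 𝓘(ℝ, E) 1 X]
  {F : Type*} [NormedAddCommGroup F] [NormedSpace ℝ F] {n : ℕ}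

theorem formInChart_self (σ : ∀ x : X, TangentSpace 𝓘(ℝ, E) x [⋀^Fin n]→L[ℝ] F) (x : X) :
    formInChart 𝓘(ℝ, E) σ x (extChartAt 𝓘(ℝ, E) x x) = (σ x : E [⋀^Fin n]→L[ℝ] F) := by
  have h := chartInv_self (I := 𝓘(ℝ, E)) x
  ext v
  have e : formInChart 𝓘(ℝ, E) σ x (extChartAt 𝓘(ℝ, E) x x) v =
    (σ ((extChartAt 𝓘(ℝ, E) x).symm (extChartAt 𝓘(ℝ, E) x x)) : E [⋀^Fin n]→L[ℝ] F)
      (fun i => chartInv 𝓘(ℝ, E) x (extChartAt 𝓘(ℝ, E) x x) (v i)) := rfl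
  rw [e, h]
  have key : ∀ x', x' = x →
      (σ x' : E [⋀^Fin n]→L[ℝ] F) v = (σ x : E [⋀^Fin n]→L[ℝ] F) v := by
    rintro _ rfl; rfl
  exact key _ (extChartAt_to_inv x)

theorem bivectorInChart_self (π : SharpField 𝓘(ℝ, E) X) (x : X) :
    bivectorInChart 𝓘(ℝ, E) π x (extChartAt 𝓘(ℝ, E) x x) =
      (show (E →L[ℝ] ℝ) →L[ℝ] E from π x) := by
  have key : ∀ x', x' = x → chartFwd 𝓘(ℝ, E) x x' ∘L
        (show (E →L[ℝ] ℝ) →L[ℝ] E from π x') ∘L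
        ContinuousLinearMap.precomp ℝ (chartFwd 𝓘(ℝ, E) x x') =
      (show (E →L[ℝ] ℝ) →L[ℝ] E from π x) := by
    rintro _ rfl
    rw [chartFwd_self]
    rfl
  exact key _ (extChartAt_to_inv x)

theorem schoutenSelf_eq (π : SharpField 𝓘(ℝ, E) X) (x : X) (a b c : E →L[ℝ] ℝ) :
    schoutenSelf 𝓘(ℝ, E) π x a b c =
      2 * (fderiv ℝ (fun y => c (bivectorInChart 𝓘(ℝ, E) π x y b)) (extChartAt 𝓘(ℝ, E) x x)
          (bivectorInChart 𝓘(ℝ, E) π x (extChartAt 𝓘(ℝ, E) x x) a)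
        + fderiv ℝ (fun y => a (bivectorInChart 𝓘(ℝ, E) π x y c)) (extChartAt 𝓘(ℝ, E) x x)
          (bivectorInChart 𝓘(ℝ, E) π x (extChartAt 𝓘(ℝ, E) x x) b)
        + fderiv ℝ (fun y => b (bivectorInChart 𝓘(ℝ, E) π x y a)) (extChartAt 𝓘(ℝ, E) x x)
          (bivectorInChart 𝓘(ℝ, E) π x (extChartAt 𝓘(ℝ, E) x x) c)) := by
  have h := chartInv_self (I := 𝓘(ℝ, E)) x
  have key : ∀ T : E →L[ℝ] E, T = ContinuousLinearMap.id ℝ E → ∀ a : E →L[ℝ] ℝ,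
      ContinuousLinearMap.precomp ℝ T a = a := by
    rintro _ rfl a; rfl
  have ha := fun a => key _ h a
  unfold chartInv at ha
  unfold schoutenSelf
  simp only [ModelWithCorners.range_eq_univ, fderivWithin_univ] at ha ⊢
  erw [ha a, ha b, ha c]

theorem alternating_three_neg {V : Type*} [NormedAddCommGroup V] [NormedSpace ℝ V]
    (σ : V [⋀^Fin 3]→L[ℝ] F) (u v w : V) : σ ![-u, -v, -w] = -σ ![u, v, w] := by
  have h := σ.map_smul_univ (fun _ : Fin 3 => (-1 : ℝ)) ![u, v, w]
  have e : (fun i => (-1 : ℝ) • (![u, v, w] : Fin 3 → V) i) = ![-u, -v, -w] := by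
    funext i; fin_cases i <;> simp
  rw [e] at h
  rw [h, Finset.prod_const, Finset.card_univ, Fintype.card_fin, Odd.neg_one_pow (by decide),
    neg_one_smul]

end Centers

/-! ### The reduced bivector field on the orbit space. -/

namespace NonholonomicSystem

section Reduction

variable {E : Type*} [NormedAddCommGroup E] [NormedSpace ℝ E]
  {Q : Type*} [TopologicalSpace Q] [ChartedSpace E Q] [IsManifold 𝓘(ℝ, E) ∞ Q]
  (S : NonholonomicSystem E Q)
  {EM : Type*} [NormedAddCommGroup EM] [NormedSpace ℝ EM] [ChartedSpace EM S.M]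
  {G : Type*} [Group G] [MulAction G Q] [S.IsSymmetric G]
  {EN : Type*} [NormedAddCommGroup EN] [NormedSpace ℝ EN] [ChartedSpace EN (S.OrbitSpace G)]

theorem orbitProj_eq_iff {m m' : S.M} : S.orbitProj G m = S.orbitProj G m' ↔ ∃ g : G, g • m' = m :=
  Quotient.eq.trans Iff.rfl

theorem tderiv_orbitProj_tsmul
    (hρ : ContMDiff 𝓘(ℝ, EM) 𝓘(ℝ, EN) ∞ (S.orbitProj G))
    (hg : ∀ g : G, ContMDiff 𝓘(ℝ, EM) 𝓘(ℝ, EM) ∞ (fun m : S.M => g • m)) (g : G) (m : S.M) :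
    tderiv 𝓘(ℝ, EM) 𝓘(ℝ, EN) (S.orbitProj G) (g • m) ∘L S.tsmul g m =
      tderiv 𝓘(ℝ, EM) 𝓘(ℝ, EN) (S.orbitProj G) m := by
  have h := (hρ.mdifferentiable (by simp) (g • m)).hasMFDerivAt.comp m
    ((hg g).mdifferentiable (by simp) m).hasMFDerivAt
  have e : S.orbitProj G ∘ (fun m : S.M => g • m) = S.orbitProj G := by
    funext m
    exact S.orbitProj_eq_iff.2 ⟨g, rfl⟩
  rw [e] at h
  exact h.mfderiv.symm

theorem tderiv_orbitProj_infAction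
    {EG : Type*} [NormedAddCommGroup EG] [NormedSpace ℝ EG]
    [TopologicalSpace G] [ChartedSpace EG G]
    (hρ : ContMDiff 𝓘(ℝ, EM) 𝓘(ℝ, EN) ∞ (S.orbitProj G)) {m : S.M}
    (ho : ContMDiff 𝓘(ℝ, EG) 𝓘(ℝ, EM) ∞ (fun g : G => g • m)) (ξ : EG) :
    tderiv 𝓘(ℝ, EM) 𝓘(ℝ, EN) (S.orbitProj G) m ((S.infAction EM EG G m : EG →L[ℝ] EM) ξ) = 0 := by
  have h := (hρ.mdifferentiable (by simp) ((1 : G) • m)).hasMFDerivAt.comp (1 : G)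
    (ho.mdifferentiable (by simp) 1).hasMFDerivAt
  have e : S.orbitProj G ∘ (fun g : G => g • m) = fun _ => S.orbitProj G m := by
    funext g
    exact S.orbitProj_eq_iff.2 ⟨g, rfl⟩
  rw [e] at h
  have h1 := DFunLike.congr_fun (h.mfderiv.symm.trans mfderiv_const) ξ
  have h2 : tderiv 𝓘(ℝ, EM) 𝓘(ℝ, EN) (S.orbitProj G) ((1 : G) • m)
    ((S.infAction EM EG G m : EG →L[ℝ] EM) ξ) = 0 := h1
  rwa [one_smul] at h2

variable [FiniteDimensional ℝ E] [FiniteDimensional ℝ EM] [IsManifold 𝓘(ℝ, EM) ∞ S.M]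

/-- The reduced bivector field is related to the gauge transformed bivector field by the orbit
projection. -/
theorem reducedBivector_apply
    (hι : Manifold.IsSmoothEmbedding 𝓘(ℝ, EM) (cotangentModel E) ∞ S.incl)
    (hρ : ContMDiff 𝓘(ℝ, EM) 𝓘(ℝ, EN) ∞ (S.orbitProj G))
    (hg : ∀ g : G, ContMDiff 𝓘(ℝ, EM) 𝓘(ℝ, EM) ∞ (fun m : S.M => g • m))
    {B : ∀ m : S.M, TangentSpace 𝓘(ℝ, EM) m [⋀^Fin 2]→L[ℝ] ℝ}
    (hB : S.IsGauge B) (hBi : S.IsInvariantForm G B) (m : S.M) (a : EN →L[ℝ] ℝ) :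
    tderiv 𝓘(ℝ, EM) 𝓘(ℝ, EN) (S.orbitProj G) m
        ((show (EM →L[ℝ] ℝ) →L[ℝ] EM from S.gaugeBivector B m)
          (a ∘L tderiv 𝓘(ℝ, EM) 𝓘(ℝ, EN) (S.orbitProj G) m)) =
      (show (EN →L[ℝ] ℝ) →L[ℝ] EN from
        S.reducedBivector G (S.gaugeBivector B) (S.orbitProj G m)) a := by
  -- Invariance of π_B and of ρ makes the value independent of the point of the orbit, in particular
  -- of the one selected by `Quotient.out`.
  have key : ∀ m', (∃ g : G, g • m = m') →
      tderiv 𝓘(ℝ, EM) 𝓘(ℝ, EN) (S.orbitProj G) m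
        ((show (EM →L[ℝ] ℝ) →L[ℝ] EM from S.gaugeBivector B m)
          (a ∘L tderiv 𝓘(ℝ, EM) 𝓘(ℝ, EN) (S.orbitProj G) m)) =
      tderiv 𝓘(ℝ, EM) 𝓘(ℝ, EN) (S.orbitProj G) m'
        ((show (EM →L[ℝ] ℝ) →L[ℝ] EM from S.gaugeBivector B m')
          (a ∘L tderiv 𝓘(ℝ, EM) 𝓘(ℝ, EN) (S.orbitProj G) m')) := by
    rintro _ ⟨g, rfl⟩
    rw [S.gaugeBivector_smul hι hg hB hBi g m, ContinuousLinearMap.comp_assoc,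
      S.tderiv_orbitProj_tsmul hρ hg]
    exact (DFunLike.congr_fun (S.tderiv_orbitProj_tsmul hρ hg g m) _).symm
  exact key _ (S.orbitProj_eq_iff.1 (Quotient.out_eq (S.orbitProj G m)))

variable [IsManifold 𝓘(ℝ, EN) ∞ (S.OrbitSpace G)]

/-- The relation Tρ π_B ρ^* = π_red in coordinates. It holds along the local expression of ρ on an
open set, so it can be differentiated, unlike the identity at a single point. -/
theorem bivectorInChart_reducedBivector
    (hι : Manifold.IsSmoothEmbedding 𝓘(ℝ, EM) (cotangentModel E) ∞ S.incl)
    (hρ : ContMDiff 𝓘(ℝ, EM) 𝓘(ℝ, EN) ∞ (S.orbitProj G))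
    (hg : ∀ g : G, ContMDiff 𝓘(ℝ, EM) 𝓘(ℝ, EM) ∞ (fun m : S.M => g • m))
    {B : ∀ m : S.M, TangentSpace 𝓘(ℝ, EM) m [⋀^Fin 2]→L[ℝ] ℝ}
    (hB : S.IsGauge B) (hBi : S.IsInvariantForm G B) {m : S.M} {x₀ : S.OrbitSpace G} {z : EM}
    (hz : z ∈ (extChartAt 𝓘(ℝ, EM) m).target)
    (hx : S.orbitProj G ((extChartAt 𝓘(ℝ, EM) m).symm z) ∈ (extChartAt 𝓘(ℝ, EN) x₀).source) :
    bivectorInChart 𝓘(ℝ, EN) (S.reducedBivector G (S.gaugeBivector B)) x₀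
        (localExpr 𝓘(ℝ, EM) 𝓘(ℝ, EN) (S.orbitProj G) m x₀ z) =
      fderiv ℝ (localExpr 𝓘(ℝ, EM) 𝓘(ℝ, EN) (S.orbitProj G) m x₀) z ∘L
        bivectorInChart 𝓘(ℝ, EM) (S.gaugeBivector B) m z ∘L
        ContinuousLinearMap.precomp ℝ
          (fderiv ℝ (localExpr 𝓘(ℝ, EM) 𝓘(ℝ, EN) (S.orbitProj G) m x₀) z) := by
  have : IsManifold 𝓘(ℝ, EM) 1 S.M := .of_le (n := ∞) (by simp)
  have : IsManifold 𝓘(ℝ, EN) 1 (S.OrbitSpace G) := .of_le (n := ∞) (by simp)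
  rw [(hasFDerivAt_localExpr hz (hρ.mdifferentiable (by simp) _) hx).fderiv]
  set m' := (extChartAt 𝓘(ℝ, EM) m).symm z with hm'
  have h1 := fun u => DFunLike.congr_fun (chartInv_comp_chartFwd (I := 𝓘(ℝ, EM)) hz) u
  have key : ∀ y, y = S.orbitProj G m' → ∀ b : EN →L[ℝ] ℝ,
      chartFwd 𝓘(ℝ, EN) x₀ y ((show (EN →L[ℝ] ℝ) →L[ℝ] EN from
        S.reducedBivector G (S.gaugeBivector B) y) (b ∘L chartFwd 𝓘(ℝ, EN) x₀ y)) =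
      chartFwd 𝓘(ℝ, EN) x₀ (S.orbitProj G m') (tderiv 𝓘(ℝ, EM) 𝓘(ℝ, EN) (S.orbitProj G) m'
        ((show (EM →L[ℝ] ℝ) →L[ℝ] EM from S.gaugeBivector B m')
          ((b ∘L chartFwd 𝓘(ℝ, EN) x₀ (S.orbitProj G m')) ∘L
            tderiv 𝓘(ℝ, EM) 𝓘(ℝ, EN) (S.orbitProj G) m'))) := by
    rintro _ rfl b
    rw [S.reducedBivector_apply hι hρ hg hB hBi]
  ext b
  refine (key _ ((extChartAt 𝓘(ℝ, EN) x₀).left_inv hx) b).trans ?_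
  have h2 : ((b ∘L (chartFwd 𝓘(ℝ, EN) x₀ (S.orbitProj G m') ∘L
      tderiv 𝓘(ℝ, EM) 𝓘(ℝ, EN) (S.orbitProj G) m' ∘L chartInv 𝓘(ℝ, EM) m z)) ∘L
        chartFwd 𝓘(ℝ, EM) m m') =
      (b ∘L chartFwd 𝓘(ℝ, EN) x₀ (S.orbitProj G m')) ∘L
            tderiv 𝓘(ℝ, EM) 𝓘(ℝ, EN) (S.orbitProj G) m' := by
    ext u
    exact congrArg (fun u => b (chartFwd 𝓘(ℝ, EN) x₀ (S.orbitProj G m')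
      (tderiv 𝓘(ℝ, EM) 𝓘(ℝ, EN) (S.orbitProj G) m' u))) (h1 u)
  rw [← h2]
  exact (congrArg (fun u => chartFwd 𝓘(ℝ, EN) x₀ (S.orbitProj G m')
      (tderiv 𝓘(ℝ, EM) 𝓘(ℝ, EN) (S.orbitProj G) m' u)) (h1 _)).symm

/-- Skewness is inherited at any representative. The choice of representatives has no regularity, so
for smoothness it is replaced by a smooth local section of ρ, along which the coordinate expression
Dr P Dr^* is smooth. -/
theorem isBivectorField_reducedBivector
    {EG : Type*} [NormedAddCommGroup EG] [NormedSpace ℝ EG]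
    [TopologicalSpace G] [ChartedSpace EG G]
    (hι : Manifold.IsSmoothEmbedding 𝓘(ℝ, EM) (cotangentModel E) ∞ S.incl)
    (hρ : Manifold.IsSubmersion 𝓘(ℝ, EM) 𝓘(ℝ, EN) ∞ (S.orbitProj G))
    (hg : ∀ g : G, ContMDiff 𝓘(ℝ, EM) 𝓘(ℝ, EM) ∞ (fun m : S.M => g • m))
    [IsManifold 𝓘(ℝ, EM) 1 S.M] (W : S.VerticalComplement EM EG G)
    {B : ∀ m : S.M, TangentSpace 𝓘(ℝ, EM) m [⋀^Fin 2]→L[ℝ] ℝ}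
    (hBs : IsSmoothForm 𝓘(ℝ, EM) B) (hB : S.IsGauge B) (hBi : S.IsInvariantForm G B) :
    IsBivectorField 𝓘(ℝ, EN) (S.reducedBivector G (EN := EN) (S.gaugeBivector B)) := by
  have : IsManifold 𝓘(ℝ, EN) 1 (S.OrbitSpace G) := .of_le (n := ∞) (by simp)
  refine ⟨fun x α β => ?_, fun x₀ y hy => ContDiffAt.contDiffWithinAt ?_⟩
  · let T : EM →L[ℝ] EN := tderiv 𝓘(ℝ, EM) 𝓘(ℝ, EN) (S.orbitProj G) (Quotient.out x)
    exact (isSharp_gaugeBivector hι hB (Quotient.out x)).skew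
      ((show EN →L[ℝ] ℝ from α) ∘L T) ((show EN →L[ℝ] ℝ from β) ∘L T)
  obtain ⟨m, hm⟩ : ∃ m, S.orbitProj G m = (extChartAt 𝓘(ℝ, EN) x₀).symm y :=
    ⟨Quotient.out _, Quotient.out_eq _⟩
  have hmt := mem_extChartAt_target (I := 𝓘(ℝ, EM)) m
  obtain ⟨s, hs, hsm, hρs⟩ := exists_local_section (hρ.isSubmersionAt m)
  rw [hm] at hs hsm hρs
  have hsrc : s ((extChartAt 𝓘(ℝ, EN) x₀).symm y) ∈ (extChartAt 𝓘(ℝ, EM) m).source := by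
    rw [hsm]; exact mem_extChartAt_source m
  have hu : ContDiffAt ℝ ∞ (localExpr 𝓘(ℝ, EN) 𝓘(ℝ, EM) s x₀ m) y :=
    contDiffAt_localExpr (k := ⊤) hy hs hsrc
  have huy : localExpr 𝓘(ℝ, EN) 𝓘(ℝ, EM) s x₀ m y = extChartAt 𝓘(ℝ, EM) m m :=
    congrArg (extChartAt 𝓘(ℝ, EM) m) hsm
  have hr : ContDiffAt ℝ ∞ (localExpr 𝓘(ℝ, EM) 𝓘(ℝ, EN) (S.orbitProj G) m x₀)
      (extChartAt 𝓘(ℝ, EM) m m) := by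
    refine contDiffAt_localExpr (k := ⊤) hmt (hρ.contMDiff _) ?_
    rw [extChartAt_to_inv, hm]
    exact (extChartAt 𝓘(ℝ, EN) x₀).map_target hy
  have hDr := hr.fderiv_right (m := ∞) le_rfl
  have hF := hDr.clm_comp ((W.contDiffAt_gaugeBivector hι hBs hB m).clm_comp (NonholonomicGeometry.ContDiffAt.precomp hDr))
  rw [← huy] at hF
  refine (hF.comp y hu).congr_of_eventuallyEq ?_
  have hc := continuousAt_extChartAt_symm'' hy
  have h1 : ∀ᶠ y' in 𝓝 y, s ((extChartAt 𝓘(ℝ, EN) x₀).symm y') ∈ (extChartAt 𝓘(ℝ, EM) m).source :=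
    (ContinuousAt.comp (g := s) hs.continuousAt hc).eventually
      ((isOpen_extChartAt_source m).mem_nhds hsrc)
  filter_upwards [h1, hc.eventually hρs, chart_mem_nhds hy] with y' h1 h2 h3
  have e1 : (extChartAt 𝓘(ℝ, EM) m).symm (localExpr 𝓘(ℝ, EN) 𝓘(ℝ, EM) s x₀ m y') =
      s ((extChartAt 𝓘(ℝ, EN) x₀).symm y') := (extChartAt 𝓘(ℝ, EM) m).left_inv h1
  have e2 : localExpr 𝓘(ℝ, EM) 𝓘(ℝ, EN) (S.orbitProj G) m x₀
      (localExpr 𝓘(ℝ, EN) 𝓘(ℝ, EM) s x₀ m y') = y' := by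
    refine (congrArg (fun u => extChartAt 𝓘(ℝ, EN) x₀ (S.orbitProj G u)) e1).trans ?_
    rw [h2]
    exact (extChartAt 𝓘(ℝ, EN) x₀).right_inv h3
  have h4 := S.bivectorInChart_reducedBivector hι hρ.contMDiff hg hB hBi (x₀ := x₀)
    ((extChartAt 𝓘(ℝ, EM) m).map_source h1) (by
      refine (congrArg (fun u => u ∈ (extChartAt 𝓘(ℝ, EN) x₀).source)
        ((congrArg (S.orbitProj G) e1).trans h2)).mpr ?_
      exact (extChartAt 𝓘(ℝ, EN) x₀).map_target h3)
  exact (congrArg (bivectorInChart 𝓘(ℝ, EN) (S.reducedBivector G (S.gaugeBivector B)) x₀)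
    e2).symm.trans h4

end Reduction

end NonholonomicSystem

theorem neg_sharpThree_add {V : Type*} [NormedAddCommGroup V] [NormedSpace ℝ V]
    (π : (V →L[ℝ] ℝ) →L[ℝ] V) (φ ψ : V [⋀^Fin 3]→L[ℝ] ℝ) (α β γ : V →L[ℝ] ℝ) :
    -sharpThree π (φ + ψ) α β γ = φ ![π α, π β, π γ] + ψ ![π α, π β, π γ] := by
  unfold sharpThree
  rw [ContinuousAlternatingMap.add_apply]
  ring

/-! ### The Schouten bracket of the reduced field and the vanishing of ψ. -/

namespace NonholonomicSystem

namespace VerticalComplement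

variable {E : Type*} [NormedAddCommGroup E] [NormedSpace ℝ E] [FiniteDimensional ℝ E]
  {Q : Type*} [TopologicalSpace Q] [ChartedSpace E Q] [IsManifold 𝓘(ℝ, E) ∞ Q]
  {S : NonholonomicSystem E Q}
  {EM : Type*} [NormedAddCommGroup EM] [NormedSpace ℝ EM] [FiniteDimensional ℝ EM]
  [ChartedSpace EM S.M]
  {EG : Type*} [NormedAddCommGroup EG] [NormedSpace ℝ EG]
  {G : Type*} [TopologicalSpace G] [ChartedSpace EG G] [Group G]
  [MulAction G Q] [S.IsSymmetric G]

theorem curvature_apply_of_mem [IsManifold 𝓘(ℝ, EM) 1 S.M] (W : S.VerticalComplement EM EG G)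
    (m : S.M) {u v : EM}
    (hu : u ∈ (show Submodule ℝ EM from S.constraintDist m))
    (hv : v ∈ (show Submodule ℝ EM from S.constraintDist m)) :
    (W.curvature m : EM [⋀^Fin 2]→L[ℝ] EG) ![u, v] =
      (mextDeriv 𝓘(ℝ, EM) W.connForm m : EM [⋀^Fin 2]→L[ℝ] EG) ![u, v] := by
  refine (congrArg (mextDeriv 𝓘(ℝ, EM) W.connForm m : EM [⋀^Fin 2]→L[ℝ] EG)
    (comp_vec_two (W.projC m) u v)).trans ?_
  rw [W.projC_of_mem m hu, W.projC_of_mem m hv]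
  rfl

theorem projW_of_mem [IsManifold 𝓘(ℝ, EM) 1 S.M] (W : S.VerticalComplement EM EG G) (m : S.M)
    {v : EM} (hv : v ∈ (show Submodule ℝ EM from S.constraintDist m)) : W.projW m v = 0 := by
  exact Submodule.projection_apply_of_mem_right (W.isCompl m).symm hv

variable [LieGroup 𝓘(ℝ, EG) ∞ G] [ContMDiffSMul 𝓘(ℝ, EG) 𝓘(ℝ, E) ∞ G Q]
  [IsCancelSMul G Q] [FiniteDimensional ℝ EG] [IsManifold 𝓘(ℝ, EM) ∞ S.M]
  {EN : Type*} [NormedAddCommGroup EN] [NormedSpace ℝ EN] [ChartedSpace EN (S.OrbitSpace G)]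
  [IsManifold 𝓘(ℝ, EN) ∞ (S.OrbitSpace G)]

/-- The Schouten bracket of the reduced bivector field. -/
theorem schoutenSelf_reducedBivector [IsManifold 𝓘(ℝ, EM) 1 S.M]
    (hι : Manifold.IsSmoothEmbedding 𝓘(ℝ, EM) (cotangentModel E) ∞ S.incl)
    (hρ : Manifold.IsSubmersion 𝓘(ℝ, EM) 𝓘(ℝ, EN) ∞ (S.orbitProj G))
    (W : S.VerticalComplement EM EG G)
    {B : ∀ m : S.M, TangentSpace 𝓘(ℝ, EM) m [⋀^Fin 2]→L[ℝ] ℝ}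
    (hBs : IsSmoothForm 𝓘(ℝ, EM) B) (hB : S.IsGauge B) (hBi : S.IsInvariantForm G B)
    (hBW : ∀ (m : S.M), ∀ Z ∈ W.dist m, ∀ X : TangentSpace 𝓘(ℝ, EM) m, B m ![Z, X] = 0)
    (m : S.M) (a b c : EN →L[ℝ] ℝ) :
    (1 / 2) * schoutenSelf 𝓘(ℝ, EN) (S.reducedBivector G (S.gaugeBivector B))
        (S.orbitProj G m) a b c =
      -sharpThree (V := EM) (S.gaugeBivector B m)
        (mextDeriv 𝓘(ℝ, EM) B m + W.momentumCurvature m)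
        (a ∘L tderiv 𝓘(ℝ, EM) 𝓘(ℝ, EN) (S.orbitProj G) m)
        (b ∘L tderiv 𝓘(ℝ, EM) 𝓘(ℝ, EN) (S.orbitProj G) m)
        (c ∘L tderiv 𝓘(ℝ, EM) 𝓘(ℝ, EN) (S.orbitProj G) m) := by
  have : IsManifold 𝓘(ℝ, EN) 1 (S.OrbitSpace G) := .of_le (n := ∞) (by simp)
  have hg := S.contMDiff_smul_const EG hι (G := G)
  have hmt := mem_extChartAt_target (I := 𝓘(ℝ, EM)) m
  set x := extChartAt 𝓘(ℝ, EM) m m with hx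
  set x₀ := S.orbitProj G m with hx₀
  set r := localExpr 𝓘(ℝ, EM) 𝓘(ℝ, EN) (S.orbitProj G) m x₀ with hr
  set P := bivectorInChart 𝓘(ℝ, EM) (S.gaugeBivector B) m with hP
  set p := bivectorInChart 𝓘(ℝ, EN) (S.reducedBivector G (S.gaugeBivector B)) x₀ with hp
  have hrx : r x = extChartAt 𝓘(ℝ, EN) x₀ x₀ := by
    simp [hr, hx, localExpr, hx₀]
  have hDrx : fderiv ℝ r x = tderiv 𝓘(ℝ, EM) 𝓘(ℝ, EN) (S.orbitProj G) m :=
    (tderiv_eq_fderiv_localExpr (hρ.contMDiff.mdifferentiable (by simp) m)).symm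
  have hrs : ContDiffAt ℝ ∞ r x := by
    refine contDiffAt_localExpr (k := ⊤) hmt (hρ.contMDiff _) ?_
    rw [extChartAt_to_inv]
    exact mem_extChartAt_source x₀
  have hPs : ContDiffAt ℝ ∞ P x := W.contDiffAt_gaugeBivector hι hBs hB m
  have hps : ContDiffAt ℝ ∞ p (r x) := by
    rw [hrx]
    exact ((S.isBivectorField_reducedBivector hι hρ hg W hBs hB hBi).smooth x₀).contDiffAt
      (chart_mem_nhds (mem_extChartAt_target x₀))
  set T := tderiv 𝓘(ℝ, EM) 𝓘(ℝ, EN) (S.orbitProj G) m with hT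
  set π : (EM →L[ℝ] ℝ) →L[ℝ] EM := S.gaugeBivector B m with hπ
  -- The sign makes i_X(Ω − B) equal to the pullback of `a` on 𝓒. The covector `a` is constant in
  -- the chart at ρ(m), as in the coordinate definition of `schoutenSelf`.
  set X : (EN →L[ℝ] ℝ) → EM → EM := fun a y => -P y (a ∘L fderiv ℝ r y) with hX
  have hXs : ∀ a, DifferentiableAt ℝ (X a) x := fun a =>
    ((hPs.clm_apply (contDiffAt_const.clm_comp
      (hrs.fderiv_right (m := ∞) le_rfl))).differentiableAt (by simp)).neg
  have hXx : ∀ a, X a x = -π (a ∘L T) := by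
    intro a
    rw [hX, ← hDrx]
    exact congrArg Neg.neg (DFunLike.congr_fun (bivectorInChart_self (S.gaugeBivector B) m) _)
  have hΩ := (S.contDiffAt_formInChart_twoForm hι.contMDiff hmt).differentiableAt (by simp)
  have hBd : DifferentiableAt ℝ (formInChart 𝓘(ℝ, EM) B m) x :=
    ((hBs m).contDiffAt (chart_mem_nhds hmt)).differentiableAt (by simp)
  have hσ : formInChart 𝓘(ℝ, EM) (S.twoForm - B) m =
    formInChart 𝓘(ℝ, EM) S.twoForm m + (-1 : ℝ) • formInChart 𝓘(ℝ, EM) B m := by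
    rw [neg_one_smul, ← sub_eq_add_neg]
    rfl
  have hdσ : extDeriv (formInChart 𝓘(ℝ, EM) (S.twoForm - B) m) x =
      -(mextDeriv 𝓘(ℝ, EM) B m : EM [⋀^Fin 3]→L[ℝ] ℝ) := by
    rw [hσ, extDeriv_add hΩ (hBd.const_smul _), S.extDeriv_formInChart_twoForm hι.contMDiff hmt,
      extDeriv_smul, neg_one_smul, zero_add, mextDeriv_eq]
    rfl
  have hsharp : ∀ᶠ y in 𝓝 x, IsSharp (distInChart S.constraintDist m y)
      (formInChart 𝓘(ℝ, EM) (S.twoForm - B) m y) (P y) := by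
    filter_upwards [chart_mem_nhds hmt] with y hy
    exact IsSharp.inChart hy (isSharp_gaugeBivector hι hB _)
  have hsrc : ∀ᶠ y in 𝓝 x, S.orbitProj G ((extChartAt 𝓘(ℝ, EM) m).symm y) ∈
      (extChartAt 𝓘(ℝ, EN) x₀).source := by
    have h1 : ContinuousAt (fun y => S.orbitProj G ((extChartAt 𝓘(ℝ, EM) m).symm y)) x :=
      ContinuousAt.comp (g := S.orbitProj G) hρ.contMDiff.continuous.continuousAt
        (continuousAt_extChartAt_symm'' hmt)
    refine h1.eventually ((isOpen_extChartAt_source x₀).mem_nhds ?_)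
    change S.orbitProj G ((extChartAt 𝓘(ℝ, EM) m).symm x) ∈ _
    rw [hx, extChartAt_to_inv]
    exact mem_extChartAt_source x₀
  set A := formInChart 𝓘(ℝ, EM) W.connForm m with hA
  have hAx : A x = (W.connForm m : EM [⋀^Fin 1]→L[ℝ] EG) := formInChart_self _ _
  set i : EG →L[ℝ] EM := S.infAction EM EG G m with hi
  have hiA : ∀ v, i (A x ![v]) = W.projW m v := fun v => by
    rw [hAx]
    exact W.infAction_connForm hι m v
  have hCx : ∀ v, v ∈ distInChart S.constraintDist m x ↔
      v ∈ (show Submodule ℝ EM from S.constraintDist m) := by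
    intro v
    rw [mem_distInChart, hx, chartInv_self, extChartAt_to_inv]
    rfl
  have hJac := jacobiator_eq (r := r) (p := p) (X := X)
    (σ := formInChart 𝓘(ℝ, EM) (S.twoForm - B) m) (A := A) (i := i)
    (dJ := tderiv 𝓘(ℝ, EM) 𝓘(ℝ, EG →L[ℝ] ℝ) (S.momentum EM EG G) m)
    (C := distInChart S.constraintDist m) (x := x)
    (hrs.of_le two_le_infty) (hps.differentiableAt (by simp)) hXs
    (by rw [hσ]; exact hΩ.add (hBd.const_smul _))
    ((W.contDiffAt_formInChart_connForm hι m).differentiableAt (by simp))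
    (fun a => by
      filter_upwards [hsharp] with y hy
      exact Submodule.neg_mem _ (hy _).1)
    (fun a => by
      filter_upwards [hsharp] with y hy v hv
      rw [hX, alternating_two_neg_left, (hy _).2 v hv, neg_neg]
      rfl)
    (fun a => by
      filter_upwards [chart_mem_nhds hmt, hsrc] with y hy hy'
      rw [hX, map_neg, neg_neg]
      exact DFunLike.congr_fun
        (S.bivectorInChart_reducedBivector hι hρ.contMDiff hg hB hBi hy hy') a)
    (by
      filter_upwards with y v hv
      rw [hA, formInChart_apply_one]
      refine (W.connForm_iff _ (S.infAction_injective hι _) _ 0).2 ?_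
      have h1 := W.projW_of_mem _ hv
      exact h1.trans (map_zero (S.infAction EM EG G
        ((extChartAt 𝓘(ℝ, EM) m).symm y) : EG →L[ℝ] EM)).symm)
    (fun v => by
      rw [hCx, hiA]
      have h1 := W.projC_add_projW m v
      rw [← eq_sub_iff_add_eq] at h1
      rw [← h1]
      exact W.projC_mem m v)
    (fun ξ => by
      rw [hDrx]
      exact S.tderiv_orbitProj_infAction hρ.contMDiff (S.contMDiff_orbitMap hι m) ξ)
    -- The vertical component lies in 𝓦, which B annihilates; only Ω remains, and the momentum
    -- equation evaluates it.
    (fun w v _ => by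
      have h1 := hBW m _ (W.projW_mem m w) v
      have h2 := congrArg (fun u : EM => (B m : EM [⋀^Fin 2]→L[ℝ] ℝ) ![u, v]) (hiA w)
      have h3 := congrArg (fun σ => σ ![i (A x ![w]), v]) (formInChart_self (S.twoForm - B) m)
      exact (h3.trans (alternating_two_sub (V := EM) (S.twoForm m) (B m) _ v)).trans
        ((sub_eq_self.2 (h2.trans h1)).trans (S.twoForm_infAction hι m (A x ![w]) v)))
    a b c
  have hXC : ∀ a, π (a ∘L T) ∈ (show Submodule ℝ EM from S.constraintDist m) := fun a =>
    (isSharp_gaugeBivector hι hB m _).1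
  rw [schoutenSelf_eq, ← hp, ← hrx]
  have hdA : extDeriv A x = (mextDeriv 𝓘(ℝ, EM) W.connForm m : EM [⋀^Fin 2]→L[ℝ] EG) :=
    (mextDeriv_eq W.connForm m).symm
  -- The two signs cancel, and P_𝓒 is the identity on the values of π_B, so dA_𝓦 may be replaced by
  -- the curvature.
  have hK : ∀ a b, extDeriv A x ![-π (a ∘L T), -π (b ∘L T)] =
      (W.curvature m : EM [⋀^Fin 2]→L[ℝ] EG) ![π (a ∘L T), π (b ∘L T)] := by
    intro a b
    rw [alternating_two_neg_left, alternating_two_swap, alternating_two_neg_left, neg_neg,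
      alternating_two_swap, neg_neg, hdA]
    exact (W.curvature_apply_of_mem m (hXC a) (hXC b)).symm
  have hw := wedgeDual_apply (tderiv 𝓘(ℝ, EM) 𝓘(ℝ, EG →L[ℝ] ℝ) (S.momentum EM EG G) m)
    (W.curvature m : EM [⋀^Fin 2]→L[ℝ] EG) (π (a ∘L T)) (π (b ∘L T)) (π (c ∘L T))
  refine Eq.trans ?_ (neg_sharpThree_add (V := EM) π _ _ _ _ _).symm
  refine Eq.trans ?_ (congrArg (_ + ·) hw.symm)
  -- The three signs of X = −π_B♯ρ^* cancel against d(Ω − B) = −dB.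
  have hdB : ∀ u v w : EM, extDeriv (formInChart 𝓘(ℝ, EM) (S.twoForm - B) m) x ![-u, -v, -w] =
      (mextDeriv 𝓘(ℝ, EM) B m : EM [⋀^Fin 3]→L[ℝ] ℝ) ![u, v, w] := by
    intro u v w
    rw [alternating_three_neg, hdσ]
    exact neg_neg _
  rw [hXx, hXx, hXx, hdB, hK, hK, hK] at hJac
  have hneg : ∀ (u : EM) (ξ : EG), tderiv 𝓘(ℝ, EM) 𝓘(ℝ, EG →L[ℝ] ℝ) (S.momentum EM EG G) m (-u) ξ =
      -tderiv 𝓘(ℝ, EM) 𝓘(ℝ, EG →L[ℝ] ℝ) (S.momentum EM EG G) m u ξ := fun u ξ => by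
    rw [map_neg]
    rfl
  rw [hneg, hneg, hneg] at hJac
  rw [← mul_assoc, one_div, inv_mul_cancel₀ two_ne_zero, one_mul, hJac]
  have key : ∀ s p q r : ℝ, s - (-p + -q + -r) = s + (p + q + r) := fun s p q r => by ring
  exact key _ _ _ _

/-- Each term evaluates a covector pulled back by ρ on an infinitesimal generator, which is tangent
to the orbit and hence killed by Tρ; nothing about π or the curvature is needed. -/
theorem psi_pullCovector [IsManifold 𝓘(ℝ, EM) 1 S.M]
    (hι : Manifold.IsSmoothEmbedding 𝓘(ℝ, EM) (cotangentModel E) ∞ S.incl)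
    (hρ : ContMDiff 𝓘(ℝ, EM) 𝓘(ℝ, EN) ∞ (S.orbitProj G))
    (W : S.VerticalComplement EM EG G) (π : SharpField 𝓘(ℝ, EM) S.M) (m : S.M)
    (α β γ : TangentSpace 𝓘(ℝ, EN) (S.orbitProj G m) →L[ℝ] ℝ) :
    W.psi π m (S.pullCovector G m α) (S.pullCovector G m β) (S.pullCovector G m γ) = 0 := by
  have h : ∀ (δ : TangentSpace 𝓘(ℝ, EN) (S.orbitProj G m) →L[ℝ] ℝ) (ξ : EG),
      S.pullCovector G m δ ((S.infAction EM EG G m : EG →L[ℝ] EM) ξ) = 0 := fun δ ξ =>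
    (congrArg (show EN →L[ℝ] ℝ from δ) (S.tderiv_orbitProj_infAction hρ
      (S.contMDiff_orbitMap hι m) ξ)).trans (map_zero (show EN →L[ℝ] ℝ from δ))
  unfold psi
  refine (congrArg₂ (· + ·) (congrArg₂ (· + ·) (h γ _) (h α _)) (h β _)).trans ?_
  norm_num

end VerticalComplement

end NonholonomicSystem

end NonholonomicGeometry

end

open NonholonomicGeometry in
theorem mainTheorem3
    {E : Type*} [NormedAddCommGroup E] [NormedSpace ℝ E] [FiniteDimensional ℝ E]
    {Q : Type*} [TopologicalSpace Q] [T2Space Q] [ChartedSpace E Q] [IsManifold 𝓘(ℝ, E) ∞ Q]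
    (S : NonholonomicSystem E Q)
    -- the symmetry group, acting freely and properly
    {EG : Type*} [NormedAddCommGroup EG] [NormedSpace ℝ EG] [FiniteDimensional ℝ EG]
    {G : Type*} [TopologicalSpace G] [ChartedSpace EG G] [Group G] [LieGroup 𝓘(ℝ, EG) ∞ G]
    [MulAction G Q] [ContMDiffSMul 𝓘(ℝ, EG) 𝓘(ℝ, E) ∞ G Q] [IsCancelSMul G Q] [ProperSMul G Q]
    [S.IsSymmetric G]
    -- the smooth structure of `𝓜` as an embedded submanifold of `T*Q`
    {EM : Type*} [NormedAddCommGroup EM] [NormedSpace ℝ EM] [FiniteDimensional ℝ EM]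
    [ChartedSpace EM S.M] [IsManifold 𝓘(ℝ, EM) ∞ S.M]
    (h_incl : Manifold.IsSmoothEmbedding 𝓘(ℝ, EM) (cotangentModel E) ∞ S.incl)
    -- the smooth structure of the orbit space `𝓜/G`, for which `ρ` is a submersion
    {EN : Type*} [NormedAddCommGroup EN] [NormedSpace ℝ EN] [FiniteDimensional ℝ EN]
    [ChartedSpace EN (S.OrbitSpace G)] [IsManifold 𝓘(ℝ, EN) ∞ (S.OrbitSpace G)]
    (h_proj : Manifold.IsSubmersion 𝓘(ℝ, EM) 𝓘(ℝ, EN) ∞ (S.orbitProj G))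
    -- the dimension assumption
    (h_dim : ∀ m : S.M, S.constraintDist m ⊔ S.vertical EM EG G m = ⊤)
    (W : S.VerticalComplement EM EG G)
    (B : ∀ m : S.M, TangentSpace 𝓘(ℝ, EM) m [⋀^Fin 2]→L[ℝ] ℝ)
    (hB_smooth : IsSmoothForm 𝓘(ℝ, EM) B)
    (hB_inv : S.IsInvariantForm G B)
    (hB_W : ∀ (m : S.M), ∀ Z ∈ W.dist m, ∀ X : TangentSpace 𝓘(ℝ, EM) m, B m ![Z, X] = 0)
    (hB_gauge : S.IsGauge B) :
    -- `π_B` induces a smooth bivector field `π_red` on `𝓜/G`, `Tρ ∘ π_B♯ ∘ ρ^* = π_red♯`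
    IsBivectorField 𝓘(ℝ, EN) (S.reducedBivector G (EN := EN) (S.gaugeBivector B)) ∧
    (∀ (m : S.M) (α : TangentSpace 𝓘(ℝ, EN) (S.orbitProj G m) →L[ℝ] ℝ),
      mfderiv 𝓘(ℝ, EM) 𝓘(ℝ, EN) (S.orbitProj G) m (S.gaugeBivector B m (S.pullCovector G m α)) =
        S.reducedBivector G (S.gaugeBivector B) (S.orbitProj G m) α) ∧
    -- `½ [π_red, π_red] = -π_B♯(dB + dJ ∧ K_W) ∘ ρ^*`
    (∀ (m : S.M) (α β γ : TangentSpace 𝓘(ℝ, EN) (S.orbitProj G m) →L[ℝ] ℝ),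
      (1 / 2) * schoutenSelf 𝓘(ℝ, EN) (S.reducedBivector G (S.gaugeBivector B))
          (S.orbitProj G m) α β γ =
        -sharpThree (V := EM) (S.gaugeBivector B m)
          (mextDeriv 𝓘(ℝ, EM) B m + W.momentumCurvature m)
          (S.pullCovector G m α) (S.pullCovector G m β) (S.pullCovector G m γ)) ∧
    -- the term `ψ` vanishes after reduction: `ψ ∘ ρ^* = 0`
    (∀ (m : S.M) (α β γ : TangentSpace 𝓘(ℝ, EN) (S.orbitProj G m) →L[ℝ] ℝ),
      W.psi (S.gaugeBivector B) m
        (S.pullCovector G m α) (S.pullCovector G m β) (S.pullCovector G m γ) = 0) := by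
  have hg := S.contMDiff_smul_const EG h_incl (G := G)
  refine ⟨S.isBivectorField_reducedBivector h_incl h_proj hg W hB_smooth hB_gauge hB_inv,
    fun m α => S.reducedBivector_apply h_incl h_proj.contMDiff hg hB_gauge hB_inv m α,
    fun m α β γ => W.schoutenSelf_reducedBivector h_incl h_proj hB_smooth hB_gauge hB_inv hB_W m
      α β γ,
    fun m α β γ => W.psi_pullCovector h_incl h_proj.contMDiff (S.gaugeBivector B) m α β γ⟩
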